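/- Let $M,N\ge 0$ and let $q\in\mathbb C$ be nonzero and not a root of unity. For $1\le a\le M+N$ put $[a]=0$ if $a\le M$ and $[a]=1$ if $a>M$. All tensor products are $\mathbb Z_2$-graded, $V$ is the superspace with basis $v^a$ of parity $[a]$, and $e^a_b\in\mathrm{End}(V)$ are the matrix units, of parity $[a]+[b]$. **The quantum supergroup.** $U_q(gl(M|N))$ is the $\mathbb Z_2$-graded unital complex algebra generated by the even elements $q^{\pm E^a_a}$ ($1\le a\le M+N$) and the elements $E^a_{a+1},E^{a+1}_a$ ($1\le a<M+N$) of parity $[a]+[a+1]$, with the relations: the $q^{\pm E^a_a}$ are mutually inverse and commute; $q^{E^a_a}E^b_{b\pm1}=q^{\delta_{a,b}-\delta_{a,b\pm1}}E^b_{b\pm1}q^{E^a_a}$; $[E^a_{a+1},E^{b+1}_b\}=(-1)^{[a]}\delta_{ab}\,(q^{h_a}-q^{-h_a})/(q-q^{-1})$ with $h_a=(-1)^{[a]}E^a_a-(-1)^{[a+1]}E^{a+1}_{a+1}$; $(E^M_{M+1})^2=(E^{M+1}_M)^2=0$; $E^a_{a+1}E^b_{b+1}=E^b_{b+1}E^a_{a+1}$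 and $E^{a+1}_aE^{b+1}_b=E^{b+1}_bE^{a+1}_a$ for $|a-b|\ge2$; for $a\ne M$ and $b=a\pm1$, $(E^a_{a+1})^2E^b_{b+1}-(q+q^{-1})E^a_{a+1}E^b_{b+1}E^a_{a+1}+E^b_{b+1}(E^a_{a+1})^2=0$ and the same with $E^{a+1}_a,E^{b+1}_b$ in place of $E^a_{a+1},E^b_{b+1}$; and, if $M,N\ge2$, $[E^{M-1}_{M+2},E^M_{M+1}\}=[E^{M+2}_{M-1},E^{M+1}_M\}=0$. Here $[\cdot,\cdot\}$ is the graded commutator, and for $b>a+1$ the elements $E^a_b,E^b_a$ are defined recursively by the following formulas with $c=b-1$: $$E^a_b=E^a_cE^c_b-q^{-(-1)^{[c]}}E^c_bE^a_c,\qquad E^b_a=E^b_cE^c_a-q^{(-1)^{[c]}}E^c_aE^b_c .\qquad(1)$$ **The quantum super Yangian.** Let $$R(x)=q^{\sum_a(-1)^{[a]}e^a_a\otimes e^a_a}-x^{-1}q^{-\sum_a(-1)^{[a]}e^a_a\otimes e^a_a}+(q-q^{-1})\Big(x^{-1}\sum_{a<b}+\sum_{a>b}\Big)(-1)^{[b]}e^a_b\otimes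 e^b_a .$$ $Y_q(gl(M|N))$ is the $\mathbb Z_2$-graded unital complex algebra generated by $T^a_b[k]$, $k\ge0$, $1\le a,b\le M+N$, of parity $[a]+[b]$, with the relations $$R_{12}(x)L_1(xy)L_2(y)=L_2(y)L_1(xy)R_{12}(x),\qquad L(x)=\sum_{a,b}(-1)^{[b]}e^a_b\otimes\sum_{k\ge0}x^{-k}T^b_a[k],\qquad(2)$$ an identity of formal power series in $x^{-1}$ and $y^{-1}$. **Theorem.** In $U_q(gl(M|N))$ the formulas (1) hold for all $a<c<b$. Define $$l^{(+)}=q^{\sum_a(-1)^{[a]}e^a_a\otimes E^a_a}\Big\{1\otimes1+(q-q^{-1})\sum_{a<b}(-1)^{[a]}e^b_a\otimes E^a_b\Big\},$$ $$l^{(-)}=\Big\{1\otimes1-(q-q^{-1})\sum_{a<b}(-1)^{[b]}e^a_b\otimes E^b_a\Big\}q^{-\sum_a(-1)^{[a]}e^a_a\otimes E^a_a},\qquad l(x)=\frac{l^{(+)}-x^{-1}l^{(-)}}{1-x^{-1}},$$ where $l(x)$ is expanded as a power series in $x^{-1}$. Then $$R_{12}(x)\,l_1(xy)\,l_2(y)=l_2(y)\,l_1(xy)\,R_{12}(x),$$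 and there is a unique homomorphism of unital algebras $\Lambda:Y_q(gl(M|N))\to U_q(gl(M|N))$ with $(\mathrm{id}\otimes\Lambda)(L(x))=l(x)$. It preserves the $\mathbb Z_2$-grading and is surjective. -/

import Mathlib

namespace SuperYangian

noncomputable section

/-! ### Superalgebras over the complex numbers -/

/-- The sign `(-1)^i` for `i` in `ℤ/2`. -/
def sgn (i : ZMod 2) : ℤ := if i = 0 then 1 else -1

theorem sgn_zero : sgn 0 = 1 := rfl

theorem sgn_add (i j : ZMod 2) : sgn (i + j) = sgn i * sgn j := by
  revert i j; decide

theorem sgn_mul_self (i : ZMod 2) : sgn i * sgn i = 1 := by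
  revert i; decide

/-- A `ℤ/2`-graded algebra structure on a complex algebra, given by its parity automorphism: the
algebra involution that is `+1` on even and `-1` on odd elements.  The homogeneous parts are
recovered as its eigenspaces in `homPart`; they form a grading, see `gradedAlgebra`. -/
class Superalgebra (A : Type*) [Ring A] [Algebra ℂ A] where
  parity : A →ₐ[ℂ] A
  parity_parity : ∀ x, parity (parity x) = x

section Basic

variable {A : Type*} [Ring A] [Algebra ℂ A] [Superalgebra A]

/-- The `i`-th power of the parity automorphism: `(-1)^{i [x]} x` for homogeneous `x`. -/
def twist (i : ZMod 2) : A →ₐ[ℂ] A :=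
  if i = 0 then AlgHom.id ℂ A else Superalgebra.parity

theorem twist_zero (x : A) : twist 0 x = x := by simp [twist]

theorem twist_one (x : A) : twist 1 x = Superalgebra.parity x := by simp [twist]

theorem twist_twist (i j : ZMod 2) (x : A) : twist i (twist j x) = twist (i + j) x := by
  have h : ∀ k : ZMod 2, k = 0 ∨ k = 1 := by decide
  rcases h i with rfl | rfl <;> rcases h j with rfl | rfl <;>
    simp [twist, Superalgebra.parity_parity, show (1 : ZMod 2) + 1 = 0 from rfl]

variable (A) in
/-- The homogeneous part of degree `i` of a superalgebra. -/
def homPart (i : ZMod 2) : Submodule ℂ A where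
  carrier := {x | Superalgebra.parity x = sgn i • x}
  add_mem' := by
    intro x y hx hy
    simp only [Set.mem_ofPred_eq] at *
    rw [map_add, hx, hy, smul_add]
  zero_mem' := by simp
  smul_mem' := by
    intro c x hx
    simp only [Set.mem_ofPred_eq] at *
    rw [map_smul, hx, smul_comm]

theorem mem_homPart {i : ZMod 2} {x : A} :
    x ∈ homPart A i ↔ Superalgebra.parity x = sgn i • x := Iff.rfl

theorem one_mem_homPart : (1 : A) ∈ homPart A 0 := by simp [mem_homPart, sgn]

theorem mul_mem_homPart {i j : ZMod 2} {x y : A} (hx : x ∈ homPart A i) (hy : y ∈ homPart A j) :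
    x * y ∈ homPart A (i + j) := by
  rw [mem_homPart] at *
  rw [map_mul, hx, hy, sgn_add, smul_mul_smul_comm]

theorem mul_mem_homPart' {i j : ZMod 2} {x y : A} (hx : x ∈ homPart A i) (hy : y ∈ homPart A j) :
    y * x ∈ homPart A (i + j) := by
  rw [add_comm]
  exact mul_mem_homPart hy hx

instance : SetLike.GradedMonoid (homPart A) where
  one_mem := one_mem_homPart
  mul_mem _ _ _ _ hx hy := mul_mem_homPart hx hy

theorem half_mem (i : ZMod 2) (x : A) :
    (2⁻¹ : ℂ) • (x + sgn i • Superalgebra.parity x) ∈ homPart A i := by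
  rw [mem_homPart]
  rw [map_smul, map_add, map_zsmul, Superalgebra.parity_parity, smul_comm (sgn i), smul_add (sgn i),
    smul_smul, sgn_mul_self, one_smul, add_comm]

variable (A) in
/-- The projection of a superalgebra to its homogeneous part of degree `i`. -/
def proj (i : ZMod 2) : A →ₗ[ℂ] homPart A i where
  toFun x := ⟨_, half_mem i x⟩
  map_add' x y := by
    ext
    simp only [map_add, smul_add, Submodule.coe_add]
    abel
  map_smul' c x := by
    ext
    simp only [map_smul, RingHom.id_apply, SetLike.val_smul]
    rw [smul_comm (sgn i) c, ← smul_add, smul_comm]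

theorem proj_self {i : ZMod 2} (x : homPart A i) : proj A i x = x := by
  ext
  change (2⁻¹ : ℂ) • ((x : A) + sgn i • Superalgebra.parity (x : A)) = x
  rw [mem_homPart.1 x.2, smul_smul, sgn_mul_self, one_smul, ← two_smul ℂ, smul_smul]
  norm_num

theorem proj_add_one {i : ZMod 2} (x : homPart A i) : proj A (i + 1) x = 0 := by
  ext
  change (2⁻¹ : ℂ) • ((x : A) + sgn (i + 1) • Superalgebra.parity (x : A)) = 0
  rw [mem_homPart.1 x.2, smul_smul, sgn_add, mul_right_comm, sgn_mul_self]
  simp [sgn]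

/-- The homogeneous parts of a superalgebra form a `ℤ/2`-grading. -/
instance gradedAlgebra : GradedAlgebra (homPart A) :=
  { toDecomposition := DirectSum.Decomposition.ofLinearMap (homPart A)
      (DirectSum.lof ℂ (ZMod 2) (fun i => homPart A i) 0 ∘ₗ proj A 0 +
        DirectSum.lof ℂ (ZMod 2) (fun i => homPart A i) 1 ∘ₗ proj A 1)
      (by
        ext x
        simp only [LinearMap.comp_apply, LinearMap.add_apply, map_add, DirectSum.coeLinearMap_lof,
          LinearMap.id_apply]
        change (2⁻¹ : ℂ) • (x + sgn 0 • Superalgebra.parity x) +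
          (2⁻¹ : ℂ) • (x + sgn 1 • Superalgebra.parity x) = x
        rw [← smul_add]
        simp only [sgn, one_ne_zero, if_true, if_false, one_smul, neg_smul]
        rw [show x + Superalgebra.parity x + (x + -Superalgebra.parity x) = (2 : ℂ) • x by
          rw [two_smul]; abel, smul_smul]
        norm_num)
      (by
        apply DirectSum.linearMap_ext
        intro i
        ext1 x
        have h : ∀ k : ZMod 2, k = 0 ∨ k = 1 := by decide
        have h0 := proj_self x
        have h1 := proj_add_one x
        rcases h i with rfl | rfl
        · rw [show (0 : ZMod 2) + 1 = 1 from rfl] at h1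
          simp only [LinearMap.comp_apply, LinearMap.add_apply, DirectSum.coeLinearMap_lof,
            LinearMap.id_apply, h0, h1, map_zero, add_zero]
        · rw [show (1 : ZMod 2) + 1 = 0 from rfl] at h1
          simp only [LinearMap.comp_apply, LinearMap.add_apply, DirectSum.coeLinearMap_lof,
            LinearMap.id_apply, h0, h1, map_zero, zero_add]) }

end Basic

/-! ### The superalgebra `End V ⊗ A` -/

/-- For a superspace `V` with homogeneous basis `v^a` of parities `p a` and a superalgebra `A`, the
superalgebra `End V ⊗ A` (graded tensor product).  The entry `X a b` is the coefficient of the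
matrix unit `e^a_b`, that is `X = ∑ e^a_b ⊗ X a b`. -/
structure EndTensor {n : ℕ} (p : Fin n → ZMod 2) (A : Type*) where
  mk ::
  coef : Fin n → Fin n → A

namespace EndTensor

variable {n : ℕ} {p : Fin n → ZMod 2} {A : Type*}

instance : CoeFun (EndTensor p A) (fun _ => Fin n → Fin n → A) := ⟨coef⟩

@[simp] theorem mk_apply (f : Fin n → Fin n → A) (a b : Fin n) :
    (mk f : EndTensor p A) a b = f a b := rfl

@[ext] theorem ext {X Y : EndTensor p A} (h : ∀ a b, X a b = Y a b) : X = Y := by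
  cases X; cases Y; congr; funext a b; exact h a b

theorem coef_injective : Function.Injective (coef : EndTensor p A → Fin n → Fin n → A) :=
  fun _ _ h => ext fun a b => congrFun (congrFun h a) b

instance {S : Type*} [SMul S A] : SMul S (EndTensor p A) := ⟨fun c X => mk fun a b => c • X a b⟩

@[simp] theorem smul_apply {S : Type*} [SMul S A] (c : S) (X : EndTensor p A)
    (a b : Fin n) : (c • X) a b = c • X a b := rfl

variable [Ring A]

instance : Zero (EndTensor p A) := ⟨mk fun _ _ => 0⟩
instance : Add (EndTensor p A) := ⟨fun X Y => mk fun a b => X a b + Y a b⟩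
instance : Neg (EndTensor p A) := ⟨fun X => mk fun a b => -X a b⟩
instance : Sub (EndTensor p A) := ⟨fun X Y => mk fun a b => X a b - Y a b⟩

instance : AddCommGroup (EndTensor p A) :=
  coef_injective.addCommGroup _ rfl (fun _ _ => rfl) (fun _ => rfl) (fun _ _ => rfl)
    (fun _ _ => rfl) (fun _ _ => rfl)

@[simp] theorem zero_apply (a b : Fin n) : (0 : EndTensor p A) a b = 0 := rfl

@[simp] theorem add_apply (X Y : EndTensor p A) (a b : Fin n) : (X + Y) a b = X a b + Y a b := rfl

instance [Algebra ℂ A] : Module ℂ (EndTensor p A) :=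
  coef_injective.module ℂ ⟨⟨coef, rfl⟩, fun _ _ => rfl⟩ (fun _ _ => rfl)

instance : One (EndTensor p A) := ⟨mk fun a b => if a = b then 1 else 0⟩

theorem one_apply (a b : Fin n) : (1 : EndTensor p A) a b = if a = b then 1 else 0 := rfl

variable [Algebra ℂ A] [Superalgebra A]

/-- The multiplication `(e ⊗ u) (e' ⊗ u') = (-1)^{[u] [e']} e e' ⊗ u u'`. -/
instance : Mul (EndTensor p A) :=
  ⟨fun X Y => mk fun a b => ∑ c, twist (p c + p b) (X a c) * Y c b⟩

theorem mul_apply (X Y : EndTensor p A) (a b : Fin n) :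
    (X * Y) a b = ∑ c, twist (p c + p b) (X a c) * Y c b := rfl

instance : Ring (EndTensor p A) :=
  { (inferInstance : AddCommGroup (EndTensor p A)),
    (inferInstance : One (EndTensor p A)),
    (inferInstance : Mul (EndTensor p A)) with
    left_distrib := fun X Y Z => by
      ext a b; simp [mul_apply, mul_add, Finset.sum_add_distrib]
    right_distrib := fun X Y Z => by
      ext a b; simp [mul_apply, add_mul, Finset.sum_add_distrib]
    zero_mul := fun X => by ext a b; simp [mul_apply]
    mul_zero := fun X => by ext a b; simp [mul_apply]
    mul_assoc := fun X Y Z => by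
      ext a b
      simp only [mul_apply, map_sum, map_mul, twist_twist, Finset.sum_mul, Finset.mul_sum]
      rw [Finset.sum_comm]
      refine Finset.sum_congr rfl fun c _ => Finset.sum_congr rfl fun d _ => ?_
      rw [mul_assoc]
      congr 2
      have key : ∀ x y z : ZMod 2, z + x + (y + z) = y + x := by decide
      rw [key]
    one_mul := fun X => by
      ext a b
      simp [mul_apply, one_apply, apply_ite]
    mul_one := fun X => by
      ext a b
      simp [mul_apply, one_apply, ← two_mul, show (2 : ZMod 2) = 0 from rfl, twist_zero] }

instance : Algebra ℂ (EndTensor p A) :=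
  Algebra.ofModule
    (fun c X Y => by ext a b; simp [mul_apply, Finset.smul_sum])
    (fun c X Y => by ext a b; simp [mul_apply, Finset.smul_sum])

/-- The parity of `e^a_b ⊗ u` is `p a + p b + [u]`. -/
def parityFun (X : EndTensor p A) : EndTensor p A :=
  mk fun a b => sgn (p a + p b) • Superalgebra.parity (X a b)

theorem parityFun_apply (X : EndTensor p A) (a b : Fin n) :
    parityFun X a b = sgn (p a + p b) • Superalgebra.parity (X a b) := rfl

theorem parityFun_mul (X Y : EndTensor p A) : parityFun (X * Y) = parityFun X * parityFun Y := by
  ext a b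
  simp only [parityFun_apply, mul_apply, map_sum, map_mul, map_zsmul,
    Finset.smul_sum, smul_mul_smul_comm]
  refine Finset.sum_congr rfl fun c _ => ?_
  rw [← twist_one, ← twist_one (X a c), twist_twist, twist_twist, add_comm (1 : ZMod 2),
    ← sgn_add]
  congr 2
  generalize p a = x
  generalize p b = y
  generalize p c = z
  revert x y z
  decide

instance : Superalgebra (EndTensor p A) where
  parity := AlgHom.ofLinearMap
    { toFun := parityFun
      map_add' := fun X Y => by ext a b; simp only [parityFun_apply, add_apply, map_add, smul_add]
      map_smul' := fun c X => by
        ext a b; simp only [parityFun_apply, smul_apply, map_smul, smul_comm c, RingHom.id_apply] }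
    (by
      change parityFun 1 = 1
      ext a b
      rw [parityFun_apply]
      by_cases h : a = b
      · subst h
        rw [one_apply, CharTwo.add_self_eq_zero]
        simp [sgn]
      · simp [one_apply, h])
    parityFun_mul
  parity_parity X := by
    change parityFun (parityFun X) = X
    ext a b
    rw [parityFun_apply, parityFun_apply, map_zsmul, Superalgebra.parity_parity, smul_smul,
      sgn_mul_self, one_smul]

theorem parity_apply (X : EndTensor p A) (a b : Fin n) :
    (Superalgebra.parity X : EndTensor p A) a b = sgn (p a + p b) • Superalgebra.parity (X a b) :=
  rfl

variable (p) in
/-- The element `1 ⊗ u`. -/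
def oneTensor (u : A) : EndTensor p A := mk fun a b => if a = b then u else 0

variable (p) in
/-- The element `e^a_b ⊗ u`. -/
def unitTensor (a b : Fin n) (u : A) : EndTensor p A := mk fun c d => if c = a ∧ d = b then u else 0

theorem oneTensor_zsmul (k : ℤ) (u : A) : oneTensor p (k • u) = k • oneTensor p u := by
  ext a b
  simp only [oneTensor, mk_apply, smul_apply, smul_ite, smul_zero]

theorem unitTensor_zsmul (a b : Fin n) (k : ℤ) (u : A) :
    unitTensor p a b (k • u) = k • unitTensor p a b u := by
  ext c d
  simp only [unitTensor, mk_apply, smul_apply, smul_ite, smul_zero]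

theorem parity_oneTensor (u : A) :
    Superalgebra.parity (oneTensor p u) = oneTensor p (Superalgebra.parity u) := by
  ext a b
  rw [parity_apply]
  by_cases h : a = b
  · subst h
    rw [CharTwo.add_self_eq_zero]
    simp [oneTensor, sgn]
  · simp [oneTensor, h]

theorem parity_unitTensor (a b : Fin n) (u : A) :
    Superalgebra.parity (unitTensor p a b u) =
      unitTensor p a b (sgn (p a + p b) • Superalgebra.parity u) := by
  ext c d
  rw [parity_apply]
  by_cases h : c = a ∧ d = b
  · obtain ⟨rfl, rfl⟩ := h
    simp [unitTensor]
  · simp [unitTensor, h]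

/-- For `X = ∑ e^a_b ⊗ u` in `End V ⊗ A`, the element `X₁ = ∑ e^a_b ⊗ 1 ⊗ u` of
`End V ⊗ End V ⊗ A`. -/
def inFirst (X : EndTensor p A) : EndTensor p (EndTensor p A) :=
  mk fun a b => oneTensor p (X a b)

/-- For `X = ∑ e^a_b ⊗ u` in `End V ⊗ A`, the element `X₂ = ∑ 1 ⊗ e^a_b ⊗ u` of
`End V ⊗ End V ⊗ A`. -/
def inSecond (X : EndTensor p A) : EndTensor p (EndTensor p A) := oneTensor p X

theorem parity_inFirst (X : EndTensor p A) :
    Superalgebra.parity (inFirst X) = inFirst (Superalgebra.parity X) := by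
  ext a b : 2
  simp only [parity_apply, inFirst, mk_apply, parity_oneTensor, oneTensor_zsmul]

theorem parity_inSecond (X : EndTensor p A) :
    Superalgebra.parity (inSecond X) = inSecond (Superalgebra.parity X) :=
  parity_oneTensor X

end EndTensor

open EndTensor

/-! ### The Perk–Schultz matrix and the `RLL` relation -/

/-- The parity `[a]` of an index.  Indices start at `0` here: `[a] = 0` for the first `M` indices
`0, …, M - 1`, and `[a] = 1` for the later ones. -/
def par (M a : ℕ) : ZMod 2 := if a < M then 0 else 1

/-- The parities of the basis `v^a` of the vector module of `gl(M|N)`. -/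
def parV (M N : ℕ) (a : Fin (M + N)) : ZMod 2 := par M a

section RLL

variable {M N : ℕ} {A : Type*} [Ring A] [Algebra ℂ A] [Superalgebra A]

variable (M N A) in
/-- The algebra `End V ⊗ End V ⊗ A`, for `V` the vector module of `gl(M|N)`. -/
abbrev EndEnd : Type _ := EndTensor (parV M N) (EndTensor (parV M N) A)

variable (M N A) in
/-- The element `e^a_b ⊗ e^c_d ⊗ 1`. -/
def units (a b c d : Fin (M + N)) : EndEnd M N A :=
  unitTensor (parV M N) a b (unitTensor (parV M N) c d 1)

variable (M N A) in
/-- The element `z^{∑_a e^a_a ⊗ e^a_a (-1)^{[a]}} ⊗ 1`. -/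
def powDiag (z : ℂ) : EndEnd M N A :=
  ∑ a, ∑ b, (if a = b then z ^ sgn (parV M N a) else 1) • units M N A a a b b

variable (M N A) in
/-- The Perk–Schultz matrix `R₁₂(x)`, where the variable number `0` stands for `x⁻¹`. -/
def rMatrix (q : ℂ) : MvPowerSeries (Fin 2) (EndEnd M N A) :=
  MvPowerSeries.C (powDiag M N A q) - MvPowerSeries.X 0 * MvPowerSeries.C (powDiag M N A q⁻¹) +
    MvPowerSeries.X 0 * MvPowerSeries.C ((q - q⁻¹) • ∑ a, ∑ b,
      if a < b then sgn (parV M N b) • units M N A a b b a else 0) +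
    MvPowerSeries.C ((q - q⁻¹) • ∑ a, ∑ b,
      if b < a then sgn (parV M N b) • units M N A a b b a else 0)

/-- For a power series `L(x) = ∑ x⁻ᵏ L[k]` in `x⁻¹`, the series
`L₁(xy) = ∑ x⁻ᵏ y⁻ᵏ L[k]₁`, where the variables number `0` and `1` stand for `x⁻¹` and `y⁻¹`. -/
def firstXY (L : PowerSeries (EndTensor (parV M N) A)) : MvPowerSeries (Fin 2) (EndEnd M N A) :=
  fun n => if n 0 = n 1 then inFirst (PowerSeries.coeff (n 0) L) else 0

/-- For a power series `L(x) = ∑ x⁻ᵏ L[k]` in `x⁻¹`, the series `L₂(y) = ∑ y⁻ᵏ L[k]₂`. -/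
def secondY (L : PowerSeries (EndTensor (parV M N) A)) : MvPowerSeries (Fin 2) (EndEnd M N A) :=
  fun n => if n 0 = 0 then inSecond (PowerSeries.coeff (n 1) L) else 0

/-- The left side `R₁₂(x) L₁(xy) L₂(y)`. -/
def rllLeft (q : ℂ) (L : PowerSeries (EndTensor (parV M N) A)) :
    MvPowerSeries (Fin 2) (EndEnd M N A) :=
  rMatrix M N A q * firstXY L * secondY L

/-- The right side `L₂(y) L₁(xy) R₁₂(x)`. -/
def rllRight (q : ℂ) (L : PowerSeries (EndTensor (parV M N) A)) :
    MvPowerSeries (Fin 2) (EndEnd M N A) :=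
  secondY L * firstXY L * rMatrix M N A q

theorem parity_units (a b c d : Fin (M + N)) :
    Superalgebra.parity (units M N A a b c d) =
      sgn (parV M N a + parV M N b + (parV M N c + parV M N d)) • units M N A a b c d := by
  rw [units, parity_unitTensor, parity_unitTensor, map_one, unitTensor_zsmul, unitTensor_zsmul,
    unitTensor_zsmul, smul_smul, ← sgn_add]

theorem parity_powDiag (z : ℂ) :
    Superalgebra.parity (powDiag M N A z) = powDiag M N A z := by
  simp only [powDiag, map_sum, map_smul, parity_units, CharTwo.add_self_eq_zero, sgn_zero, one_smul]

theorem parity_units_swap (a b : Fin (M + N)) :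
    Superalgebra.parity (units M N A a b b a) = units M N A a b b a := by
  rw [parity_units, add_comm (parV M N b), CharTwo.add_self_eq_zero, sgn_zero, one_smul]

theorem map_rMatrix (q : ℂ) :
    MvPowerSeries.map (Superalgebra.parity (A := EndEnd M N A)).toRingHom (rMatrix M N A q) =
      rMatrix M N A q := by
  simp only [rMatrix, map_add, map_sub, map_mul, MvPowerSeries.map_C, MvPowerSeries.map_X,
    AlgHom.toRingHom_eq_coe, RingHom.coe_coe, map_smul, map_sum, parity_powDiag, apply_ite,
    map_zsmul, parity_units_swap, map_zero]

theorem map_firstXY (L : PowerSeries (EndTensor (parV M N) A))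
    (hL : ∀ k, Superalgebra.parity (PowerSeries.coeff k L) = PowerSeries.coeff k L) :
    MvPowerSeries.map (Superalgebra.parity (A := EndEnd M N A)).toRingHom (firstXY L) =
      firstXY L := by
  ext n : 1
  rw [MvPowerSeries.coeff_map]
  change Superalgebra.parity (if n 0 = n 1 then inFirst (PowerSeries.coeff (n 0) L) else 0) =
    if n 0 = n 1 then inFirst (PowerSeries.coeff (n 0) L) else 0
  split_ifs
  · rw [parity_inFirst, hL]
  · exact map_zero _

theorem map_secondY (L : PowerSeries (EndTensor (parV M N) A))
    (hL : ∀ k, Superalgebra.parity (PowerSeries.coeff k L) = PowerSeries.coeff k L) :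
    MvPowerSeries.map (Superalgebra.parity (A := EndEnd M N A)).toRingHom (secondY L) =
      secondY L := by
  ext n : 1
  rw [MvPowerSeries.coeff_map]
  change Superalgebra.parity (if n 0 = 0 then inSecond (PowerSeries.coeff (n 1) L) else 0) =
    if n 0 = 0 then inSecond (PowerSeries.coeff (n 1) L) else 0
  split_ifs
  · rw [parity_inSecond, hL]
  · exact map_zero _

theorem parity_coeff (S : MvPowerSeries (Fin 2) (EndEnd M N A))
    (hS : MvPowerSeries.map (Superalgebra.parity (A := EndEnd M N A)).toRingHom S = S)
    (n : Fin 2 →₀ ℕ) (a b c d : Fin (M + N)) :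
    Superalgebra.parity (MvPowerSeries.coeff n S a b c d) =
      sgn (parV M N a + parV M N b + (parV M N c + parV M N d)) •
        MvPowerSeries.coeff n S a b c d := by
  have h : Superalgebra.parity (MvPowerSeries.coeff n S) = MvPowerSeries.coeff n S := by
    conv_rhs => rw [← hS]
    rw [MvPowerSeries.coeff_map]
    rfl
  have h2 := congrArg (fun X : EndEnd M N A => X a b c d) h
  simp only [parity_apply, EndTensor.smul_apply, smul_smul, ← sgn_add] at h2
  conv_rhs => rw [← h2]
  rw [smul_smul, sgn_mul_self, one_smul]

end RLL

/-! ### Presented superalgebras -/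

/-- A set of generators, each with a parity. -/
class HasParity (X : Type*) where
  deg : X → ZMod 2

/-- The free superalgebra on a set of generators with parities. -/
instance {X : Type*} [HasParity X] : Superalgebra (FreeAlgebra ℂ X) where
  parity := FreeAlgebra.lift ℂ fun x => sgn (HasParity.deg x) • FreeAlgebra.ι ℂ x
  parity_parity x := by
    rw [← AlgHom.comp_apply, ← AlgHom.id_apply (R := ℂ) x]
    congr 1
    ext y
    simp only [Function.comp_apply, AlgHom.comp_apply, FreeAlgebra.lift_ι_apply, map_zsmul,
      smul_smul, sgn_mul_self, one_smul, AlgHom.id_apply]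

theorem parity_ι {X : Type*} [HasParity X] (x : X) :
    Superalgebra.parity (FreeAlgebra.ι ℂ x) = sgn (HasParity.deg x) • FreeAlgebra.ι ℂ x :=
  FreeAlgebra.lift_ι_apply _ _

/-- The quotient of a superalgebra by relations `x = y` with `x` and `y` homogeneous of the same
degree is a superalgebra. -/
abbrev quotSuperalgebra {F : Type*} [Ring F] [Algebra ℂ F] [Superalgebra F] (r : F → F → Prop)
    (hr : ∀ x y, r x y → ∃ i, x ∈ homPart F i ∧ y ∈ homPart F i) :
    Superalgebra (RingQuot r) where
  parity := RingQuot.liftAlgHom ℂ ⟨(RingQuot.mkAlgHom ℂ r).comp Superalgebra.parity, by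
    intro x y h
    obtain ⟨i, hx, hy⟩ := hr x y h
    rw [AlgHom.comp_apply, AlgHom.comp_apply, mem_homPart.1 hx, mem_homPart.1 hy, map_zsmul,
      map_zsmul, RingQuot.mkAlgHom_rel ℂ h]⟩
  parity_parity x := by
    obtain ⟨x, rfl⟩ := RingQuot.mkAlgHom_surjective ℂ r x
    rw [RingQuot.liftAlgHom_mkAlgHom_apply, AlgHom.comp_apply, RingQuot.liftAlgHom_mkAlgHom_apply,
      AlgHom.comp_apply, Superalgebra.parity_parity]

/-! ### The quantum super Yangian -/

/-- The generators `T^a_b[k]` of the quantum super Yangian, for all `k ≥ 0`. -/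
inductive YGen (M N : ℕ) : Type
  | T (a b : Fin (M + N)) (k : ℕ)

instance (M N : ℕ) : HasParity (YGen M N) where
  deg | .T a b _ => parV M N a + parV M N b

/-- The series `L(x) = ∑_{a, b} (-1)^{[b]} e^a_b ⊗ ∑_k x⁻ᵏ T^b_a[k]` in `x⁻¹`, for elements
`T^a_b[k]` of an algebra. -/
def lSeries {M N : ℕ} {A : Type*} [Ring A] (T : YGen M N → A) :
    PowerSeries (EndTensor (parV M N) A) :=
  PowerSeries.mk fun k => EndTensor.mk fun a b => sgn (parV M N b) • T (.T b a k)

/-- The relation `R₁₂(x) L₁(xy) L₂(y) = L₂(y) L₁(xy) R₁₂(x)` of the quantum super Yangian, for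
each matrix entry of the coefficient of each monomial in `x⁻¹` and `y⁻¹`. -/
inductive YRel (M N : ℕ) (q : ℂ) : FreeAlgebra ℂ (YGen M N) → FreeAlgebra ℂ (YGen M N) → Prop
  | rll (n : Fin 2 →₀ ℕ) (a b c d : Fin (M + N)) : YRel M N q
      (MvPowerSeries.coeff n (rllLeft q (lSeries (FreeAlgebra.ι ℂ))) a b c d)
      (MvPowerSeries.coeff n (rllRight q (lSeries (FreeAlgebra.ι ℂ))) a b c d)

theorem YRel.homogeneous (M N : ℕ) (q : ℂ) (x y : FreeAlgebra ℂ (YGen M N))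
    (h : YRel M N q x y) :
    ∃ i, x ∈ homPart (FreeAlgebra ℂ (YGen M N)) i ∧ y ∈ homPart (FreeAlgebra ℂ (YGen M N)) i := by
  have hL : ∀ k, Superalgebra.parity (PowerSeries.coeff k
      (lSeries (M := M) (N := N) (FreeAlgebra.ι ℂ))) =
      PowerSeries.coeff k (lSeries (M := M) (N := N) (FreeAlgebra.ι ℂ)) := by
    intro k
    ext a b
    rw [parity_apply, lSeries, PowerSeries.coeff_mk, EndTensor.mk_apply]
    rw [map_zsmul, parity_ι, smul_comm, smul_smul (sgn (parV M N a + parV M N b)),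
      show HasParity.deg (YGen.T b a k) = parV M N b + parV M N a from rfl,
      add_comm (parV M N b), sgn_mul_self, one_smul]
  obtain ⟨n, a, b, c, d⟩ := h
  refine ⟨_, parity_coeff _ ?_ n a b c d, parity_coeff _ ?_ n a b c d⟩
  · rw [rllLeft, map_mul, map_mul, map_rMatrix, map_firstXY _ hL, map_secondY _ hL]
  · rw [rllRight, map_mul, map_mul, map_rMatrix, map_firstXY _ hL, map_secondY _ hL]

/-- The quantum super Yangian `Y_q(gl(M|N))`. -/
def Yangian (M N : ℕ) (q : ℂ) : Type := RingQuot (YRel M N q)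

namespace Yangian

variable (M N : ℕ) (q : ℂ)

instance : Ring (Yangian M N q) := inferInstanceAs (Ring (RingQuot (YRel M N q)))

instance : Algebra ℂ (Yangian M N q) := inferInstanceAs (Algebra ℂ (RingQuot (YRel M N q)))

instance : Superalgebra (Yangian M N q) := quotSuperalgebra (YRel M N q) (YRel.homogeneous M N q)

/-- The generators `T^a_b[k]` of the quantum super Yangian. -/
def gen (x : YGen M N) : Yangian M N q := RingQuot.mkAlgHom ℂ (YRel M N q) (FreeAlgebra.ι ℂ x)

/-- The generating series `L(x)` of the quantum super Yangian. -/
def L : PowerSeries (EndTensor (parV M N) (Yangian M N q)) := lSeries (gen M N q)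

end Yangian

/-! ### The quantum supergroup -/

/-- The generators of `U_q(gl(M|N))`: `K a` is `q^{E^a_a}`, `Kinv a` is `q^{-E^a_a}`, and, for two
successive indices `lo i` and `hi i`, `up i` is `E^{lo i}_{hi i}` and `down i` is
`E^{hi i}_{lo i}`. -/
inductive UGen (M N : ℕ) : Type
  | K (a : Fin (M + N))
  | Kinv (a : Fin (M + N))
  | up (i : Fin (M + N - 1))
  | down (i : Fin (M + N - 1))

/-- The index `i`. -/
def lo {M N : ℕ} (i : Fin (M + N - 1)) : Fin (M + N) := ⟨i, by omega⟩

/-- The index `i + 1`. -/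
def hi {M N : ℕ} (i : Fin (M + N - 1)) : Fin (M + N) := ⟨i + 1, by omega⟩

/-- The parity `[i] + [i + 1]` of `E^{i}_{i+1}` and `E^{i+1}_{i}`. -/
def degE {M N : ℕ} (i : Fin (M + N - 1)) : ZMod 2 := parV M N (lo i) + parV M N (hi i)

instance (M N : ℕ) : HasParity (UGen M N) where
  deg
    | .K _ => 0
    | .Kinv _ => 0
    | .up i => degE i
    | .down i => degE i

section CartanWeyl

variable {M N : ℕ} {A : Type*} [Ring A] [Algebra ℂ A] (q : ℂ) (g : UGen M N → A)

/-- `E^{i}_{i+1}` for a natural number `i`, and `0` if there is no such generator. -/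
def simpleUp (i : ℕ) : A := if h : i < M + N - 1 then g (.up ⟨i, h⟩) else 0

/-- `E^{i+1}_{i}` for a natural number `i`, and `0` if there is no such generator. -/
def simpleDown (i : ℕ) : A := if h : i < M + N - 1 then g (.down ⟨i, h⟩) else 0

/-- The element `E^a_b` with `b = a + d + 1`, by the recursion
`E^a_b = E^a_c E^c_b - q^{-(-1)^{[c]}} E^c_b E^a_c` with `c = b - 1`. -/
def raising (a : ℕ) : ℕ → A
  | 0 => simpleUp g a
  | d + 1 => raising a d * simpleUp g (a + d + 1) -
      q ^ (-sgn (par M (a + d + 1))) • (simpleUp g (a + d + 1) * raising a d)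

/-- The element `E^b_a` with `b = a + d + 1`, by the recursion
`E^b_a = E^b_c E^c_a - q^{(-1)^{[c]}} E^c_a E^b_c` with `c = b - 1`. -/
def lowering (a : ℕ) : ℕ → A
  | 0 => simpleDown g a
  | d + 1 => simpleDown g (a + d + 1) * lowering a d -
      q ^ sgn (par M (a + d + 1)) • (lowering a d * simpleDown g (a + d + 1))

/-- The quantum Cartan–Weyl element `E^a_b` for `a ≠ b` (and `0` for `a = b`). -/
def cartanWeyl (a b : Fin (M + N)) : A :=
  if a < b then raising q g a (b - a - 1) else if b < a then lowering q g b (a - b - 1) else 0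

/-- The element `q^{(-1)^i E^a_a}`. -/
def powK (a : Fin (M + N)) (i : ZMod 2) : A := if i = 0 then g (.K a) else g (.Kinv a)

/-- The element `q^{h_i}`, where `h_i = (-1)^{[i]} E^i_i - (-1)^{[i+1]} E^{i+1}_{i+1}`. -/
def qh (i : Fin (M + N - 1)) : A :=
  powK g (lo i) (parV M N (lo i)) * powK g (hi i) (parV M N (hi i) + 1)

/-- The element `q^{-h_i}`. -/
def qhInv (i : Fin (M + N - 1)) : A :=
  powK g (lo i) (parV M N (lo i) + 1) * powK g (hi i) (parV M N (hi i))

/-- The graded commutator `[x, y} = x y - (-1)^{i j} y x` of elements of degrees `i` and `j`. -/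
def superComm (i j : ZMod 2) (x y : A) : A := x * y - sgn (i * j) • (y * x)

end CartanWeyl

/-- The exponent `δ_{a,i} - δ_{a,i+1}` in `[E^a_a, E^i_{i+1}] = (δ_{a,i} - δ_{a,i+1}) E^i_{i+1}`. -/
def weight {M N : ℕ} (a : Fin (M + N)) (i : Fin (M + N - 1)) : ℤ :=
  (if a = lo i then 1 else 0) - (if a = hi i then 1 else 0)

section URel

open FreeAlgebra (ι)

/-- The defining relations of `U_q(gl(M|N))`.  The odd simple root is the index `i` with
`i + 1 = M`. -/
inductive URel (M N : ℕ) (q : ℂ) : FreeAlgebra ℂ (UGen M N) → FreeAlgebra ℂ (UGen M N) → Prop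
  | K_mul_Kinv (a : Fin (M + N)) : URel M N q (ι ℂ (.K a) * ι ℂ (.Kinv a)) 1
  | Kinv_mul_K (a : Fin (M + N)) : URel M N q (ι ℂ (.Kinv a) * ι ℂ (.K a)) 1
  | K_comm (a b : Fin (M + N)) :
      URel M N q (ι ℂ (.K a) * ι ℂ (.K b)) (ι ℂ (.K b) * ι ℂ (.K a))
  | K_up (a : Fin (M + N)) (i : Fin (M + N - 1)) :
      URel M N q (ι ℂ (.K a) * ι ℂ (.up i)) (q ^ weight a i • (ι ℂ (.up i) * ι ℂ (.K a)))
  | K_down (a : Fin (M + N)) (i : Fin (M + N - 1)) :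
      URel M N q (ι ℂ (.K a) * ι ℂ (.down i)) (q ^ (-weight a i) • (ι ℂ (.down i) * ι ℂ (.K a)))
  | up_down_self (i : Fin (M + N - 1)) :
      URel M N q (superComm (degE i) (degE i) (ι ℂ (.up i)) (ι ℂ (.down i)))
        (sgn (parV M N (lo i)) • (q - q⁻¹)⁻¹ • (qh (ι ℂ) i - qhInv (ι ℂ) i))
  | up_down (i j : Fin (M + N - 1)) (h : i ≠ j) :
      URel M N q (superComm (degE i) (degE j) (ι ℂ (.up i)) (ι ℂ (.down j))) 0
  | up_sq (i : Fin (M + N - 1)) (h : (i : ℕ) + 1 = M) : URel M N q (ι ℂ (.up i) ^ 2) 0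
  | down_sq (i : Fin (M + N - 1)) (h : (i : ℕ) + 1 = M) : URel M N q (ι ℂ (.down i) ^ 2) 0
  | up_comm (i j : Fin (M + N - 1)) (h : (i : ℕ) + 2 ≤ j) :
      URel M N q (ι ℂ (.up i) * ι ℂ (.up j)) (ι ℂ (.up j) * ι ℂ (.up i))
  | down_comm (i j : Fin (M + N - 1)) (h : (i : ℕ) + 2 ≤ j) :
      URel M N q (ι ℂ (.down i) * ι ℂ (.down j)) (ι ℂ (.down j) * ι ℂ (.down i))
  | up_serre (i j : Fin (M + N - 1)) (h : (i : ℕ) + 1 = j ∨ (j : ℕ) + 1 = i)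
      (hi : (i : ℕ) + 1 ≠ M) :
      URel M N q (ι ℂ (.up i) ^ 2 * ι ℂ (.up j) -
        (q + q⁻¹) • (ι ℂ (.up i) * ι ℂ (.up j) * ι ℂ (.up i)) + ι ℂ (.up j) * ι ℂ (.up i) ^ 2) 0
  | down_serre (i j : Fin (M + N - 1)) (h : (i : ℕ) + 1 = j ∨ (j : ℕ) + 1 = i)
      (hi : (i : ℕ) + 1 ≠ M) :
      URel M N q (ι ℂ (.down i) ^ 2 * ι ℂ (.down j) -
        (q + q⁻¹) • (ι ℂ (.down i) * ι ℂ (.down j) * ι ℂ (.down i)) +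
          ι ℂ (.down j) * ι ℂ (.down i) ^ 2) 0
  | up_quartic (a b : Fin (M + N)) (i : Fin (M + N - 1)) (ha : (a : ℕ) + 2 = M)
      (hb : (b : ℕ) = M + 1) (hi : (i : ℕ) + 1 = M) :
      URel M N q (superComm (parV M N a + parV M N b) (degE i)
        (cartanWeyl q (ι ℂ) a b) (ι ℂ (.up i))) 0
  | down_quartic (a b : Fin (M + N)) (i : Fin (M + N - 1)) (ha : (a : ℕ) + 2 = M)
      (hb : (b : ℕ) = M + 1) (hi : (i : ℕ) + 1 = M) :
      URel M N q (superComm (parV M N a + parV M N b) (degE i)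
        (cartanWeyl q (ι ℂ) b a) (ι ℂ (.down i))) 0

section Homogeneous

variable {M N : ℕ} (q : ℂ)

local notation "F" => FreeAlgebra ℂ (UGen M N)

theorem ι_mem (x : UGen M N) : ι ℂ x ∈ homPart F (HasParity.deg x) := mem_homPart.2 (parity_ι x)

theorem simpleUp_mem (i : ℕ) :
    simpleUp (M := M) (N := N) (ι ℂ) i ∈ homPart F (par M i + par M (i + 1)) := by
  rw [simpleUp]
  split_ifs with h
  · exact parity_ι _
  · exact zero_mem _

theorem simpleDown_mem (i : ℕ) :
    simpleDown (M := M) (N := N) (ι ℂ) i ∈ homPart F (par M i + par M (i + 1)) := by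
  rw [simpleDown]
  split_ifs with h
  · exact parity_ι _
  · exact zero_mem _

theorem raising_mem (a d : ℕ) :
    raising (M := M) (N := N) q (ι ℂ) a d ∈ homPart F (par M a + par M (a + d + 1)) := by
  induction d with
  | zero => exact simpleUp_mem a
  | succ d ih =>
    have h : ∀ x y z : ZMod 2, x + y + (y + z) = x + z := by decide
    have h1 := mul_mem_homPart ih (simpleUp_mem (M := M) (N := N) (a + d + 1))
    have h2 := mul_mem_homPart (simpleUp_mem (M := M) (N := N) (a + d + 1)) ih
    rw [add_comm (par M (a + d + 1) + _)] at h2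
    rw [h] at h1 h2
    exact sub_mem h1 (Submodule.smul_mem _ _ h2)

theorem lowering_mem (a d : ℕ) :
    lowering (M := M) (N := N) q (ι ℂ) a d ∈ homPart F (par M a + par M (a + d + 1)) := by
  induction d with
  | zero => exact simpleDown_mem a
  | succ d ih =>
    have h : ∀ x y z : ZMod 2, x + y + (y + z) = x + z := by decide
    have h1 := mul_mem_homPart ih (simpleDown_mem (M := M) (N := N) (a + d + 1))
    have h2 := mul_mem_homPart (simpleDown_mem (M := M) (N := N) (a + d + 1)) ih
    rw [add_comm (par M (a + d + 1) + _)] at h2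
    rw [h] at h1 h2
    exact sub_mem h2 (Submodule.smul_mem _ _ h1)

theorem cartanWeyl_mem (a b : Fin (M + N)) :
    cartanWeyl q (ι ℂ) a b ∈ homPart F (parV M N a + parV M N b) := by
  rw [cartanWeyl]
  split_ifs with h h'
  · have := raising_mem (M := M) (N := N) q a (b - a - 1)
    rwa [show (a : ℕ) + (b - a - 1) + 1 = b by omega] at this
  · have := lowering_mem (M := M) (N := N) q b (a - b - 1)
    rwa [show (b : ℕ) + (a - b - 1) + 1 = a by omega, add_comm] at this
  · exact zero_mem _

theorem powK_mem (a : Fin (M + N)) (i : ZMod 2) : powK (ι ℂ) a i ∈ homPart F 0 := by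
  rw [powK]
  split_ifs
  · exact parity_ι _
  · exact parity_ι _

theorem qh_mem (i : Fin (M + N - 1)) : qh (ι ℂ) i ∈ homPart F 0 := by
  have h := mul_mem_homPart (powK_mem (lo i) (parV M N (lo i)))
    (powK_mem (hi i) (parV M N (hi i) + 1))
  rwa [add_zero] at h

theorem qhInv_mem (i : Fin (M + N - 1)) : qhInv (ι ℂ) i ∈ homPart F 0 := by
  have h := mul_mem_homPart (powK_mem (lo i) (parV M N (lo i) + 1))
    (powK_mem (hi i) (parV M N (hi i)))
  rwa [add_zero] at h

theorem superComm_mem {i j : ZMod 2} {x y : F} (hx : x ∈ homPart F i) (hy : y ∈ homPart F j) :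
    superComm i j x y ∈ homPart F (i + j) := by
  refine sub_mem (mul_mem_homPart hx hy) (zsmul_mem ?_ _)
  rw [add_comm]
  exact mul_mem_homPart hy hx

theorem serre_mem {i j : ZMod 2} {x y : F} (hx : x ∈ homPart F i) (hy : y ∈ homPart F j) :
    x ^ 2 * y - (q + q⁻¹) • (x * y * x) + y * x ^ 2 ∈ homPart F (i + (i + j)) := by
  have h1 : x ^ 2 * y ∈ homPart F (i + (i + j)) := by
    rw [sq, mul_assoc]
    exact mul_mem_homPart hx (mul_mem_homPart hx hy)
  have h2 : x * y * x ∈ homPart F (i + (i + j)) := by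
    rw [mul_assoc]
    exact mul_mem_homPart hx (mul_mem_homPart' hx hy)
  have h3 : y * x ^ 2 ∈ homPart F (i + (i + j)) := by
    rw [sq, ← mul_assoc]
    exact mul_mem_homPart' hx (mul_mem_homPart' hx hy)
  exact add_mem (sub_mem h1 (Submodule.smul_mem _ _ h2)) h3

theorem sq_mem {i : ZMod 2} {x : F} (hx : x ∈ homPart F i) : x ^ 2 ∈ homPart F (i + i) := by
  rw [sq]
  exact mul_mem_homPart hx hx

theorem URel.homogeneous (x y : F) (h : URel M N q x y) :
    ∃ i, x ∈ homPart F i ∧ y ∈ homPart F i := by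
  have hK (a : Fin (M + N)) : ι ℂ (UGen.K a) ∈ homPart F 0 := (ι_mem (UGen.K a))
  have hK' (a : Fin (M + N)) : ι ℂ (UGen.Kinv a) ∈ homPart F 0 := (ι_mem (UGen.Kinv a))
  have hu (i : Fin (M + N - 1)) : ι ℂ (UGen.up i) ∈ homPart F (degE i) := (ι_mem (UGen.up i))
  have hd (i : Fin (M + N - 1)) : ι ℂ (UGen.down i) ∈ homPart F (degE i) := (ι_mem (UGen.down i))
  cases h with
  | K_mul_Kinv a => exact ⟨_, mul_mem_homPart (hK a) (hK' a), one_mem_homPart⟩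
  | Kinv_mul_K a => exact ⟨_, mul_mem_homPart (hK' a) (hK a), one_mem_homPart⟩
  | K_comm a b => exact ⟨_, mul_mem_homPart (hK a) (hK b), mul_mem_homPart' (hK a) (hK b)⟩
  | K_up a i =>
    exact ⟨_, mul_mem_homPart (hK a) (hu i), Submodule.smul_mem _ _ (mul_mem_homPart' (hK a) (hu i))⟩
  | K_down a i =>
    exact ⟨_, mul_mem_homPart (hK a) (hd i), Submodule.smul_mem _ _ (mul_mem_homPart' (hK a) (hd i))⟩
  | up_down_self i =>
    refine ⟨_, superComm_mem (hu i) (hd i), ?_⟩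
    rw [CharTwo.add_self_eq_zero]
    exact zsmul_mem (Submodule.smul_mem _ _ (sub_mem (qh_mem i) (qhInv_mem i))) _
  | up_down i j => exact ⟨_, superComm_mem (hu i) (hd j), zero_mem _⟩
  | up_sq i => exact ⟨_, sq_mem (hu i), zero_mem _⟩
  | down_sq i => exact ⟨_, sq_mem (hd i), zero_mem _⟩
  | up_comm i j => exact ⟨_, mul_mem_homPart (hu i) (hu j), mul_mem_homPart' (hu i) (hu j)⟩
  | down_comm i j => exact ⟨_, mul_mem_homPart (hd i) (hd j), mul_mem_homPart' (hd i) (hd j)⟩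
  | up_serre i j => exact ⟨_, serre_mem q (hu i) (hu j), zero_mem _⟩
  | down_serre i j => exact ⟨_, serre_mem q (hd i) (hd j), zero_mem _⟩
  | up_quartic a b i => exact ⟨_, superComm_mem (cartanWeyl_mem q a b) (hu i), zero_mem _⟩
  | down_quartic a b i =>
    refine ⟨_, superComm_mem ?_ (hd i), zero_mem _⟩
    rw [add_comm]
    exact cartanWeyl_mem q b a

end Homogeneous

end URel

/-- The quantum supergroup `U_q(gl(M|N))`. -/
def QuantumGL (M N : ℕ) (q : ℂ) : Type := RingQuot (URel M N q)

namespace QuantumGL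

variable (M N : ℕ) (q : ℂ)

instance : Ring (QuantumGL M N q) := inferInstanceAs (Ring (RingQuot (URel M N q)))

instance : Algebra ℂ (QuantumGL M N q) := inferInstanceAs (Algebra ℂ (RingQuot (URel M N q)))

instance : Superalgebra (QuantumGL M N q) := quotSuperalgebra (URel M N q) (URel.homogeneous q)

/-- The generators of `U_q(gl(M|N))`. -/
def gen (x : UGen M N) : QuantumGL M N q := RingQuot.mkAlgHom ℂ (URel M N q) (FreeAlgebra.ι ℂ x)

/-- The quantum Cartan–Weyl generators `E^a_b`, `a ≠ b`, of `U_q(gl(M|N))`. -/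
def E (a b : Fin (M + N)) : QuantumGL M N q := cartanWeyl q (gen M N q) a b

/-- The algebra `End V ⊗ U_q(gl(M|N))`. -/
abbrev EndU : Type := EndTensor (parV M N) (QuantumGL M N q)

/-- The element `q^{± ∑_a e^a_a ⊗ E^a_a (-1)^{[a]}}`, the sign being `(-1)^i`. -/
def diagPart (i : ZMod 2) : EndU M N q :=
  ∑ a, unitTensor (parV M N) a a (powK (gen M N q) a (parV M N a + i))

/-- `l^{(+)} = q^{∑_a e^a_a ⊗ E^a_a (-1)^{[a]}}
  (1 + (q - q⁻¹) ∑_{a<b} (-1)^{[a]} e^b_a ⊗ E^a_b)`. -/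
def lPlus : EndU M N q :=
  diagPart M N q 0 * (1 + (q - q⁻¹) • ∑ a, ∑ b,
    if a < b then sgn (parV M N a) • unitTensor (parV M N) b a (E M N q a b) else 0)

/-- `l^{(-)} = (1 - (q - q⁻¹) ∑_{a<b} (-1)^{[b]} e^a_b ⊗ E^b_a)
  q^{-∑_a e^a_a ⊗ E^a_a (-1)^{[a]}}`. -/
def lMinus : EndU M N q :=
  (1 - (q - q⁻¹) • ∑ a, ∑ b,
    if a < b then sgn (parV M N b) • unitTensor (parV M N) a b (E M N q b a) else 0) *
    diagPart M N q 1

/-- `l(x) = (l^{(+)} - x⁻¹ l^{(-)}) / (1 - x⁻¹)`, as a power series in `x⁻¹`. -/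
def l : PowerSeries (EndU M N q) :=
  (PowerSeries.C (lPlus M N q) - PowerSeries.X * PowerSeries.C (lMinus M N q)) *
    PowerSeries.mk 1

theorem l_mul_one_sub_X : l M N q * (1 - PowerSeries.X) =
    PowerSeries.C (lPlus M N q) - PowerSeries.X * PowerSeries.C (lMinus M N q) := by
  have h : (PowerSeries.mk 1 : PowerSeries (EndU M N q)) * (1 - PowerSeries.X) = 1 := by
    ext1 n
    rw [mul_sub, mul_one, map_sub]
    cases n with
    | zero => simp
    | succ n => simp [PowerSeries.coeff_succ_mul_X, PowerSeries.coeff_one]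
  rw [l, mul_assoc, h, mul_one]

end QuantumGL

end

end SuperYangian

/-! Write q_a for q^{(-1)^{[a]}}, u = x⁻¹, v = y⁻¹, R(x) = R⁺ - u R⁻. After the central denominators
of `l(x)` are cleared, the relation is a polynomial identity in u and v between R⁺ - u R⁻, l⁺₁ - uv
l⁻₁ and l⁺₂ - v l⁻₂. The difference R⁺ - R⁻ is (q - q⁻¹) times the graded permutation, hence
exchanges the two copies of End V. With this, the identity follows from four relations without
parameters: R⁺ l⁺₁ Y₂ = Y₂ l⁺₁ R⁺ and R⁻ l⁻₁ Y₂ = Y₂ l⁻₁ R⁻, for Y = l⁺ and Y = l⁻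
(`rll_of_central`, `rllLeft_eq_rllRight`). The relations with R⁻ come from those with R⁺ by passing
to the opposite algebra, exchanging raising and lowering generators and inverting q (`QData.op`,
`RelPlus.relMinus`).

For a fixed entry (x, y) of l⁺, the relation R⁺ l⁺₁ Y₂ = Y₂ l⁺₁ R⁺ says that Y intertwines two
matrices, `matR` and `matL`, which are blocks of l⁺₁ R⁺ and R⁺ l⁺₁. Both families of matrices
satisfy the recursion that expresses an entry of l⁺ far from the diagonal through entries nearer to
it (`matR_recursion`, `matL_recursion`). Therefore only the entries (x, x) and (i + 1, i) have to be
checked (`matL_mul_eq_mul_matR`). The diagonal ones are weight relations. The others compare a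
simple root vector e_i with every entry of Y: for Y = l⁺ this is the commutation of e_i with raising
root vectors, a consequence of the Serre and quartic relations (`simple_mul_end`,
`simple_mul_start`, `simple_mul_middle`); for Y = l⁻ it is the commutation with lowering root
vectors, a consequence of the relation between e_i and f_i (`simple_negRoot_end`,
`simple_negRoot_start`, `simple_negRoot_middle`).

All of this takes place with ordinary matrices: `toMatrix` absorbs the signs of the graded tensor
product, so that even elements multiply without signs.

The map Λ exists because the relations of the Yangian are transported to the one for `l(x)`; it is
unique because the entries of L(x) are the generators up to sign. It is surjective because the
coefficients of `l(x)` are l⁺ and l⁺ - l⁻, whose entries contain the Cartan elements and, up to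
invertible factors, all simple root vectors. -/

namespace SuperYangian

noncomputable section

/-! ### Half of the quantum supergroup -/

section Half

variable {A : Type*} [Ring A] [Algebra ℂ A] {M : ℕ} {q : ℂ} {e : ℕ → A}

/-- The number `q ^ (-1)^{[a]}`. -/
def qs (M : ℕ) (q : ℂ) (a : ℕ) : ℂ := q ^ sgn (par M a)

/-- The sign `(-1)^{[a]}` as a complex number. -/
def sg (M a : ℕ) : ℂ := sgn (par M a)

theorem qs_ne_zero (hq : q ≠ 0) (a : ℕ) : qs M q a ≠ 0 := zpow_ne_zero _ hq

theorem qs_inv (a : ℕ) : qs M q⁻¹ a = (qs M q a)⁻¹ := inv_zpow _ _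

theorem par_succ {i : ℕ} (h : i + 1 ≠ M) : par M (i + 1) = par M i := by
  unfold par; split_ifs <;> first | rfl | omega

theorem qs_succ {i : ℕ} (h : i + 1 ≠ M) : qs M q (i + 1) = qs M q i := by
  rw [qs, par_succ h, qs]

theorem sg_succ {i : ℕ} (h : i + 1 ≠ M) : sg M (i + 1) = sg M i := by
  rw [sg, par_succ h, sg]

theorem par_of_lt {a : ℕ} (h : a < M) : par M a = 0 := if_pos h

theorem par_of_le {a : ℕ} (h : M ≤ a) : par M a = 1 := if_neg (by omega)

theorem sg_of_lt {a : ℕ} (h : a < M) : sg M a = 1 := by simp [sg, par_of_lt h, sgn]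

theorem sg_of_le {a : ℕ} (h : M ≤ a) : sg M a = -1 := by simp [sg, par_of_le h, sgn]

theorem qs_of_lt {a : ℕ} (h : a < M) : qs M q a = q := by simp [qs, par_of_lt h, sgn]

theorem qs_of_le {a : ℕ} (h : M ≤ a) : qs M q a = q⁻¹ := by simp [qs, par_of_le h, sgn]

theorem sg_mul_self (a : ℕ) : sg M a * sg M a = 1 := by
  rcases lt_or_ge a M with h | h
  · simp [sg_of_lt h]
  · simp [sg_of_le h]

theorem sg_ne_zero (a : ℕ) : sg M a ≠ 0 := left_ne_zero_of_mul_eq_one (sg_mul_self a)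

theorem qs_add_inv (a : ℕ) : qs M q a + (qs M q a)⁻¹ = q + q⁻¹ := by
  rcases lt_or_ge a M with h | h
  · simp [qs_of_lt h]
  · simp [qs_of_le h, add_comm]

theorem qs_sub_inv (a : ℕ) : qs M q a - (qs M q a)⁻¹ = sg M a * (q - q⁻¹) := by
  rcases lt_or_ge a M with h | h
  · simp [qs_of_lt h, sg_of_lt h]
  · simp [qs_of_le h, sg_of_le h]

/-- The root vector `E^a_b`, `a < b`, built from simple root vectors `e i = E^i_{i+1}` by the
recursion `E^a_{b+1} = E^a_b E^b_{b+1} - q^{-(-1)^{[b]}} E^b_{b+1} E^a_b`, and `0` for `b ≤ a`. -/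
def posRoot (M : ℕ) (q : ℂ) (e : ℕ → A) (a : ℕ) : ℕ → A
  | 0 => 0
  | b + 1 => if a = b then e b else
      posRoot M q e a b * e b - (qs M q b)⁻¹ • (e b * posRoot M q e a b)

theorem posRoot_of_le {a b : ℕ} (h : b ≤ a) : posRoot M q e a b = 0 := by
  induction b with
  | zero => rfl
  | succ b ih => rw [posRoot, if_neg (by omega), ih (by omega)]; simp

theorem posRoot_self_succ (a : ℕ) : posRoot M q e a (a + 1) = e a := by
  rw [posRoot, if_pos rfl]

theorem posRoot_succ {a b : ℕ} (h : a ≠ b) : posRoot M q e a (b + 1) =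
    posRoot M q e a b * e b - (qs M q b)⁻¹ • (e b * posRoot M q e a b) := by
  rw [posRoot, if_neg h]

theorem commute_posRoot {x : A} {a b : ℕ} (h : ∀ j, a ≤ j → j < b → Commute x (e j)) :
    Commute x (posRoot M q e a b) := by
  induction b with
  | zero => exact Commute.zero_right x
  | succ b ih =>
    rcases lt_trichotomy a b with hab | rfl | hab
    · have h1 := ih fun j h1 h2 => h j h1 (by omega)
      have h2 := h b hab.le (by omega)
      rw [posRoot_succ hab.ne]
      exact (h1.mul_right h2).sub_right ((h2.mul_right h1).smul_right _)
    · rw [posRoot_self_succ]; exact h a le_rfl (by omega)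
    · rw [posRoot_of_le (by omega)]; exact Commute.zero_right x

/-- The Serre relation `x² y - (q + q⁻¹) x y x + y x² = 0`. -/
def SerreRel (q : ℂ) (x y : A) : Prop := x * (x * y) + y * (x * x) = (q + q⁻¹) • (x * (y * x))

/-- The Serre expression is linear in y and compatible with multiplication by anything commuting
with x. Together with `SerreRel.mul_left` and `SerreRel.sub_smul` this carries the relation from a
simple root vector y to q-commutators of y with elements that commute with x. -/
theorem SerreRel.mul_right {x y z : A} (h : SerreRel q x y) (hz : Commute x z) :
    SerreRel q x (y * z) := by
  unfold SerreRel at *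
  have h1 := congrArg (· * z) h
  simp only [add_mul, smul_mul_assoc, mul_assoc] at h1
  simp only [mul_assoc]
  rw [← hz.eq, ← h1, ← mul_assoc z x x, ← hz.eq, mul_assoc x z x, ← hz.eq]

theorem SerreRel.mul_left {x y z : A} (h : SerreRel q x y) (hz : Commute x z) :
    SerreRel q x (z * y) := by
  unfold SerreRel at *
  have h1 := congrArg (z * ·) h
  simp only [mul_add, mul_smul_comm] at h1
  have h2 : ∀ t, x * (z * t) = z * (x * t) := fun t => by rw [← mul_assoc, hz.eq, mul_assoc]
  simp only [mul_assoc, h2]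
  exact h1

theorem SerreRel.sub_smul {x y z : A} (hy : SerreRel q x y) (hz : SerreRel q x z) (t : ℂ) :
    SerreRel q x (y - t • z) := by
  unfold SerreRel at *
  simp only [mul_sub, sub_mul, mul_smul_comm, smul_mul_assoc, smul_sub, smul_comm _ t] at *
  rw [← hy, ← hz]
  module

/-- The relations between the simple root vectors `e i = E^i_{i+1}`, where the odd one has
`i + 1 = M`. -/
structure HalfRel (M : ℕ) (q : ℂ) (e : ℕ → A) : Prop where
  comm : ∀ i j, i + 2 ≤ j → Commute (e i) (e j)
  sq : ∀ i, i + 1 = M → e i * e i = 0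
  serre : ∀ i j, (i + 1 = j ∨ j + 1 = i) → i + 1 ≠ M → SerreRel q (e i) (e j)
  quartic : ∀ i, i + 2 = M → e (i + 1) * posRoot M q e i (i + 3) =
    -(posRoot M q e i (i + 3) * e (i + 1))

namespace HalfRel

theorem comm' (h : HalfRel M q e) {i j : ℕ} (hij : i + 2 ≤ j ∨ j + 2 ≤ i) :
    Commute (e i) (e j) :=
  hij.elim (h.comm i j) fun h' => (h.comm j i h').symm

theorem commute_far (h : HalfRel M q e) {i a b : ℕ} (hi : i + 2 ≤ a ∨ b + 1 ≤ i) :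
    Commute (e i) (posRoot M q e a b) :=
  commute_posRoot fun j _ _ => h.comm' (by omega)

theorem commute_root (h : HalfRel M q e) {a b c d : ℕ} (hbc : b + 1 ≤ c) :
    Commute (posRoot M q e a b) (posRoot M q e c d) :=
  commute_posRoot fun j _ _ => (h.commute_far (by omega)).symm

/-- The recursion for root vectors holds for every intermediate index. -/
theorem posRoot_split (h : HalfRel M q e) {a c b : ℕ} (hac : a < c) (hcb : c < b) :
    posRoot M q e a b = posRoot M q e a c * posRoot M q e c b -
      (qs M q c)⁻¹ • (posRoot M q e c b * posRoot M q e a c) := by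
  induction b with
  | zero => omega
  | succ b ih =>
    rcases Nat.lt_succ_iff_lt_or_eq.1 hcb with hcb | rfl
    -- The left factor only involves e_j with j < c < b, hence commutes with e_b; bracketing with
    -- e_b therefore acts on the right factor alone.
    · have h1 : Commute (posRoot M q e a c) (e b) := (h.commute_far (by omega)).symm
      have h2 : ∀ t, e b * (posRoot M q e a c * t) = posRoot M q e a c * (e b * t) := fun t => by
        rw [← mul_assoc, ← h1.eq, mul_assoc]
      rw [posRoot_succ (by omega), posRoot_succ hcb.ne, ih hcb]
      simp only [mul_sub, sub_mul, mul_smul_comm, smul_mul_assoc, smul_sub, mul_assoc, h2, h1.eq]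
      module
    · rw [posRoot_self_succ, posRoot_succ hac.ne]

/-- Of the factors of E^a_i only the last one, e_{i-1}, fails to commute with e_i. -/
theorem serre_left (h : HalfRel M q e) {a i : ℕ} (ha : a < i) (hi : i + 1 ≠ M) :
    SerreRel q (e i) (posRoot M q e a i) := by
  obtain ⟨j, rfl⟩ : ∃ j, i = j + 1 := ⟨i - 1, by omega⟩
  have h1 := h.serre (j + 1) j (Or.inr rfl) hi
  rcases Nat.lt_succ_iff_lt_or_eq.1 ha with ha | rfl
  · have h2 : Commute (e (j + 1)) (posRoot M q e a j) := h.commute_far (by omega)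
    rw [posRoot_succ ha.ne]
    exact (h1.mul_left h2).sub_smul (h1.mul_right h2) _
  · rwa [posRoot_self_succ]

/-- Here the factor that fails to commute with e_i is the first one, e_{i+1}. The recursion peels
off the last factor, so `posRoot_split` is needed to isolate the first. -/
theorem serre_right (h : HalfRel M q e) {b i : ℕ} (hb : i + 1 < b) (hi : i + 1 ≠ M) :
    SerreRel q (e i) (posRoot M q e (i + 1) b) := by
  have h1 := h.serre i (i + 1) (Or.inl rfl) hi
  rcases Nat.lt_or_eq_of_le (show i + 1 + 1 ≤ b from hb) with hb | rfl
  · have h2 : Commute (e i) (posRoot M q e (i + 1 + 1) b) := h.commute_far (by omega)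
    rw [h.posRoot_split (c := i + 1 + 1) (by omega) hb, posRoot_self_succ]
    exact (h1.mul_right h2).sub_smul (h1.mul_left h2) _
  · rwa [posRoot_self_succ]

/-- One formula for two mechanisms. With E^a_{i+1} written as the q-commutator of E^a_i and e_i, the
even case is the Serre relation for e_i and E^a_i, read as a q-commutation with that bracket; in the
odd case e_i² = 0 leaves a single monomial. The factors `sg` and `qs` are chosen to cover both. -/
theorem simple_mul_end (h : HalfRel M q e) (hq : q ≠ 0) {a i : ℕ} (ha : a < i) :
    (sg M (i + 1) * qs M q (i + 1)) • (e i * posRoot M q e a (i + 1)) =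
      sg M i • (posRoot M q e a (i + 1) * e i) := by
  rw [posRoot_succ ha.ne]
  simp only [mul_sub, sub_mul, mul_smul_comm, smul_mul_assoc, smul_sub, mul_assoc]
  by_cases hi : i + 1 = M
  · have h1 := h.sq i hi
    rw [sg_of_lt (a := i) (by omega), sg_of_le (a := i + 1) (by omega), qs_of_lt (a := i) (by omega),
      qs_of_le (a := i + 1) (by omega), h1, ← mul_assoc (e i) (e i), h1]
    simp
  · have h1 := h.serre_left ha hi
    unfold SerreRel at h1
    rw [sg_succ hi, qs_succ hi, ← qs_add_inv (M := M) i] at *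
    have h0 : qs M q i ≠ 0 := qs_ne_zero hq i
    generalize qs M q i = t at *
    have h2 : posRoot M q e a i * (e i * e i) = (t + t⁻¹) • (e i * (posRoot M q e a i * e i)) -
      e i * (e i * posRoot M q e a i) := by rw [← h1]; abel
    rw [h2]
    match_scalars <;> field_simp
    ring

/-- Mirror image of `simple_mul_end`, with e_i split off at the lower end of the root. -/
theorem simple_mul_start (h : HalfRel M q e) (hq : q ≠ 0) {b i : ℕ} (hb : i + 1 < b) :
    sg M (i + 1) • (e i * posRoot M q e i b) =
      (sg M i * qs M q i) • (posRoot M q e i b * e i) := by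
  rw [h.posRoot_split (c := i + 1) (by omega) hb, posRoot_self_succ]
  simp only [mul_sub, sub_mul, mul_smul_comm, smul_mul_assoc, smul_sub, mul_assoc]
  by_cases hi : i + 1 = M
  · have h1 := h.sq i hi
    rw [sg_of_lt (a := i) (by omega), sg_of_le (a := i + 1) (by omega), qs_of_lt (a := i) (by omega),
      qs_of_le (a := i + 1) (by omega), h1, ← mul_assoc (e i) (e i), h1]
    simp
  · have h1 := h.serre_right hb hi
    unfold SerreRel at h1
    rw [sg_succ hi, qs_succ hi, ← qs_add_inv (M := M) i] at *
    have h0 : qs M q i ≠ 0 := qs_ne_zero hq i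
    generalize qs M q i = t at *
    generalize posRoot M q e (i + 1) b = Y at *
    have h2 : Y * (e i * e i) = (t + t⁻¹) • (e i * (Y * e i)) - e i * (e i * Y) := by
      rw [← h1]; abel
    rw [h2]
    match_scalars <;> field_simp
    ring

/-- Applied with x = E^a_i, y = e_i, z = E^{i+1}_b. The two Serre relations are solved for yxy and
yzy, which requires dividing by t + t⁻¹; after this substitution, and sorting z past x, both
products have the same normal form. -/
theorem simple_comm_middle_even {x y z : A} {t : ℂ} (ht : t ≠ 0) (ht' : t + t⁻¹ ≠ 0)
    (hx : y * (y * x) + x * (y * y) = (t + t⁻¹) • (y * (x * y)))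
    (hz : y * (y * z) + z * (y * y) = (t + t⁻¹) • (y * (z * y))) (hxz : Commute x z) :
    Commute y ((x * y - t⁻¹ • (y * x)) * z - t⁻¹ • (z * (x * y - t⁻¹ • (y * x)))) := by
  have hx' : y * (x * y) = (t + t⁻¹)⁻¹ • (y * (y * x) + x * (y * y)) := by
    rw [hx, smul_smul, inv_mul_cancel₀ ht', one_smul]
  have hz' : y * (z * y) = (t + t⁻¹)⁻¹ • (y * (y * z) + z * (y * y)) := by
    rw [hz, smul_smul, inv_mul_cancel₀ ht', one_smul]
  have h1 : y * (x * (y * z)) = (t + t⁻¹)⁻¹ • (y * (y * (x * z)) + x * (y * (y * z))) := by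
    have := congrArg (· * z) hx'
    simpa only [mul_assoc, smul_mul_assoc, add_mul] using this
  have h2 : y * (z * (y * x)) = (t + t⁻¹)⁻¹ • (y * (y * (x * z)) + z * (y * (y * x))) := by
    have := congrArg (· * x) hz'
    simp only [mul_assoc, smul_mul_assoc, add_mul] at this
    rw [this, hxz.eq]
  have h3 : ∀ s, z * (x * s) = x * (z * s) := fun s => by
    rw [← mul_assoc, ← hxz.eq, mul_assoc]
  have hu : t ^ 2 + 1 ≠ 0 := by
    intro h0
    apply ht'
    field_simp
    linear_combination h0
  rw [commute_iff_eq]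
  simp only [mul_sub, sub_mul, mul_smul_comm, smul_mul_assoc, smul_sub, mul_assoc, hx', hz', h1, h2,
    smul_add, mul_add, h3]
  match_scalars <;> field_simp <;> ring

/-- For even e_i this is `simple_comm_middle_even`. For odd e_i the Serre relations are replaced by
the quartic relation, which is the case of the shortest root E^{i-1}_{i+2}; longer roots differ from
it by factors commuting with e_i. -/
theorem simple_mul_middle (h : HalfRel M q e) (hq : q ≠ 0) (hq' : q + q⁻¹ ≠ 0) {a b i : ℕ}
    (ha : a < i) (hb : i + 1 < b) :
    sg M (i + 1) • (e i * posRoot M q e a b) = sg M i • (posRoot M q e a b * e i) := by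
  by_cases hi : i + 1 = M
  · rw [sg_of_lt (a := i) (by omega), sg_of_le (a := i + 1) (by omega), one_smul, neg_one_smul,
      neg_eq_iff_eq_neg]
    obtain ⟨j, rfl⟩ : ∃ j, i = j + 1 := ⟨i - 1, by omega⟩
    -- The root is lengthened on the right here, starting from the quartic relation at b = j + 3; it
    -- is lengthened on the left afterwards.
    have key : ∀ b, j + 3 ≤ b → e (j + 1) * posRoot M q e j b =
        -(posRoot M q e j b * e (j + 1)) := by
      intro b hb
      rcases Nat.lt_or_eq_of_le hb with hb | rfl
      · have h1 : Commute (e (j + 1)) (posRoot M q e (j + 3) b) := h.commute_far (by omega)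
        have h2 := h.quartic j hi
        rw [h.posRoot_split (c := j + 3) (by omega) hb]
        generalize posRoot M q e (j + 3) b = z at *
        generalize posRoot M q e j (j + 3) = x at *
        simp only [mul_sub, sub_mul, mul_smul_comm, smul_mul_assoc, mul_assoc]
        rw [← mul_assoc, h2, ← mul_assoc _ z x, h1.eq, mul_assoc z, h2, neg_mul, mul_assoc, h1.eq]
        simp only [mul_neg]
        module
      · exact h.quartic j hi
    rcases Nat.lt_succ_iff_lt_or_eq.1 ha with ha | rfl
    · have h1 : Commute (e (j + 1)) (posRoot M q e a j) := h.commute_far (by omega)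
      have h2 := key b (by omega)
      rw [h.posRoot_split (c := j) ha (by omega)]
      generalize posRoot M q e a j = z at *
      generalize posRoot M q e j b = x at *
      simp only [mul_sub, sub_mul, mul_smul_comm, smul_mul_assoc, mul_assoc]
      rw [← mul_assoc _ z x, h1.eq, mul_assoc, h2, ← mul_assoc _ x z, h2, neg_mul, mul_assoc, h1.eq]
      simp only [mul_neg]
      module
    · exact key b (by omega)
  · rw [sg_succ hi]
    congr 1
    have h1 := h.serre_left ha hi
    have h2 := h.serre_right hb hi
    unfold SerreRel at h1 h2
    rw [← qs_add_inv (M := M) i] at h1 h2 hq'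
    have h3 := simple_comm_middle_even (qs_ne_zero hq i) hq' h1 h2 (h.commute_root (by omega))
    rw [h.posRoot_split (c := i + 1) (by omega) hb, posRoot_succ ha.ne, qs_succ hi]
    exact h3.eq

end HalfRel

end Half

open MulOpposite

/-! ### Raising and lowering generators together: the symmetry between them, weights, and brackets
of e_i with lowering root vectors -/

section Data

variable {A : Type*} [Ring A] [Algebra ℂ A] {M n : ℕ} {q : ℂ} {e f k k' : ℕ → A}

/-- The root vector `E^b_a`, `a < b`, built from simple root vectors `f i = E^{i+1}_i` by the
recursion `E^{b+1}_a = E^{b+1}_b E^b_a - q^{(-1)^{[b]}} E^b_a E^{b+1}_b`, and `0` for `b ≤ a`. -/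
def negRoot (M : ℕ) (q : ℂ) (f : ℕ → A) (a : ℕ) : ℕ → A
  | 0 => 0
  | b + 1 => if a = b then f b else
      f b * negRoot M q f a b - qs M q b • (negRoot M q f a b * f b)

/-- Reversing products and inverting q interchanges the two recursions. Statements about lowering
root vectors are obtained from those about raising ones through this identity. -/
theorem posRoot_op (a b : ℕ) :
    posRoot M q⁻¹ (fun i => op (f i)) a b = op (negRoot M q f a b) := by
  induction b with
  | zero => rfl
  | succ b ih =>
    rw [posRoot, negRoot, apply_ite op, ih, qs_inv, inv_inv]
    simp

theorem negRoot_op (a b : ℕ) :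
    negRoot M q⁻¹ (fun i => op (e i)) a b = op (posRoot M q e a b) := by
  induction b with
  | zero => rfl
  | succ b ih =>
    rw [posRoot, negRoot, apply_ite op, ih, qs_inv]
    simp

/-- Since f x - q_b x f = -q_b (x f - q_b⁻¹ f x), the two recursions applied to the same simple
vectors differ by a nonzero scalar. A homogeneous linear relation for one is thus one for the other;
this is used for the quartic relation. -/
theorem exists_negRoot_eq (hq : q ≠ 0) (a b : ℕ) :
    ∃ t : ℂ, t ≠ 0 ∧ negRoot M q e a b = t • posRoot M q e a b := by
  induction b with
  | zero => exact ⟨1, one_ne_zero, by simp [negRoot, posRoot]⟩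
  | succ b ih =>
    obtain ⟨t, ht0, ht⟩ := ih
    have := qs_ne_zero (M := M) hq b
    rw [posRoot, negRoot]
    split_ifs
    · exact ⟨1, one_ne_zero, by simp⟩
    · refine ⟨-(t * qs M q b), by simp [ht0, this], ?_⟩
      rw [ht]
      simp only [mul_smul_comm, smul_mul_assoc]
      match_scalars <;> field_simp

theorem SerreRel.op {x y : A} (h : SerreRel q x y) : SerreRel q⁻¹ (op x) (op y) := by
  unfold SerreRel at *
  rw [inv_inv, add_comm q⁻¹]
  have := congrArg MulOpposite.op h
  simp only [op_add, op_mul, op_smul, mul_assoc] at this ⊢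
  rw [← this, add_comm]

/-- The relations between simple root vectors are preserved by passing to the opposite algebra
and replacing `q` by its inverse. -/
theorem HalfRel.op (h : HalfRel M q e) (hq : q ≠ 0) : HalfRel M q⁻¹ (fun i => op (e i)) where
  comm i j hij := (h.comm i j hij).op
  sq i hi := by rw [← op_mul, h.sq i hi, op_zero]
  serre i j hij hi := (h.serre i j hij hi).op
  quartic i hi := by
    -- In the opposite algebra the root vector becomes a lowering one, that is, a multiple of the
    -- original; anticommutation is insensitive to the order of the product.
    obtain ⟨t, -, ht⟩ := exists_negRoot_eq (M := M) (e := e) hq i (i + 3)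
    rw [posRoot_op, ht, ← op_mul, ← op_mul, ← op_neg]
    congr 1
    rw [smul_mul_assoc, mul_smul_comm, h.quartic i hi, smul_neg, neg_neg]

/-- The exponential of the weight of `E^x_y` under `q^{(-1)^{[a]} E^a_a}`. -/
def rootWt (M : ℕ) (q : ℂ) (a x y : ℕ) : ℂ :=
  (if a = x then qs M q a else 1) * (if a = y then (qs M q a)⁻¹ else 1)

theorem rootWt_self (hq : q ≠ 0) (a x : ℕ) : rootWt M q a x x = 1 := by
  have := qs_ne_zero (M := M) hq a
  unfold rootWt
  split_ifs <;> simp [this]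

/-- Weights telescope along a chain of indices, so the weight of an iterated bracket depends only on
its end points. -/
theorem rootWt_mul (hq : q ≠ 0) (a x y z : ℕ) :
    rootWt M q a x y * rootWt M q a y z = rootWt M q a x z := by
  have := qs_ne_zero (M := M) hq a
  unfold rootWt
  split_ifs <;> simp [this]

theorem rootWt_inv (a x y : ℕ) : (rootWt M q a x y)⁻¹ = rootWt M q a y x := by
  unfold rootWt
  split_ifs <;> simp [mul_comm]

theorem rootWt_inv_left (a x y : ℕ) : rootWt M q⁻¹ a x y = rootWt M q a y x := by
  unfold rootWt
  rw [qs_inv, mul_comm]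
  split_ifs <;> simp

/-- The relations of `U_q(gl(M|N))`, `M + N = n`, for elements `e i = E^i_{i+1}`,
`f i = E^{i+1}_i`, `k a = q^{(-1)^{[a]} E^a_a}` and `k' a = (k a)⁻¹` indexed by all natural
numbers. -/
structure QData (M n : ℕ) (q : ℂ) (e f k k' : ℕ → A) : Prop where
  k_mul_k' : ∀ a, k a * k' a = 1
  k'_mul_k : ∀ a, k' a * k a = 1
  k_comm : ∀ a b, Commute (k a) (k b)
  k_e : ∀ a i, k a * e i = rootWt M q a i (i + 1) • (e i * k a)
  k_f : ∀ a i, k a * f i = rootWt M q a (i + 1) i • (f i * k a)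
  -- The bound matters: in `QuantumGL.qData` generators out of range are 0 and Cartan elements out
  -- of range are 1, so for i + 1 = n the relation would force k i = k' i.
  e_f_self : ∀ i, i + 1 < n → e i * f i = (sg M i * sg M (i + 1)) • (f i * e i) +
    (sg M i * (q - q⁻¹)⁻¹) • (k i * k' (i + 1) - k' i * k (i + 1))
  e_f : ∀ i j, i ≠ j → Commute (e i) (f j)
  pos : HalfRel M q e
  neg : HalfRel M q f

namespace QData

theorem k_comm_k' (h : QData M n q e f k k') (a b : ℕ) : Commute (k a) (k' b) := by
  rw [commute_iff_eq]
  calc k a * k' b = k' b * (k b * k a) * k' b := by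
        rw [← mul_assoc, h.k'_mul_k, one_mul]
    _ = k' b * k a := by rw [(h.k_comm b a).eq, mul_assoc, mul_assoc, h.k_mul_k', mul_one]

theorem k'_comm_k' (h : QData M n q e f k k') (a b : ℕ) : Commute (k' a) (k' b) := by
  rw [commute_iff_eq]
  calc k' a * k' b = k' b * (k b * k' a) * k' b := by
        rw [← mul_assoc, h.k'_mul_k, one_mul]
    _ = k' b * k' a := by rw [(h.k_comm_k' b a).eq, mul_assoc, mul_assoc, h.k_mul_k', mul_one]

theorem k'_mul_of_k_mul (h : QData M n q e f k k') {a : ℕ} {x : A} {t : ℂ}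
    (hx : k a * x = t • (x * k a)) : x * k' a = t • (k' a * x) := by
  calc x * k' a = k' a * (k a * x) * k' a := by rw [← mul_assoc, h.k'_mul_k, one_mul]
    _ = t • (k' a * x) := by
      rw [hx, mul_smul_comm, smul_mul_assoc, mul_assoc, mul_assoc, h.k_mul_k', mul_one]

/-- The relations are preserved by passing to the opposite algebra, exchanging raising and lowering
generators and replacing `q` by its inverse. -/
theorem op (h : QData M n q e f k k') (hq : q ≠ 0) :
    QData M n q⁻¹ (fun i => MulOpposite.op (f i)) (fun i => MulOpposite.op (e i))
      (fun i => MulOpposite.op (k' i)) (fun i => MulOpposite.op (k i)) where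
  k_mul_k' a := by rw [← op_mul, h.k_mul_k', op_one]
  k'_mul_k a := by rw [← op_mul, h.k'_mul_k, op_one]
  k_comm a b := (h.k'_comm_k' a b).op
  k_e a i := by rw [← op_mul, h.k'_mul_of_k_mul (h.k_f a i), rootWt_inv_left, op_smul, op_mul]
  k_f a i := by rw [← op_mul, h.k'_mul_of_k_mul (h.k_e a i), rootWt_inv_left, op_smul, op_mul]
  e_f_self i hi := by
    -- Exchanging k with k' and inverting q each change the sign of the Cartan term, so it is
    -- preserved.
    rw [← op_mul, h.e_f_self i hi, (h.k_comm_k' i (i + 1)).eq, ← (h.k_comm_k' (i + 1) i).eq, inv_inv,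
      ← neg_sub q, inv_neg]
    simp only [op_add, op_smul, op_mul, op_sub]
    module
  e_f i j hij := (h.e_f j i hij.symm).symm.op
  pos := h.neg.op hq
  neg := h.pos.op hq

theorem k_posRoot (h : QData M n q e f k k') (hq : q ≠ 0) (a x y : ℕ) :
    k a * posRoot M q e x y = rootWt M q a x y • (posRoot M q e x y * k a) := by
  induction y with
  | zero => simp [posRoot]
  | succ y ih =>
    rw [posRoot]
    split_ifs with hxy
    · rw [hxy]; exact h.k_e a y
    · rw [← rootWt_mul hq a x y]
      simp only [mul_sub, sub_mul, mul_smul_comm, smul_mul_assoc, ← mul_assoc, ih, h.k_e a y]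
      simp only [mul_assoc, h.k_e a y, ih, mul_smul_comm]
      module

theorem k_negRoot (h : QData M n q e f k k') (hq : q ≠ 0) (a x y : ℕ) :
    k a * negRoot M q f x y = rootWt M q a y x • (negRoot M q f x y * k a) := by
  induction y with
  | zero => simp [negRoot]
  | succ y ih =>
    rw [negRoot]
    split_ifs with hxy
    · rw [hxy]; exact h.k_f a y
    · rw [← rootWt_mul hq a (y + 1) y x]
      simp only [mul_sub, sub_mul, mul_smul_comm, smul_mul_assoc, ← mul_assoc, ih, h.k_f a y]
      simp only [mul_assoc, h.k_f a y, ih, mul_smul_comm]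
      module

theorem negRoot_split (h : QData M n q e f k k') (hq : q ≠ 0) {a c b : ℕ} (hac : a < c)
    (hcb : c < b) : negRoot M q f a b = negRoot M q f c b * negRoot M q f a c -
      qs M q c • (negRoot M q f a c * negRoot M q f c b) := by
  have := congrArg unop ((h.op hq).pos.posRoot_split hac hcb)
  simpa [posRoot_op, qs_inv] using this

theorem commute_negRoot {x : A} {a b : ℕ} (h : ∀ j, a ≤ j → j < b → Commute x (f j)) :
    Commute x (negRoot M q f a b) := by
  have := commute_posRoot (M := M) (q := q⁻¹) (e := fun i => MulOpposite.op (f i))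
    fun j h1 h2 => (h j h1 h2).op
  rw [posRoot_op] at this
  exact this.unop

theorem negRoot_of_le {a b : ℕ} (h : b ≤ a) : negRoot M q f a b = 0 := by
  have := congrArg unop
    (posRoot_of_le (M := M) (q := q⁻¹) (e := fun i => MulOpposite.op (f i)) h)
  simpa [posRoot_op] using this

theorem negRoot_self_succ (a : ℕ) : negRoot M q f a (a + 1) = f a := by
  rw [negRoot, if_pos rfl]

theorem negRoot_succ {a b : ℕ} (h : a ≠ b) : negRoot M q f a (b + 1) =
    f b * negRoot M q f a b - qs M q b • (negRoot M q f a b * f b) := by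
  rw [negRoot, if_neg h]

theorem negRoot_comm_negRoot (h : QData M n q e f k k') {a b c d : ℕ} (hbc : b + 1 ≤ c) :
    Commute (negRoot M q f a b) (negRoot M q f c d) :=
  commute_negRoot fun _ _ _ => (commute_negRoot fun _ _ _ => h.neg.comm' (by omega)).symm

theorem simple_negRoot_comm (h : QData M n q e f k k') {i a b : ℕ} (hi : i < a ∨ b ≤ i) :
    Commute (e i) (negRoot M q f a b) :=
  commute_negRoot fun _ _ _ => h.e_f _ _ (by omega)

/-- Write E^{i+1}_a as the q-commutator of f_i and F = E^i_a. Since e_i commutes with F, it only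
meets f_i; in the resulting Cartan terms k_i k'_{i+1} cancels, while k'_i k_{i+1} keeps the factor
q_i - q_i⁻¹ = ±(q - q⁻¹), which removes the denominator. -/
theorem simple_negRoot_end (h : QData M n q e f k k') (hq : q ≠ 0) (hq2 : q - q⁻¹ ≠ 0) {i a : ℕ}
    (hi : i + 1 < n) (ha : a < i) :
    e i * negRoot M q f a (i + 1) = (sg M i * sg M (i + 1)) • (negRoot M q f a (i + 1) * e i) +
      negRoot M q f a i * (k' i * k (i + 1)) := by
  have h1 : Commute (e i) (negRoot M q f a i) := h.simple_negRoot_comm (by omega)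
  have h2 := h.k_negRoot hq i a i
  have h3 := h.k_negRoot hq (i + 1) a i
  have h4 := h.k'_mul_of_k_mul h2
  have h5 := h.k'_mul_of_k_mul h3
  have h6 := h.e_f_self i hi
  have h7 := qs_sub_inv (M := M) (q := q) i
  have h8 := (h.k_comm_k' (i + 1) i).eq
  have h9 := qs_ne_zero (M := M) hq i
  have h10 := sg_mul_self (M := M) i
  simp only [rootWt, if_true, if_neg (show ¬ i = a by omega), if_neg (show ¬ i + 1 = i by omega),
    if_neg (show ¬ i + 1 = a by omega), mul_one, one_smul] at h2 h3 h4 h5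
  rw [negRoot_succ ha.ne]
  generalize negRoot M q f a i = F at *
  have h4' : k' i * F = (qs M q i)⁻¹ • (F * k' i) := by
    rw [h4, smul_smul, inv_mul_cancel₀ h9, one_smul]
  have a1 : e i * (f i * F) = (sg M i * sg M (i + 1)) • (f i * (F * e i)) +
      (sg M i * (q - q⁻¹)⁻¹) • (qs M q i • (F * (k i * k' (i + 1))) -
        (qs M q i)⁻¹ • (F * (k' i * k (i + 1)))) := by
    rw [← mul_assoc, h6, add_mul, smul_mul_assoc, mul_assoc, h1.eq, smul_mul_assoc, sub_mul,
      mul_assoc (k i), ← h5, ← mul_assoc (k i), h2, mul_assoc (k' i), h3, ← mul_assoc (k' i), h4']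
    simp only [smul_mul_assoc, mul_assoc]
  have a2 : e i * (F * f i) = (sg M i * sg M (i + 1)) • (F * (f i * e i)) +
      (sg M i * (q - q⁻¹)⁻¹) • (F * (k i * k' (i + 1)) - F * (k' i * k (i + 1))) := by
    rw [← mul_assoc, h1.eq, mul_assoc, h6, mul_add, mul_smul_comm, mul_smul_comm, mul_sub]
  rw [mul_sub, mul_smul_comm, a1, a2, sub_mul, smul_mul_assoc, mul_assoc, mul_assoc]
  have h11 : (qs M q i)⁻¹ = qs M q i - sg M i * (q - q⁻¹) := by linear_combination -h7
  rw [h11]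
  match_scalars
  · ring
  · ring
  · linear_combination (q - q⁻¹) * (q - q⁻¹)⁻¹ * h10 + mul_inv_cancel₀ hq2
  · ring

/-- As in `simple_negRoot_end`, with f_i split off at the lower end; now k'_i k_{i+1} cancels and
k_i k'_{i+1} survives. -/
theorem simple_negRoot_start (h : QData M n q e f k k') (hq : q ≠ 0) (hq2 : q - q⁻¹ ≠ 0)
    {i b : ℕ} (hi : i + 1 < n) (hb : i + 1 < b) :
    e i * negRoot M q f i b = (sg M i * sg M (i + 1)) • (negRoot M q f i b * e i -
      k i * k' (i + 1) * negRoot M q f (i + 1) b) := by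
  have h1 : Commute (e i) (negRoot M q f (i + 1) b) := h.simple_negRoot_comm (by omega)
  have h2 := h.k_negRoot hq i (i + 1) b
  have h3 := h.k_negRoot hq (i + 1) (i + 1) b
  have h4 := h.k'_mul_of_k_mul h2
  have h5 := h.k'_mul_of_k_mul h3
  have h6 := h.e_f_self i hi
  have h7 := qs_sub_inv (M := M) (q := q) (i + 1)
  have h8 := (h.k_comm_k' (i + 1) i).eq
  have h9 := qs_ne_zero (M := M) hq (i + 1)
  have h10 := sg_mul_self (M := M) (i + 1)
  simp only [rootWt, if_true, if_neg (show ¬ i = b by omega), if_neg (show ¬ i = i + 1 by omega),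
    if_neg (show ¬ i + 1 = b by omega), mul_one, one_mul, one_smul] at h2 h3 h4 h5
  rw [h.negRoot_split hq (c := i + 1) (by omega) hb, negRoot_self_succ]
  generalize negRoot M q f (i + 1) b = F at *
  generalize qs M q (i + 1) = t at *
  have h3' : F * k (i + 1) = t • (k (i + 1) * F) := by
    rw [h3, smul_smul, mul_inv_cancel₀ h9, one_smul]
  have a1 : e i * (f i * F) = (sg M i * sg M (i + 1)) • (f i * (F * e i)) +
      (sg M i * (q - q⁻¹)⁻¹) • (k i * (k' (i + 1) * F) - k' i * (k (i + 1) * F)) := by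
    rw [← mul_assoc, h6, add_mul, smul_mul_assoc, mul_assoc, h1.eq, smul_mul_assoc, sub_mul,
      mul_assoc (k i), mul_assoc (k' i)]
  have a2 : e i * (F * f i) = (sg M i * sg M (i + 1)) • (F * (f i * e i)) +
      (sg M i * (q - q⁻¹)⁻¹) • (t⁻¹ • (k i * (k' (i + 1) * F)) -
        t • (k' i * (k (i + 1) * F))) := by
    rw [← mul_assoc, h1.eq, mul_assoc, h6, mul_add, mul_smul_comm, mul_smul_comm, mul_sub,
      ← mul_assoc F (k i), ← h2, mul_assoc (k i), h5, ← mul_assoc F (k' i), h4, mul_assoc (k' i),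
      h3', mul_smul_comm, mul_smul_comm]
  rw [mul_sub, mul_smul_comm, a1, a2, sub_mul, smul_mul_assoc, mul_assoc, mul_assoc, mul_assoc]
  have h11 : t⁻¹ = t - sg M (i + 1) * (q - q⁻¹) := by linear_combination -h7
  rw [h11]
  match_scalars
  · ring
  · linear_combination (-(sg M i * sg M (i + 1))) * mul_inv_cancel₀ hq2
  · ring
  · ring

/-- Split the root at i + 1. The bracket of e_i with E^{i+1}_a leaves a term with k_{i+1}, whose
weight on E^b_{i+1} is exactly the coefficient of the q-commutator, so its two occurrences cancel.
-/
theorem simple_negRoot_middle (h : QData M n q e f k k') (hq : q ≠ 0) (hq2 : q - q⁻¹ ≠ 0)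
    {i a b : ℕ} (hi : i + 1 < n) (ha : a < i) (hb : i + 1 < b) :
    e i * negRoot M q f a b = (sg M i * sg M (i + 1)) • (negRoot M q f a b * e i) := by
  have h1 : Commute (e i) (negRoot M q f (i + 1) b) := h.simple_negRoot_comm (by omega)
  have h2 := h.k_negRoot hq i (i + 1) b
  have h3 := h.k_negRoot hq (i + 1) (i + 1) b
  have h4 := h.k'_mul_of_k_mul h2
  have h5 := h.simple_negRoot_end hq hq2 hi ha
  have h6 : Commute (negRoot M q f a i) (negRoot M q f (i + 1) b) :=
    h.negRoot_comm_negRoot (by omega)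
  have h9 := qs_ne_zero (M := M) hq (i + 1)
  simp only [rootWt, if_true, if_neg (show ¬ i = b by omega), if_neg (show ¬ i = i + 1 by omega),
    if_neg (show ¬ i + 1 = b by omega), mul_one, one_mul, one_smul] at h2 h3 h4
  rw [h.negRoot_split hq (c := i + 1) (by omega) hb]
  generalize negRoot M q f (i + 1) b = F at *
  generalize negRoot M q f a (i + 1) = G at *
  generalize negRoot M q f a i = G' at *
  generalize qs M q (i + 1) = t at *
  have a1 : e i * (F * G) = (sg M i * sg M (i + 1)) • (F * (G * e i)) +
      G' * (k' i * (F * k (i + 1))) := by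
    rw [← mul_assoc, h1.eq, mul_assoc, h5, mul_add, mul_smul_comm, ← mul_assoc F G', ← h6.eq,
      mul_assoc G', ← mul_assoc F (k' i), h4, mul_assoc (k' i)]
  have a2 : e i * (G * F) = (sg M i * sg M (i + 1)) • (G * (F * e i)) +
      t⁻¹ • (G' * (k' i * (F * k (i + 1)))) := by
    rw [← mul_assoc, h5, add_mul, smul_mul_assoc, mul_assoc, h1.eq, mul_assoc, mul_assoc, h3,
      mul_smul_comm, mul_smul_comm]
  rw [mul_sub, mul_smul_comm, a1, a2, sub_mul, smul_mul_assoc, mul_assoc, mul_assoc]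
  match_scalars
  · ring
  · field_simp
    ring
  · ring

end QData

end Data

/-! ### Entrywise form of R⁺ l⁺₁ Y₂ = Y₂ l⁺₁ R⁺, and its adjacent entries for Y = l⁺ -/

section Rel

variable {A : Type*} [Ring A] [Algebra ℂ A] {M n : ℕ} {q : ℂ} {e f k k' : ℕ → A}

/-- The sign `(-1)^{[x][y] + [y][z] + [z][x]}`. -/
def majSg (M x y z : ℕ) : ℂ :=
  (sg M x + sg M y + sg M z - sg M x * sg M y * sg M z) / 2

theorem majSg_self (x z : ℕ) : majSg M x x z = sg M x := by
  rw [majSg, sg_mul_self]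
  ring

/-- `majSg` is the majority of three signs. Parity is monotone in the index, so the majority is the
sign of the middle index. -/
theorem majSg_of_le {x y z : ℕ} (hxy : x ≤ y) (hyz : y ≤ z) : majSg M x y z = sg M y := by
  unfold majSg
  rcases lt_or_ge y M with h | h
  · rw [sg_of_lt h, sg_of_lt (a := x) (by omega)]
    ring
  · rw [sg_of_le h, sg_of_le (a := z) (by omega)]
    ring

theorem majSg_comm (x y z : ℕ) : majSg M x y z = majSg M y x z := by
  unfold majSg; ring

theorem majSg_rotate (x y z : ℕ) : majSg M x y z = majSg M y z x := by
  unfold majSg; ring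

theorem majSg_succ_of_le {i z : ℕ} (hz : z ≤ i) : majSg M (i + 1) i z = sg M i := by
  rw [majSg_comm, ← majSg_rotate, majSg_of_le hz (by omega)]

theorem majSg_succ_of_ge {i z : ℕ} (hz : i + 1 ≤ z) : majSg M (i + 1) i z = sg M (i + 1) := by
  rw [majSg_comm, majSg_of_le (by omega) hz]

/-- The entry `(x, y), (z, w)` of the relation `R⁺ X₁ Y₂ = Y₂ X₁ R⁺`, where
`R⁺ = q^{∑ (-1)^{[a]} e^a_a ⊗ e^a_a} + (q - q⁻¹) ∑_{a>b} (-1)^{[b]} e^a_b ⊗ e^b_a`, for even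
matrices `∑ (-1)^{[a][b]} e^a_b ⊗ X a b` and `∑ (-1)^{[a][b]} e^a_b ⊗ Y a b`. -/
def RelPlus {I : Type*} [LinearOrder I] (ν : I → ℕ) (M : ℕ) (q : ℂ) (X Y : I → I → A)
    (x y z w : I) : Prop :=
  ((if x = z then qs M q (ν x) else 1) * majSg M (ν x) (ν y) (ν z)) • (X x y * Y z w) +
      (if z < x then q - q⁻¹ else 0) • (X z y * Y x w) =
    ((if y = w then qs M q (ν y) else 1) * majSg M (ν x) (ν y) (ν w)) • (Y z w * X x y) +
      (if y < w then q - q⁻¹ else 0) • (Y z y * X x w)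

/-- The entries of `l^{(+)}`, up to sign. -/
def lp (M : ℕ) (q : ℂ) (e k : ℕ → A) (b a : ℕ) : A :=
  if a = b then sg M b • k b else (q - q⁻¹) • (k b * posRoot M q e a b)

/-- The entries of `l^{(-)}`, up to sign. -/
def lm (M : ℕ) (q : ℂ) (f k' : ℕ → A) (a b : ℕ) : A :=
  if a = b then sg M b • k' b else
    (-((q - q⁻¹) * (sg M a * sg M b))) • (negRoot M q f a b * k' b)

theorem lp_self (a : ℕ) : lp M q e k a a = sg M a • k a := if_pos rfl

theorem lm_self (a : ℕ) : lm M q f k' a a = sg M a • k' a := if_pos rfl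

theorem lp_of_ne {a b : ℕ} (h : a ≠ b) :
    lp M q e k b a = (q - q⁻¹) • (k b * posRoot M q e a b) := if_neg h

theorem lm_of_ne {a b : ℕ} (h : a ≠ b) : lm M q f k' a b =
    (-((q - q⁻¹) * (sg M a * sg M b))) • (negRoot M q f a b * k' b) := if_neg h

theorem lp_of_lt {a b : ℕ} (h : b < a) : lp M q e k b a = 0 := by
  rw [lp_of_ne h.ne', posRoot_of_le h.le, mul_zero, smul_zero]

theorem lm_of_lt {a b : ℕ} (h : b < a) : lm M q f k' a b = 0 := by
  rw [lm_of_ne h.ne', QData.negRoot_of_le h.le, zero_mul, smul_zero]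

theorem lp_succ_self (i : ℕ) : lp M q e k (i + 1) i = (q - q⁻¹) • (k (i + 1) * e i) := by
  rw [lp_of_ne (by omega), posRoot_self_succ]

namespace QData

theorem k_lp (h : QData M n q e f k k') (hq : q ≠ 0) (x z w : ℕ) :
    k x * lp M q e k z w = rootWt M q x w z • (lp M q e k z w * k x) := by
  unfold lp
  split_ifs with hzw
  · rw [hzw, rootWt_self hq, mul_smul_comm, (h.k_comm x z).eq, smul_mul_assoc, one_smul]
  · rw [mul_smul_comm, ← mul_assoc, (h.k_comm x z).eq, mul_assoc, h.k_posRoot hq]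
    simp only [mul_smul_comm, smul_mul_assoc, mul_assoc]
    module

theorem k_lm (h : QData M n q e f k k') (hq : q ≠ 0) (x z w : ℕ) :
    k x * lm M q f k' z w = rootWt M q x w z • (lm M q f k' z w * k x) := by
  unfold lm
  split_ifs with hzw
  · rw [hzw, rootWt_self hq, mul_smul_comm, (h.k_comm_k' x w).eq, smul_mul_assoc, one_smul]
  · rw [mul_smul_comm, ← mul_assoc (k x), h.k_negRoot hq x z w, smul_mul_assoc, mul_assoc,
      (h.k_comm_k' x w).eq, smul_mul_assoc, mul_assoc, smul_comm]

/-- As l⁺ is triangular, both exchange terms vanish, and the relation says only that Y z w has the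
weight of E^z_w under k_x, which is `hY`. -/
theorem relPlus_diag (hq : q ≠ 0) {Y : ℕ → ℕ → A} {x z w : ℕ}
    (hY : k x * Y z w = rootWt M q x w z • (Y z w * k x)) :
    RelPlus id M q (lp M q e k) Y x x z w := by
  have h0 := qs_ne_zero (M := M) hq x
  have h1 : (if z < x then q - q⁻¹ else 0) • (lp M q e k z x * Y x w) = 0 := by
    split_ifs with h
    · rw [lp_of_lt h, zero_mul, smul_zero]
    · rw [zero_smul]
  have h2 : (if x < w then q - q⁻¹ else 0) • (Y z x * lp M q e k x w) = 0 := by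
    split_ifs with h
    · rw [lp_of_lt h, mul_zero, smul_zero]
    · rw [zero_smul]
  unfold RelPlus
  rw [h1, h2, lp_self]
  simp only [id, majSg_self, smul_mul_assoc, mul_smul_comm, hY, add_zero, smul_smul]
  congr 1
  unfold rootWt
  split_ifs <;> field_simp

theorem lp_mul_lp (h : QData M n q e f k k') (hq : q ≠ 0) {a b d g : ℕ} (hab : a ≠ b)
    (hgd : g ≠ d) : lp M q e k b a * lp M q e k d g =
      ((q - q⁻¹) * (q - q⁻¹) * rootWt M q d b a) •
        (k b * k d * (posRoot M q e a b * posRoot M q e g d)) := by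
  have h1 := h.k_posRoot hq d a b
  have h2 : posRoot M q e a b * k d = rootWt M q d b a • (k d * posRoot M q e a b) := by
    rw [h1, smul_smul, rootWt_mul hq, rootWt_self hq, one_smul]
  rw [lp_of_ne hab, lp_of_ne hgd]
  simp only [smul_mul_assoc, mul_smul_comm, smul_smul]
  rw [mul_assoc (k b), ← mul_assoc (posRoot M q e a b), h2]
  simp only [smul_mul_assoc, mul_smul_comm, smul_smul, mul_assoc]

theorem k_mul_lp {a d g : ℕ} (hgd : g ≠ d) : lp M q e k a a * lp M q e k d g =
      (sg M a * (q - q⁻¹)) • (k a * k d * posRoot M q e g d) := by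
  rw [lp_of_ne hgd, lp_self]
  simp only [smul_mul_assoc, mul_smul_comm, smul_smul, mul_assoc, mul_comm (q - q⁻¹)]

theorem lp_mul_k (h : QData M n q e f k k') (hq : q ≠ 0) {a d g : ℕ} (hgd : g ≠ d) :
    lp M q e k d g * lp M q e k a a =
      (sg M a * (q - q⁻¹) * rootWt M q a d g) • (k a * k d * posRoot M q e g d) := by
  have h1 := h.k_posRoot hq a g d
  have h2 : posRoot M q e g d * k a = rootWt M q a d g • (k a * posRoot M q e g d) := by
    rw [h1, smul_smul, rootWt_mul hq, rootWt_self hq, one_smul]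
  rw [lp_of_ne hgd, lp_self]
  simp only [smul_mul_assoc, mul_smul_comm, smul_smul]
  rw [mul_assoc (k d), h2, mul_smul_comm, smul_smul, ← mul_assoc, (h.k_comm d a).eq]

/-- Away from the diagonal the relation compares e_i with the root vector E^w_z. The position of z
and w relative to i and i + 1 decides which commutation rule is meant and whether an exchange term
is present. -/
theorem relPlus_lp_lp_simple (h : QData M n q e f k k') (hq : q ≠ 0) (hq' : q + q⁻¹ ≠ 0)
    (i z w : ℕ) : RelPlus id M q (lp M q e k) (lp M q e k) (i + 1) i z w := by
  have h0 := qs_ne_zero (M := M) hq i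
  have h0' := qs_ne_zero (M := M) hq (i + 1)
  have hi := qs_sub_inv (M := M) (q := q) i
  have hi' := qs_sub_inv (M := M) (q := q) (i + 1)
  have hs := sg_mul_self (M := M) i
  have hs' := sg_mul_self (M := M) (i + 1)
  unfold RelPlus
  simp only [id]
  have hE : z < i ∨ i + 1 < w → lp M q e k z i * lp M q e k (i + 1) w = 0 := by
    rintro (h1 | h1)
    · rw [lp_of_lt h1, zero_mul]
    · rw [lp_of_lt h1, mul_zero]
  rcases lt_trichotomy z w with hzw | rfl | hzw
  -- Above the diagonal only the exchange terms remain; they are nonzero only for z = i, w = i + 1,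
  -- where they coincide.
  · rw [lp_of_lt hzw, mul_zero, zero_mul, smul_zero, smul_zero, zero_add, zero_add]
    by_cases h1 : z < i ∨ i + 1 < w
    · rw [hE h1, smul_zero, smul_zero]
    · rw [if_pos (by omega), if_pos (by omega)]
  · have h1 := h.lp_mul_k hq (a := z) (d := i + 1) (g := i) (by omega)
    have h2 := k_mul_lp (M := M) (q := q) (e := e) (k := k) (a := z) (d := i + 1) (g := i) (by omega)
    by_cases hz : z < i ∨ i + 1 < z
    · rw [hE hz, h1, h2]
      rcases hz with hz | hz <;>
        simp (disch := omega) only [if_pos, if_neg, majSg_succ_of_le, majSg_succ_of_ge, smul_zero,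
          add_zero, rootWt, mul_one]
    · obtain rfl | rfl : z = i ∨ z = i + 1 := by omega
      · rw [h1, h2]
        simp (disch := omega) only [if_pos, if_neg, if_true, majSg_succ_of_le, zero_smul, add_zero, rootWt,
          one_mul]
        match_scalars
        linear_combination (-(sg M z * sg M z * (q - q⁻¹))) * hi - (q - q⁻¹) ^ 2 * sg M z * hs
      · rw [h1, h2]
        simp (disch := omega) only [if_pos, if_neg, if_true, majSg_succ_of_ge, zero_smul, add_zero, rootWt,
          mul_one, one_mul]
        match_scalars
        linear_combination sg M (i + 1) * sg M (i + 1) * (q - q⁻¹) * qs M q (i + 1) * hi' +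
          sg M (i + 1) * sg M (i + 1) * (q - q⁻¹) * mul_inv_cancel₀ h0' +
          (q - q⁻¹) ^ 2 * sg M (i + 1) * qs M q (i + 1) * hs'
  · have h1 := h.lp_mul_lp hq (b := i + 1) (a := i) (d := z) (g := w) (by omega) (by omega)
    have h2 := h.lp_mul_lp hq (b := z) (a := w) (d := i + 1) (g := i) (by omega) (by omega)
    rw [(h.k_comm z (i + 1)).eq] at h2
    rw [posRoot_self_succ] at h1 h2
    rw [h1, h2]
    by_cases hzi : z < i ∨ i + 1 < w
    · have h3 : Commute (e i) (posRoot M q e w z) := h.pos.commute_far (by omega)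
      rw [hE hzi]
      rcases hzi with hzi | hzi <;>
        simp (disch := omega) only [if_pos, if_neg, majSg_succ_of_le, majSg_succ_of_ge, smul_zero,
          add_zero, rootWt, mul_one, one_mul, h3.eq]
    -- Now i ≤ z and w ≤ i + 1. For z = i the relation is the recursion for E^w_{i+1}; for z = i + 1
    -- it is `simple_mul_end` or a trivial comparison of squares; for z > i + 1 it is
    -- `simple_mul_middle`, `simple_mul_start`, or the splitting of E^i_z at i + 1, according to w.
    · rcases Nat.lt_trichotomy z (i + 1) with hz | rfl | hz
      · obtain rfl : z = i := by omega
        have h3 := posRoot_succ (M := M) (q := q) (e := e) hzw.ne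
        rw [k_mul_lp (by omega), h3, (h.k_comm z (z + 1)).eq]
        simp (disch := omega) only [if_pos, if_neg, if_true, majSg_succ_of_le, zero_smul, add_zero,
          rootWt, mul_one, one_mul, mul_sub, mul_smul_comm]
        match_scalars <;> ring
      · rcases Nat.lt_or_eq_of_le (Nat.le_of_lt_succ hzw) with hw | rfl
        · have h3 := congrArg (fun x => ((q - q⁻¹) * (q - q⁻¹) * qs M q (i + 1)) •
            (k (i + 1) * k (i + 1) * x)) (h.pos.simple_mul_end hq hw)
          simp (disch := omega) only [if_neg, if_true, majSg_succ_of_le, majSg_succ_of_ge,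
            zero_smul, add_zero, rootWt, mul_one, one_mul, mul_smul_comm] at h3 ⊢
          linear_combination (norm := module) h3
        · simp (disch := omega) only [if_neg, if_true, majSg_succ_of_le, majSg_succ_of_ge,
            zero_smul, add_zero, rootWt, mul_one, posRoot_self_succ]
          -- Both sides are multiples of e_w²: it vanishes at the odd root, and the coefficients
          -- agree at an even one.
          by_cases hM : w + 1 = M
          · rw [h.pos.sq w hM, mul_zero, smul_zero, smul_zero, smul_zero]
          · rw [qs_succ hM, sg_succ hM]
      · rcases Nat.lt_trichotomy w i with hw | rfl | hw
        · have h3 := congrArg (fun x => ((q - q⁻¹) * (q - q⁻¹)) •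
            (k (i + 1) * k z * x)) (h.pos.simple_mul_middle hq hq' hw hz)
          simp (disch := omega) only [if_neg, majSg_succ_of_le, majSg_succ_of_ge,
            zero_smul, add_zero, rootWt, mul_one, one_mul, mul_smul_comm] at h3 ⊢
          linear_combination (norm := module) h3
        · have h3 := congrArg (fun x => ((q - q⁻¹) * (q - q⁻¹)) •
            (k (w + 1) * k z * x)) (h.pos.simple_mul_start hq hz)
          simp (disch := omega) only [if_neg, if_true, majSg_succ_of_le, majSg_succ_of_ge,
            zero_smul, add_zero, rootWt, mul_one, one_mul, mul_smul_comm] at h3 ⊢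
          linear_combination (norm := module) h3
        · obtain rfl : w = i + 1 := by omega
          have h3 := h.pos.posRoot_split (a := i) (c := i + 1) (b := z) (by omega) hz
          rw [h.lp_mul_k hq (by omega), h3, posRoot_self_succ]
          simp (disch := omega) only [if_pos, if_neg, if_true, majSg_succ_of_ge, zero_smul,
            add_zero, rootWt, mul_one, one_mul, mul_sub, mul_smul_comm]
          match_scalars <;> ring

end QData

end Rel

/-! ### The adjacent entries for Y = l⁻ -/

section Rel

variable {A : Type*} [Ring A] [Algebra ℂ A] {M n : ℕ} {q : ℂ} {e f k k' : ℕ → A}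

namespace QData

theorem lp_simple_mul_lm {i z w : ℕ} (hzw : z ≠ w) :
    lp M q e k (i + 1) i * lm M q f k' z w =
      (-((q - q⁻¹) * (q - q⁻¹) * (sg M z * sg M w))) •
        (k (i + 1) * (e i * negRoot M q f z w) * k' w) := by
  rw [lp_succ_self, lm_of_ne hzw]
  simp only [smul_mul_assoc, mul_smul_comm, smul_smul, mul_assoc]
  congr 1
  ring

theorem k'_mul_simple (h : QData M n q e f k k') (hq : q ≠ 0) (a i : ℕ) :
    k' a * e i = rootWt M q a (i + 1) i • (e i * k' a) := by
  rw [h.k'_mul_of_k_mul (h.k_e a i), smul_smul, rootWt_mul hq, rootWt_self hq, one_smul]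

theorem lm_mul_lp_simple (h : QData M n q e f k k') (hq : q ≠ 0) {i z w : ℕ} (hzw : z ≠ w) :
    lm M q f k' z w * lp M q e k (i + 1) i =
      (-((q - q⁻¹) * (q - q⁻¹) * (sg M z * sg M w)) *
        (rootWt M q (i + 1) z w * rootWt M q w (i + 1) i)) •
        (k (i + 1) * (negRoot M q f z w * e i) * k' w) := by
  have h1 : negRoot M q f z w * k (i + 1) =
      rootWt M q (i + 1) z w • (k (i + 1) * negRoot M q f z w) := by
    rw [h.k_negRoot hq, smul_smul, rootWt_mul hq, rootWt_self hq, one_smul]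
  rw [lp_succ_self, lm_of_ne hzw]
  simp only [smul_mul_assoc, mul_smul_comm, smul_smul]
  rw [mul_assoc (negRoot M q f z w), ← mul_assoc (k' w), ← (h.k_comm_k' _ _).eq, mul_assoc (k _),
    h.k'_mul_simple hq, mul_smul_comm, mul_smul_comm, ← mul_assoc (negRoot M q f z w), h1]
  simp only [smul_mul_assoc, smul_smul, mul_assoc]
  congr 1
  ring

theorem lp_simple_mul_k' {i z : ℕ} : lp M q e k (i + 1) i * lm M q f k' z z =
      ((q - q⁻¹) * sg M z) • (k (i + 1) * e i * k' z) := by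
  rw [lp_succ_self, lm_self]
  simp only [smul_mul_assoc, mul_smul_comm, smul_smul, mul_comm]

theorem k'_mul_lp_simple (h : QData M n q e f k k') (hq : q ≠ 0) {i z : ℕ} :
    lm M q f k' z z * lp M q e k (i + 1) i =
      ((q - q⁻¹) * sg M z * rootWt M q z (i + 1) i) • (k (i + 1) * e i * k' z) := by
  rw [lp_succ_self, lm_self]
  simp only [smul_mul_assoc, mul_smul_comm, smul_smul]
  rw [← mul_assoc (k' z), ← (h.k_comm_k' _ _).eq, mul_assoc (k _), h.k'_mul_simple hq]
  simp only [mul_smul_comm, smul_smul, mul_assoc]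

/-- The exchange terms are the Cartan parts of the bracket of e_i with a lowering root vector. By
triangularity the left one survives only for z = i < w (`hE1`), the right one only for z ≤ i and w =
i + 1 (`hE2`). -/
theorem relPlus_lp_lm_simple (h : QData M n q e f k k') (hq : q ≠ 0) (hq2 : q - q⁻¹ ≠ 0)
    {i : ℕ} (hi : i + 1 < n) (z w : ℕ) :
    RelPlus id M q (lp M q e k) (lm M q f k') (i + 1) i z w := by
  have h0 := qs_ne_zero (M := M) hq i
  have h0' := qs_ne_zero (M := M) hq (i + 1)
  have hs := sg_mul_self (M := M) i
  have hs' := sg_mul_self (M := M) (i + 1)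
  have hsz := sg_mul_self (M := M) z
  have hsw := sg_mul_self (M := M) w
  unfold RelPlus
  simp only [id]
  have hE1 : z ≠ i ∨ w < i + 1 → (if z < i + 1 then q - q⁻¹ else 0) •
      (lp M q e k z i * lm M q f k' (i + 1) w) = 0 := by
    rintro (h1 | h1)
    · split_ifs with h2
      · rw [lp_of_lt (by omega), zero_mul, smul_zero]
      · rw [zero_smul]
    · rw [lm_of_lt h1, mul_zero, smul_zero]
  have hE2 : i < z ∨ w ≠ i + 1 → (if i < w then q - q⁻¹ else 0) •
      (lm M q f k' z i * lp M q e k (i + 1) w) = 0 := by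
    rintro (h1 | h1)
    · rw [lm_of_lt h1, zero_mul, smul_zero]
    · split_ifs with h2
      · rw [lp_of_lt (by omega), mul_zero, smul_zero]
      · rw [zero_smul]
  rcases lt_trichotomy z w with hzw | rfl | hzw
  · rw [lp_simple_mul_lm hzw.ne, h.lm_mul_lp_simple hq hzw.ne]
    rcases Nat.lt_or_ge i w with hw | hw
    · rcases Nat.lt_or_ge i z with hz | hz
      · have h3 : Commute (e i) (negRoot M q f z w) := h.simple_negRoot_comm (by omega)
        rw [hE1 (by omega), hE2 (by omega), h3.eq, majSg_succ_of_ge hz, majSg_succ_of_ge hw,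
          if_neg (show ¬ i = w by omega), add_zero, add_zero, smul_smul, smul_smul]
        congr 1
        unfold rootWt
        rcases Nat.lt_or_eq_of_le hz with hz' | rfl <;>
          simp (disch := omega) only [if_neg, if_true] <;> ring
      · rw [majSg_succ_of_le hz, majSg_succ_of_ge hw, if_neg (show ¬ i = w by omega),
          if_neg (show ¬ i + 1 = z by omega)]
        -- Here z ≤ i < w, so E^w_z contains f_i. According to whether z < i or z = i, and w > i + 1
        -- or w = i + 1, the relation is `simple_negRoot_middle`, `simple_negRoot_end`,
        -- `simple_negRoot_start` or `e_f_self`.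
        rcases Nat.lt_or_eq_of_le hz with hz' | rfl
        · rw [hE1 (by omega)]
          rcases Nat.lt_or_eq_of_le (show i + 1 ≤ w from hw) with hw' | rfl
          · rw [hE2 (by omega), h.simple_negRoot_middle hq hq2 hi hz' hw']
            simp (disch := omega) only [if_neg, rootWt, mul_smul_comm, smul_mul_assoc]
            match_scalars
            linear_combination (-(sg M (i + 1) * (q - q⁻¹) ^ 2 * sg M z * sg M w)) * hs
          · have h4 : k (i + 1) * (negRoot M q f z i * (k' i * k (i + 1))) * k' (i + 1) =
                negRoot M q f z i * (k' i * k (i + 1)) := by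
              rw [← mul_assoc, h.k_negRoot hq, mul_assoc (_ • _), mul_assoc (k' i), h.k_mul_k',
                ← (h.k_comm_k' _ _).eq]
              simp (disch := omega) only [if_neg, rootWt, mul_one, one_smul, mul_assoc]
            rw [h.simple_negRoot_end hq hq2 hi hz', mul_add, add_mul, h4, if_pos hw, lp_self,
              lm_of_ne hz'.ne]
            simp (disch := omega) only [if_neg, if_true, rootWt, mul_smul_comm, smul_mul_assoc,
              mul_assoc]
            match_scalars
            · linear_combination (-(sg M (i + 1) ^ 2 * (q - q⁻¹) ^ 2 * sg M z)) * hs +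
                sg M (i + 1) ^ 2 * (q - q⁻¹) ^ 2 * sg M z * inv_mul_cancel₀ h0'
            · ring
        · rcases Nat.lt_or_eq_of_le (show z + 1 ≤ w from hw) with hw' | rfl
          · have h4 : k (z + 1) * (k z * k' (z + 1) * negRoot M q f (z + 1) w) * k' w =
                k z * negRoot M q f (z + 1) w * k' w := by
              rw [← mul_assoc (k (z + 1)), ← mul_assoc (k (z + 1)), (h.k_comm _ z).eq,
                mul_assoc (k z), h.k_mul_k', mul_one]
            rw [h.simple_negRoot_start hq hq2 hi hw', hE2 (by omega), lp_self, lm_of_ne hw'.ne,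
              if_pos (by omega), smul_sub, mul_sub (k (z + 1)), sub_mul _ _ (k' w), mul_smul_comm, mul_smul_comm,
              smul_mul_assoc, smul_mul_assoc, h4]
            simp (disch := omega) only [if_neg, rootWt, mul_smul_comm, smul_mul_assoc, mul_assoc]
            match_scalars
            · linear_combination (-(sg M (z + 1) * (q - q⁻¹) ^ 2 * sg M z * sg M w)) * hs
            · linear_combination (sg M (z + 1) * (q - q⁻¹) ^ 2 * sg M z * sg M w) * hs
          · have h4 : ∀ x, Commute (k (z + 1)) x → k (z + 1) * x * k' (z + 1) = x := fun x hx => by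
              rw [hx.eq, mul_assoc, h.k_mul_k', mul_one]
            rw [negRoot_self_succ, h.e_f_self z hi, mul_add, add_mul, mul_smul_comm _ (k (z + 1)),
              mul_smul_comm _ (k (z + 1)), smul_mul_assoc, smul_mul_assoc, h4 (_ - _)
                (((h.k_comm _ _).mul_right (h.k_comm_k' _ _)).sub_right
                ((h.k_comm_k' _ _).mul_right (h.k_comm _ _)))]
            simp (disch := omega) only [if_neg, if_pos, if_true, rootWt, mul_smul_comm,
              smul_mul_assoc, lp_self, lm_self, mul_assoc]
            match_scalars
            · linear_combination (-(sg M (z + 1) ^ 2 * (q - q⁻¹) ^ 2 * sg M z)) * hs +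
                sg M (z + 1) ^ 2 * (q - q⁻¹) ^ 2 * sg M z * inv_mul_cancel₀ h0'
            · linear_combination (-(sg M z * sg M (z + 1) * (q - q⁻¹))) * hs -
                sg M z ^ 3 * sg M (z + 1) * (q - q⁻¹) * mul_inv_cancel₀ hq2
            · linear_combination (sg M z * sg M (z + 1) * (q - q⁻¹)) * hs +
                sg M z ^ 3 * sg M (z + 1) * (q - q⁻¹) * mul_inv_cancel₀ hq2
    · have h3 : Commute (e i) (negRoot M q f z w) := h.simple_negRoot_comm (by omega)
      rw [hE1 (by omega), hE2 (by omega), h3.eq, majSg_succ_of_le hw,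
        majSg_succ_of_le (by omega), if_neg (show ¬ i + 1 = z by omega),
        add_zero, add_zero, smul_smul, smul_smul]
      congr 1
      unfold rootWt
      rcases Nat.lt_or_eq_of_le hw with hz' | rfl <;>
        simp (disch := omega) only [if_neg, if_true] <;> field_simp
  · rw [hE1 (by omega), hE2 (by omega), lp_simple_mul_k', h.k'_mul_lp_simple hq, add_zero,
      add_zero, smul_smul, smul_smul]
    congr 1
    unfold rootWt
    split_ifs <;> first | omega | (subst_vars; field_simp)
  · rw [hE1 (by omega), hE2 (by omega), lm_of_lt hzw, mul_zero, zero_mul, smul_zero, smul_zero]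

end QData

end Rel

/-! ### From adjacent entries of l⁺ to all entries: blocks of R⁺ l⁺₁ and l⁺₁ R⁺ -/

section Closure

variable {A : Type*} [Ring A] {M n : ℕ} {q : ℂ}

/-- `matR` is a diagonal matrix plus one row, and `matL` a diagonal matrix plus one column. This and
`sum_col_mul_col` multiply such shapes with abstract coefficients. -/
theorem sum_row_mul_row (d d' v v' : Fin n → A) (y y' z w : Fin n) :
    ∑ f, ((if z = f then d f else 0) + (if z = y then v f else 0)) *
        ((if f = w then d' w else 0) + (if f = y' then v' w else 0)) =
      (if z = w then d w * d' w else 0) + (if z = y' then d y' * v' w else 0) +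
        (if z = y then v w * d' w else 0) + (if z = y then v y' * v' w else 0) := by
  by_cases hz : z = y
  · simp only [hz, add_mul, mul_add, Finset.sum_add_distrib, ite_mul, mul_ite, zero_mul, mul_zero,
      Finset.sum_ite_eq', Finset.mem_univ, if_true]
    split_ifs <;> simp_all <;> abel
  · simp only [hz, add_mul, mul_add, Finset.sum_add_distrib, ite_mul, mul_ite, zero_mul, mul_zero,
      Finset.sum_ite_eq', Finset.mem_univ, if_true, if_false]
    split_ifs <;> simp_all

theorem sum_col_mul_col (d d' v v' : Fin n → A) (x x' z w : Fin n) :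
    ∑ f, ((if z = f then d f else 0) + (if f = x then v z else 0)) *
        ((if f = w then d' w else 0) + (if w = x' then v' f else 0)) =
      (if z = w then d w * d' w else 0) + (if w = x' then d z * v' z else 0) +
        (if w = x then v z * d' w else 0) + (if w = x' then v z * v' x else 0) := by
  by_cases hw : w = x'
  · simp only [hw, add_mul, mul_add, Finset.sum_add_distrib, ite_mul, mul_ite, zero_mul, mul_zero,
      Finset.sum_ite_eq, Finset.sum_ite_eq', Finset.mem_univ, if_true]
    split_ifs <;> simp_all <;> abel
  · simp only [hw, add_mul, mul_add, Finset.sum_add_distrib, ite_mul, mul_ite, zero_mul, mul_zero,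
      Finset.sum_ite_eq', Finset.mem_univ, if_true, if_false,
      Finset.sum_const_zero]
    split_ifs <;> simp_all

variable [Algebra ℂ A]

/-- The matrix with `Y * matR X x y` collecting the right-hand sides of `RelPlus`. -/
def matR (M : ℕ) (q : ℂ) (X : Fin n → Fin n → A) (x y : Fin n) : Matrix (Fin n) (Fin n) A :=
  fun z w =>
    (if z = w then ((if y = w then qs M q y else 1) * majSg M x y w) • X x y else 0) +
      (if z = y then (if y < w then q - q⁻¹ else 0) • X x w else 0)

/-- The matrix with `matL X x y * Y` collecting the left-hand sides of `RelPlus`. -/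
def matL (M : ℕ) (q : ℂ) (X : Fin n → Fin n → A) (x y : Fin n) : Matrix (Fin n) (Fin n) A :=
  fun z w =>
    (if z = w then ((if x = w then qs M q x else 1) * majSg M x y w) • X x y else 0) +
      (if w = x then (if z < x then q - q⁻¹ else 0) • X z y else 0)

/-- For fixed x, y the relation becomes an intertwining property of Y. Such properties are stable
under sums and products of the pairs (`matL`, `matR`), which is what permits an induction over the
entries of X. -/
theorem relPlus_iff {X : Fin n → Fin n → A} {Y : Matrix (Fin n) (Fin n) A} {x y : Fin n} :
    (∀ z w, RelPlus Fin.val M q X Y x y z w) ↔ matL M q X x y * Y = Y * matR M q X x y := by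
  rw [← Matrix.ext_iff]
  refine forall_congr' fun z => forall_congr' fun w => ?_
  unfold RelPlus
  rw [Matrix.mul_apply, Matrix.mul_apply]
  simp only [matL, matR, add_mul, mul_add, Finset.sum_add_distrib, ite_mul, mul_ite, zero_mul,
    mul_zero, Finset.sum_ite_eq, Finset.sum_ite_eq', Finset.mem_univ, if_true, smul_mul_assoc,
    mul_smul_comm]

theorem matR_mul_apply (X : Fin n → Fin n → A) (x y x' y' z w : Fin n) :
    (matR M q X x y * matR M q X x' y') z w =
      (if z = w then (((if y = w then qs M q y else 1) * majSg M x y w) *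
        ((if y' = w then qs M q y' else 1) * majSg M x' y' w)) • (X x y * X x' y') else 0) +
      (if z = y' then (((if y = y' then qs M q y else 1) * majSg M x y y') *
        (if y' < w then q - q⁻¹ else 0)) • (X x y * X x' w) else 0) +
      (if z = y then ((if y < w then q - q⁻¹ else 0) *
        ((if y' = w then qs M q y' else 1) * majSg M x' y' w)) • (X x w * X x' y') else 0) +
      (if z = y then ((if y < y' then q - q⁻¹ else 0) *
        (if y' < w then q - q⁻¹ else 0)) • (X x y' * X x' w) else 0) := by
  simp only [← smul_mul_smul_comm]
  exact sum_row_mul_row (fun w => ((if y = w then qs M q y else 1) * majSg M x y w) • X x y)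
    (fun w => ((if y' = w then qs M q y' else 1) * majSg M x' y' w) • X x' y')
    (fun w => (if y < w then q - q⁻¹ else 0) • X x w)
    (fun w => (if y' < w then q - q⁻¹ else 0) • X x' w) y y' z w

theorem matL_mul_apply (X : Fin n → Fin n → A) (x y x' y' z w : Fin n) :
    (matL M q X x y * matL M q X x' y') z w =
      (if z = w then (((if x = w then qs M q x else 1) * majSg M x y w) *
        ((if x' = w then qs M q x' else 1) * majSg M x' y' w)) • (X x y * X x' y') else 0) +
      (if w = x' then (((if x = z then qs M q x else 1) * majSg M x y z) *
        (if z < x' then q - q⁻¹ else 0)) • (X x y * X z y') else 0) +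
      (if w = x then ((if z < x then q - q⁻¹ else 0) *
        ((if x' = w then qs M q x' else 1) * majSg M x' y' w)) • (X z y * X x' y') else 0) +
      (if w = x' then ((if z < x then q - q⁻¹ else 0) *
        (if x < x' then q - q⁻¹ else 0)) • (X z y * X x y') else 0) := by
  simp only [← smul_mul_smul_comm]
  exact sum_col_mul_col (fun w => ((if x = w then qs M q x else 1) * majSg M x y w) • X x y)
    (fun w => ((if x' = w then qs M q x' else 1) * majSg M x' y' w) • X x' y')
    (fun z => (if z < x then q - q⁻¹ else 0) • X z y)
    (fun z => (if z < x' then q - q⁻¹ else 0) • X z y') x x' z w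

/-- On the diagonal the row contributions would need an index strictly smaller than itself, so only
the product of the diagonal parts remains. -/
theorem matR_mul_apply_self (X : Fin n → Fin n → A) (x y x' y' w : Fin n) :
    (matR M q X x y * matR M q X x' y') w w =
      (((if y = w then qs M q y else 1) * majSg M x y w) *
        ((if y' = w then qs M q y' else 1) * majSg M x' y' w)) • (X x y * X x' y') := by
  have h1 : ∀ (c : ℂ) (F : A), (if w = y' then (c * if y' < w then q - q⁻¹ else 0) • F else 0)
      = 0 := by
    intro c F; split_ifs <;> first | rfl | order | simp
  have h2 : ∀ (c : ℂ) (F : A), (if w = y then ((if y < w then q - q⁻¹ else 0) * c) • F else 0)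
      = 0 := by
    intro c F; split_ifs <;> first | rfl | order | simp
  have h3 : ∀ F : A, (if w = y then ((if y < y' then q - q⁻¹ else 0) *
      (if y' < w then q - q⁻¹ else 0)) • F else 0) = 0 := by
    intro F; split_ifs <;> first | rfl | order | simp
  rw [matR_mul_apply, h1, h2, h3, if_pos rfl, add_zero, add_zero, add_zero]

theorem matL_mul_apply_self (X : Fin n → Fin n → A) (x y x' y' w : Fin n) :
    (matL M q X x y * matL M q X x' y') w w =
      (((if x = w then qs M q x else 1) * majSg M x y w) *
        ((if x' = w then qs M q x' else 1) * majSg M x' y' w)) • (X x y * X x' y') := by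
  have h1 : ∀ (c : ℂ) (F : A), (if w = x' then (c * if w < x' then q - q⁻¹ else 0) • F else 0)
      = 0 := by
    intro c F; split_ifs <;> first | rfl | order | simp
  have h2 : ∀ (c : ℂ) (F : A), (if w = x then ((if w < x then q - q⁻¹ else 0) * c) • F else 0)
      = 0 := by
    intro c F; split_ifs <;> first | rfl | order | simp
  have h3 : ∀ F : A, (if w = x' then ((if w < x then q - q⁻¹ else 0) *
      (if x < x' then q - q⁻¹ else 0)) • F else 0) = 0 := by
    intro F; split_ifs <;> first | rfl | order | simp
  rw [matL_mul_apply, h1, h2, h3, if_pos rfl, add_zero, add_zero, add_zero]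

end Closure

section Closure

variable {A : Type*} [Ring A] [Algebra ℂ A] {M n : ℕ} {q : ℂ} {e f k k' : ℕ → A}

namespace QData

/-- This is the relation for l⁺ with itself at (b + 1, b), (b, w), read as a formula for the entry
(b + 1, w). It determines that entry because the diagonal entry (b, b) is invertible and q - q⁻¹ ≠
0. -/
theorem lp_recursion (h : QData M n q e f k k') (hq : q ≠ 0) (hq' : q + q⁻¹ ≠ 0) {b w : ℕ}
    (hw : w < b) : (q - q⁻¹) • (lp M q e k b b * lp M q e k (b + 1) w) =
      sg M b • (lp M q e k b w * lp M q e k (b + 1) b) -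
        sg M b • (lp M q e k (b + 1) b * lp M q e k b w) := by
  have h1 := h.relPlus_lp_lp_simple hq hq' b b w
  unfold RelPlus at h1
  simp (disch := omega) only [id, if_pos, if_neg, majSg_succ_of_le, zero_smul, add_zero,
    one_mul] at h1
  rw [← h1, add_sub_cancel_left]

theorem lp_comm_far (h : QData M n q e f k k') (hq : q ≠ 0) (hq' : q + q⁻¹ ≠ 0) {b z w : ℕ}
    (hz : z < b) :
    lp M q e k (b + 1) b * lp M q e k z w = lp M q e k z w * lp M q e k (b + 1) b := by
  rcases Nat.lt_or_ge z w with hw | hw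
  · rw [lp_of_lt hw, mul_zero, zero_mul]
  have h1 := h.relPlus_lp_lp_simple hq hq' b z w
  unfold RelPlus at h1
  simp (disch := omega) only [id, if_pos, if_neg, majSg_succ_of_le, add_zero,
    one_mul, lp_of_lt, zero_mul, smul_zero] at h1
  exact smul_right_injective A (sg_ne_zero (M := M) b) h1

theorem lp_diag_mul (h : QData M n q e f k k') (hq : q ≠ 0) (x z w : ℕ) :
    lp M q e k x x * lp M q e k z w = rootWt M q x w z • (lp M q e k z w * lp M q e k x x) := by
  rw [lp_self, smul_mul_assoc, h.k_lp hq, mul_smul_comm, smul_comm]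

theorem majSg_mul_majSg {a b z : ℕ} (hab : a ≤ b) :
    majSg M b a z * majSg M (b + 1) b z = sg M b * majSg M (b + 1) a z := by
  unfold majSg
  rcases lt_or_ge b M with h | h
  · rw [sg_of_lt h, sg_of_lt (a := a) (by omega)]
    ring
  · rw [sg_of_le h, sg_of_le (a := b + 1) (by omega)]
    ring

variable (n) in
/-- The entries of `l^{(+)}` with indices below `n`. -/
abbrev lpFin (M : ℕ) (q : ℂ) (e k : ℕ → A) (x y : Fin n) : A := lp M q e k x y

/-- The blocks of l⁺₁ R⁺ obey the same recursion as the entries of l⁺. Conceptually this is the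
Yang–Baxter equation: if l⁺ and R⁺ both satisfy the exchange relation with R⁺, so does their
product. Here the single instance needed is verified entry by entry. -/
theorem matR_recursion (h : QData M n q e f k k') (hq : q ≠ 0) (hq' : q + q⁻¹ ≠ 0)
    {a b d : Fin n} (hd : (d : ℕ) = b + 1) (hab : a < b) :
    (q - q⁻¹) • (matR M q (lpFin n M q e k) b b * matR M q (lpFin n M q e k) d a) =
      sg M b • (matR M q (lpFin n M q e k) b a * matR M q (lpFin n M q e k) d b) -
      sg M b • (matR M q (lpFin n M q e k) d b * matR M q (lpFin n M q e k) b a) := by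
  have hab' : (a : ℕ) < b := hab
  have hb := qs_sub_inv (M := M) (q := q) b
  have h0 := qs_ne_zero (M := M) hq b
  have hs := sg_mul_self (M := M) b
  have hm : majSg M b a b = sg M b := by rw [majSg_rotate, majSg_rotate, majSg_self]
  ext z w
  rcases eq_or_ne z w with rfl | hzw
  · have h1 := congrArg (fun t => (sg M b * ((if b = z then qs M q b else 1) *
      (if a = z then qs M q a else 1) * majSg M d a z)) • t) (h.lp_recursion hq hq' hab')
    have h2 := majSg_mul_majSg (M := M) (z := z) hab'.le
    rw [← hd] at h1 h2
    simp only [Matrix.smul_apply, Matrix.sub_apply, matR_mul_apply_self, majSg_self, smul_smul,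
      smul_sub, lpFin] at h1 ⊢
    convert h1 using 2
    · ring
    · congr 1
      linear_combination (if b = z then qs M q b else 1) * (if a = z then qs M q a else 1) *
        sg M b * h2
    · congr 1
      linear_combination (if b = z then qs M q b else 1) * (if a = z then qs M q a else 1) *
        sg M b * h2
  rw [Ne, Fin.ext_iff] at hzw
  simp only [Matrix.smul_apply, Matrix.sub_apply, matR_mul_apply, Fin.lt_def, Fin.ext_iff, hd,
    lpFin]
  -- Off the diagonal only rows a and b can be nonzero, these being the second indices of the blocks
  -- involved.
  rcases eq_or_ne (z : ℕ) a with hza | hza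
  · rcases Nat.lt_or_ge a w with haw | haw
    · rcases Nat.lt_trichotomy (w : ℕ) b with hwb | hwb | hwb
      · have h1 := congrArg (fun t => (sg M b * (q - q⁻¹)) • t) (h.lp_recursion hq hq' hwb)
        simp (disch := omega) only [hza, if_neg, if_true, if_pos, majSg_succ_of_le,
          majSg_self, zero_smul, mul_zero, add_zero, zero_add, one_mul] at h1 ⊢
        linear_combination (norm := module) h1
      · have h1 := h.lp_diag_mul hq b (b + 1) b
        simp (disch := omega) only [hza, hwb, if_neg, if_true, if_pos, majSg_succ_of_le,
          majSg_self, zero_smul, mul_zero, add_zero, zero_add, one_mul, rootWt, mul_one, h1]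
        match_scalars
        linear_combination (-(sg M b ^ 2 * (q - q⁻¹) * qs M q b)) * hb -
          (q - q⁻¹) * sg M b ^ 2 * mul_inv_cancel₀ h0 -
          (q - q⁻¹) ^ 2 * sg M b * qs M q b * hs
      · rcases Nat.lt_or_eq_of_le (show (b : ℕ) + 1 ≤ w from hwb) with hwb' | hwb'
        · simp (disch := omega) only [hza, if_neg, if_true, if_pos, lp_of_lt, mul_zero,
            zero_mul, smul_zero, add_zero, sub_zero]
        · simp (disch := omega) only [hza, ← hwb', if_neg, if_true, if_pos, lp_of_lt,
            mul_zero, zero_mul, smul_zero, add_zero, zero_add, sub_zero, majSg_self, one_mul]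
          module
    · simp (disch := omega) only [hza, if_neg, if_true, mul_zero, zero_mul, zero_smul,
        smul_zero, add_zero, sub_zero]
  · rcases eq_or_ne (z : ℕ) b with hzb | hzb
    · rcases Nat.lt_or_ge b w with hbw | hbw
      · rcases Nat.lt_or_eq_of_le (show (b : ℕ) + 1 ≤ w from hbw) with hwb' | hwb'
        · simp (disch := omega) only [hzb, if_neg, if_true, if_pos, lp_of_lt, mul_zero,
            zero_mul, smul_zero, add_zero, sub_zero]
        · have h1 := h.lp_diag_mul hq (b + 1) b a
          have h2 : majSg M b a (b + 1) = sg M b := by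
            rw [majSg_comm, majSg_of_le (by omega) (by omega)]
          simp (disch := omega) only [hzb, ← hwb', if_neg, if_true, if_pos, lp_of_lt,
            mul_zero, zero_mul, zero_smul, smul_zero, add_zero, zero_add, rootWt, mul_one, one_mul,
            h1, hm, h2]
          module
      · simp (disch := omega) only [hzb, if_neg, if_true, mul_zero, zero_mul, zero_smul,
          smul_zero, add_zero, sub_zero]
    · simp only [if_neg hzw, if_neg hza, if_neg hzb, add_zero, smul_zero, sub_zero]

theorem matL_recursion (h : QData M n q e f k k') (hq : q ≠ 0) (hq' : q + q⁻¹ ≠ 0)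
    {a b d : Fin n} (hd : (d : ℕ) = b + 1) (hab : a < b) :
    (q - q⁻¹) • (matL M q (lpFin n M q e k) b b * matL M q (lpFin n M q e k) d a) =
      sg M b • (matL M q (lpFin n M q e k) b a * matL M q (lpFin n M q e k) d b) -
      sg M b • (matL M q (lpFin n M q e k) d b * matL M q (lpFin n M q e k) b a) := by
  have hab' : (a : ℕ) < b := hab
  have hb := qs_sub_inv (M := M) (q := q) b
  have h0 := qs_ne_zero (M := M) hq b
  have hs := sg_mul_self (M := M) b
  have hm : majSg M b a b = sg M b := by rw [majSg_rotate, majSg_rotate, majSg_self]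
  ext z w
  rcases eq_or_ne z w with rfl | hzw
  · have h1 := congrArg (fun t => (sg M b * ((if b = z then qs M q b else 1) *
      (if d = z then qs M q d else 1) * majSg M d a z)) • t) (h.lp_recursion hq hq' hab')
    have h2 := majSg_mul_majSg (M := M) (z := z) hab'.le
    rw [← hd] at h1 h2
    simp only [Matrix.smul_apply, Matrix.sub_apply, matL_mul_apply_self, majSg_self, smul_smul,
      smul_sub, lpFin] at h1 ⊢
    convert h1 using 2
    · ring
    · congr 1
      linear_combination (if b = z then qs M q b else 1) * (if d = z then qs M q d else 1) *
        sg M b * h2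
    · congr 1
      linear_combination (if b = z then qs M q b else 1) * (if d = z then qs M q d else 1) *
        sg M b * h2
  rw [Ne, Fin.ext_iff] at hzw
  simp only [Matrix.smul_apply, Matrix.sub_apply, matL_mul_apply, Fin.lt_def, Fin.ext_iff, hd,
    lpFin]
  -- For `matL` it is the columns b and b + 1, the first indices of the blocks, that can be nonzero
  -- off the diagonal.
  rcases eq_or_ne (w : ℕ) (b + 1) with hwd | hwd
  · rcases Nat.lt_trichotomy (z : ℕ) b with hzb | hzb | hzb
    · have h1 := h.lp_diag_mul hq b z a
      simp (disch := omega) only [hwd, if_neg, if_true, if_pos, lp_of_lt, majSg_self, zero_mul,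
        mul_zero, smul_zero, add_zero, zero_add, one_mul, mul_one, rootWt, one_smul, sub_zero] at h1 ⊢
      rw [h1]
      module
    · have h1 := h.lp_diag_mul hq b b a
      have h2 : majSg M b a (b + 1) = sg M b := by
        rw [majSg_comm, majSg_of_le (by omega) (by omega)]
      simp (disch := omega) only [hzb, hwd, if_neg, if_true, if_pos, majSg_self, zero_mul,
        mul_zero, zero_smul, add_zero, zero_add, one_mul, rootWt, h1, h2, hm]
      match_scalars
      linear_combination (-(sg M b ^ 2 * (q - q⁻¹))) * hb +
        (q - q⁻¹) ^ 2 * sg M b * mul_inv_cancel₀ h0 - (q - q⁻¹) ^ 2 * sg M b * hs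
    · simp (disch := omega) only [hwd, if_neg, if_true, mul_zero, zero_mul, zero_smul,
        smul_zero, add_zero, sub_zero]
  · rcases eq_or_ne (w : ℕ) b with hwb | hwb
    · rcases Nat.lt_or_ge z b with hzb | hzb
      · have h1 := h.lp_comm_far hq hq' (w := a) hzb
        have h2 : majSg M (b + 1) b b = sg M b := majSg_succ_of_le le_rfl
        simp (disch := omega) only [hwb, if_neg, if_true, if_pos, lp_of_lt, zero_mul, mul_zero,
          smul_zero, add_zero, zero_add, one_mul, h1, h2, majSg_succ_of_le]
        module
      · simp (disch := omega) only [hwb, if_neg, if_true, mul_zero, zero_mul, zero_smul,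
          smul_zero, add_zero, sub_zero]
    · simp only [if_neg hzw, if_neg hwd, if_neg hwb, add_zero, smul_zero, sub_zero]

end QData

end Closure

section Closure

variable {A : Type*} [Ring A] [Algebra ℂ A] {M n : ℕ} {q : ℂ} {e f k k' : ℕ → A}

theorem relPlus_val_iff {X Y : ℕ → ℕ → A} {x y z w : Fin n} :
    RelPlus Fin.val M q (fun a b => X a b) (fun a b => Y a b) x y z w ↔
      RelPlus id M q X Y x y z w := by
  simp only [RelPlus, Fin.ext_iff, Fin.lt_def, id]

namespace QData

theorem matL_lp_self_apply (x z w : Fin n) :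
    matL M q (lpFin n M q e k) x x z w =
      if z = w then ((if x = w then qs M q x else 1) * (sg M x * sg M x)) • k x else 0 := by
  have h1 : (if w = x then (if z < x then q - q⁻¹ else 0) • lpFin n M q e k z x else 0) = 0 := by
    split_ifs with _ h
    · rw [lpFin, lp_of_lt h, smul_zero]
    · rw [zero_smul]
    · rfl
  rw [matL, h1, add_zero, majSg_self, lpFin, lp_self, smul_smul, mul_assoc]

/-- By triangularity the block at (x, x) is diagonal with entries nonzero multiples of the
invertible k_x, so it can be cancelled on the left. -/
theorem matL_lp_self_injective (h : QData M n q e f k k') (hq : q ≠ 0) (x : Fin n)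
    {P Q : Matrix (Fin n) (Fin n) A}
    (hPQ : matL M q (lpFin n M q e k) x x * P = matL M q (lpFin n M q e k) x x * Q) : P = Q := by
  ext z w
  have h1 := congrFun (congrFun hPQ z) w
  simp only [Matrix.mul_apply, matL_lp_self_apply, sg_mul_self, mul_one, ite_mul, zero_mul,
    Finset.sum_ite_eq, Finset.mem_univ, if_true, smul_mul_assoc] at h1
  have h2 : (if x = z then qs M q x else 1) ≠ 0 := by
    split_ifs
    · exact qs_ne_zero hq _
    · exact one_ne_zero
  have h3 := congrArg (k' x * ·) (smul_right_injective A h2 h1)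
  simpa only [← mul_assoc, h.k'_mul_k, one_mul] using h3

/-- The relation `R⁺ l⁺₁ Y₂ = Y₂ l⁺₁ R⁺` follows from its entries that involve only the diagonal
entries and the entries next to the diagonal of `l⁺`. -/
theorem matL_mul_eq_mul_matR (h : QData M n q e f k k') (hq : q ≠ 0) (hq' : q + q⁻¹ ≠ 0)
    (hq2 : q - q⁻¹ ≠ 0) {Y : Matrix (Fin n) (Fin n) A}
    (hd : ∀ b, matL M q (lpFin n M q e k) b b * Y = Y * matR M q (lpFin n M q e k) b b)
    (hs : ∀ b d : Fin n, (d : ℕ) = b + 1 →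
      matL M q (lpFin n M q e k) d b * Y = Y * matR M q (lpFin n M q e k) d b) (x y : Fin n) :
    matL M q (lpFin n M q e k) x y * Y = Y * matR M q (lpFin n M q e k) x y := by
  rcases lt_trichotomy x y with hxy | rfl | hxy
  · have h1 : matL M q (lpFin n M q e k) x y = 0 := by
      ext z w
      have h1 : (if z < x then q - q⁻¹ else 0) • lpFin n M q e k z y = 0 := by
        split_ifs with h'
        · rw [lpFin, lp_of_lt (h'.trans hxy), smul_zero]
        · rw [zero_smul]
      rw [matL, h1, lpFin, lp_of_lt hxy, smul_zero]
      simp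
    have h2 : matR M q (lpFin n M q e k) x y = 0 := by
      ext z w
      have h1 : (if y < w then q - q⁻¹ else 0) • lpFin n M q e k x w = 0 := by
        split_ifs with h'
        · rw [lpFin, lp_of_lt (hxy.trans h'), smul_zero]
        · rw [zero_smul]
      rw [matR, h1, lpFin, lp_of_lt hxy, smul_zero]
      simp
    rw [h1, h2, zero_mul, mul_zero]
  · exact hd x
  obtain ⟨m, hm⟩ := x
  change (y : ℕ) < m at hxy
  -- Below the diagonal, the induction moves the row index away from the column y; the base case is
  -- the entry next to the diagonal.
  induction m, hxy using Nat.le_induction with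
  | base => exact hs y ⟨y + 1, hm⟩ rfl
  | succ b hyb ih =>
    have ih := ih (by omega)
    set b' : Fin n := ⟨b, by omega⟩ with hb'
    set d' : Fin n := ⟨b + 1, hm⟩ with hd'
    have h1 := hs b' d' rfl
    have hl := h.matL_recursion hq hq' (a := y) (b := b') (d := d') rfl hyb
    have hr := h.matR_recursion hq hq' (a := y) (b := b') (d := d') rfl hyb
    have h2 := hd b'
    -- After multiplication by (q - q⁻¹) times the block at (b, b), the recursions express both
    -- sides through the blocks at (b, y) and (b + 1, b), past which Y can already be moved.
    apply h.matL_lp_self_injective hq b'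
    apply smul_right_injective _ hq2
    change (q - q⁻¹) • _ = (q - q⁻¹) • _
    rw [← mul_assoc, ← mul_assoc, ← smul_mul_assoc, hl, h2, mul_assoc, ← mul_smul_comm (q - q⁻¹) Y, hr]
    simp only [sub_mul, mul_sub, smul_mul_assoc, mul_smul_comm]
    rw [mul_assoc, mul_assoc, h1, ih, ← mul_assoc, ← mul_assoc, h1, ih, mul_assoc, mul_assoc]

theorem relPlus_of_simple (h : QData M n q e f k k') (hq : q ≠ 0) (hq' : q + q⁻¹ ≠ 0)
    (hq2 : q - q⁻¹ ≠ 0) {Y : ℕ → ℕ → A}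
    (hk : ∀ x z w, k x * Y z w = rootWt M q x w z • (Y z w * k x))
    (hs : ∀ i z w, i + 1 < n → RelPlus id M q (lp M q e k) Y (i + 1) i z w) (x y z w : Fin n) :
    RelPlus id M q (lp M q e k) Y x y z w := by
  rw [← relPlus_val_iff]
  refine relPlus_iff.2 (h.matL_mul_eq_mul_matR hq hq' hq2 (fun b => ?_) (fun b d hbd => ?_) x y)
    z w
  · exact relPlus_iff.1 fun z w => relPlus_val_iff.2 (relPlus_diag hq (hk _ _ _))
  · refine relPlus_iff.1 fun z w => relPlus_val_iff.2 ?_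
    rw [hbd]
    exact hs _ _ _ (by omega)

theorem relPlus_lp_lp (h : QData M n q e f k k') (hq : q ≠ 0) (hq' : q + q⁻¹ ≠ 0)
    (hq2 : q - q⁻¹ ≠ 0) (x y z w : Fin n) :
    RelPlus id M q (lp M q e k) (lp M q e k) x y z w :=
  h.relPlus_of_simple hq hq' hq2 (fun _ _ _ => h.k_lp hq _ _ _)
    (fun _ _ _ _ => h.relPlus_lp_lp_simple hq hq' _ _ _) x y z w

theorem relPlus_lp_lm (h : QData M n q e f k k') (hq : q ≠ 0) (hq' : q + q⁻¹ ≠ 0)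
    (hq2 : q - q⁻¹ ≠ 0) (x y z w : Fin n) :
    RelPlus id M q (lp M q e k) (lm M q f k') x y z w :=
  h.relPlus_of_simple hq hq' hq2 (fun _ _ _ => h.k_lm hq _ _ _)
    (fun _ _ _ hi => h.relPlus_lp_lm_simple hq hq2 hi _ _) x y z w

end QData

end Closure

/-! ### The relations with R⁻, by the symmetry of the opposite algebra -/

section Minus

variable {A : Type*} [Ring A] [Algebra ℂ A] {M n : ℕ} {q : ℂ} {e f k k' : ℕ → A}

/-- The entry `(x, y), (z, w)` of the relation `R⁻ X₁ Y₂ = Y₂ X₁ R⁻`, where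
`R⁻ = q^{-∑ (-1)^{[a]} e^a_a ⊗ e^a_a} - (q - q⁻¹) ∑_{a<b} (-1)^{[b]} e^a_b ⊗ e^b_a`, for even
matrices `∑ (-1)^{[a][b]} e^a_b ⊗ X a b` and `∑ (-1)^{[a][b]} e^a_b ⊗ Y a b`. -/
def RelMinus {I : Type*} [LinearOrder I] (ν : I → ℕ) (M : ℕ) (q : ℂ) (X Y : I → I → A)
    (x y z w : I) : Prop :=
  ((if x = z then (qs M q (ν x))⁻¹ else 1) * majSg M (ν x) (ν y) (ν z)) • (X x y * Y z w) -
      (if x < z then q - q⁻¹ else 0) • (X z y * Y x w) =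
    ((if y = w then (qs M q (ν y))⁻¹ else 1) * majSg M (ν x) (ν y) (ν w)) • (Y z w * X x y) -
      (if w < y then q - q⁻¹ else 0) • (Y z y * X x w)

/-- Transposing both matrices, reversing products and inverting q turns R⁺ into R⁻. The sign
(-1)^{[a] + [b]} attached to the transposed entry (a, b) gives the same total factor in all four
terms, so it cancels. -/
theorem RelPlus.relMinus {X Y : ℕ → ℕ → A} {X' Y' : ℕ → ℕ → Aᵐᵒᵖ}
    (hX : ∀ a b, X' b a = (sg M a * sg M b) • op (X a b))
    (hY : ∀ a b, Y' b a = (sg M a * sg M b) • op (Y a b)) {x y z w : ℕ}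
    (h : RelPlus id M q⁻¹ X' Y' y x w z) : RelMinus id M q X Y x y z w := by
  have h0 : sg M x * sg M y * (sg M z * sg M w) ≠ 0 := by simp [sg_ne_zero]
  have h1 : (if x < z then q⁻¹ - q else 0) = -(if x < z then q - q⁻¹ else 0) := by
    split_ifs <;> simp
  have h2 : (if w < y then q⁻¹ - q else 0) = -(if w < y then q - q⁻¹ else 0) := by
    split_ifs <;> simp
  unfold RelPlus at h
  unfold RelMinus
  simp only [hX, hY, id, qs_inv, inv_inv, h1, h2, smul_mul_smul_comm, ← op_mul, ← op_smul,
    ← op_add, op_inj, majSg_comm y x] at h ⊢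
  apply smul_right_injective A h0
  change _ • _ = _ • _
  linear_combination (norm := module) -h

/-- The l⁺ of the opposite data is the signed transpose of l⁻, and by `lm_op` conversely; these are
the hypotheses of `RelPlus.relMinus`. -/
theorem lp_op (a b : ℕ) :
    lp M q⁻¹ (fun i => op (f i)) (fun i => op (k' i)) b a =
      (sg M a * sg M b) • op (lm M q f k' a b) := by
  have h1 := sg_mul_self (M := M) a
  have h2 := sg_mul_self (M := M) b
  rw [lp, lm, inv_inv, posRoot_op]
  split_ifs with h
  · rw [h, h2, one_smul, op_smul]
  · rw [op_smul, op_mul, smul_smul]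
    congr 1
    linear_combination (q - q⁻¹) * (sg M b * sg M b * h1 + h2)

theorem lm_op (a b : ℕ) :
    lm M q⁻¹ (fun i => op (e i)) (fun i => op (k i)) b a =
      (sg M a * sg M b) • op (lp M q e k a b) := by
  have h2 := sg_mul_self (M := M) b
  rw [lp, lm, inv_inv, negRoot_op]
  by_cases h : a = b
  · rw [if_pos h.symm, if_pos h.symm, h, h2, one_smul, op_smul]
  · rw [if_neg (Ne.symm h), if_neg (Ne.symm h), op_smul, op_mul, smul_smul]
    congr 1
    ring

namespace QData

theorem relMinus_lm_lm (h : QData M n q e f k k') (hq : q ≠ 0) (hq' : q + q⁻¹ ≠ 0)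
    (hq2 : q - q⁻¹ ≠ 0) (x y z w : Fin n) :
    RelMinus id M q (lm M q f k') (lm M q f k') x y z w :=
  RelPlus.relMinus lp_op lp_op ((h.op hq).relPlus_lp_lp (inv_ne_zero hq)
    (by rwa [inv_inv, add_comm]) (by rwa [inv_inv, ← neg_sub, neg_ne_zero]) y x w z)

theorem relMinus_lm_lp (h : QData M n q e f k k') (hq : q ≠ 0) (hq' : q + q⁻¹ ≠ 0)
    (hq2 : q - q⁻¹ ≠ 0) (x y z w : Fin n) :
    RelMinus id M q (lm M q f k') (lp M q e k) x y z w :=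
  RelPlus.relMinus lp_op lm_op ((h.op hq).relPlus_lp_lm (inv_ne_zero hq)
    (by rwa [inv_inv, add_comm]) (by rwa [inv_inv, ← neg_sub, neg_ne_zero]) y x w z)

end QData

end Minus

/-! ### Signs as complex numbers -/

section Signs

/-- The sign `(-1)^i` as a complex number. -/
def csgn (i : ZMod 2) : ℂ := sgn i

theorem csgn_zero : csgn 0 = 1 := by simp [csgn, sgn]

theorem csgn_add (i j : ZMod 2) : csgn (i + j) = csgn i * csgn j := by
  simp [csgn, sgn_add]

theorem csgn_mul_self (i : ZMod 2) : csgn i * csgn i = 1 := by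
  rw [← csgn_add, CharTwo.add_self_eq_zero, csgn_zero]

theorem csgn_ne_zero (i : ZMod 2) : csgn i ≠ 0 := left_ne_zero_of_mul_eq_one (csgn_mul_self i)

theorem sgn_smul_eq {V : Type*} [AddCommGroup V] [Module ℂ V] (i : ZMod 2) (x : V) :
    sgn i • x = csgn i • x := (Int.cast_smul_eq_zsmul ℂ _ _).symm

theorem zmod_two_cases : ∀ i : ZMod 2, i = 0 ∨ i = 1 := by decide

theorem twist_of_mem {A : Type*} [Ring A] [Algebra ℂ A] [Superalgebra A] {x : A} {j : ZMod 2}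
    (hx : x ∈ homPart A j) (i : ZMod 2) : twist i x = csgn (i * j) • x := by
  rcases zmod_two_cases i with rfl | rfl
  · rw [twist_zero, zero_mul, csgn_zero, one_smul]
  · rw [twist_one, mem_homPart.1 hx, one_mul, sgn_smul_eq]

theorem majSg_eq (M x y z : ℕ) :
    majSg M x y z = csgn (par M x * par M y + par M y * par M z + par M z * par M x) := by
  unfold majSg sg csgn
  generalize par M x = x
  generalize par M y = y
  generalize par M z = z
  rcases zmod_two_cases x with rfl | rfl <;> rcases zmod_two_cases y with rfl | rfl <;>
    rcases zmod_two_cases z with rfl | rfl <;>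
    simp [sgn, show (1 : ZMod 2) + 1 = 0 from rfl] <;> norm_num

end Signs

namespace EndTensor

variable {n : ℕ} {p : Fin n → ZMod 2} {A : Type*}

theorem ite_apply (P : Prop) [Decidable P] (X Y : EndTensor p A) (a b : Fin n) :
    (if P then X else Y) a b = if P then X a b else Y a b := by
  split_ifs <;> rfl

variable [Ring A]

theorem sum_apply {I : Type*} (s : Finset I) (f : I → EndTensor p A) (a b : Fin n) :
    (∑ i ∈ s, f i) a b = ∑ i ∈ s, f i a b :=
  map_sum (AddMonoidHom.mk' (fun X : EndTensor p A => X a b) fun _ _ => rfl) f s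

theorem sub_apply (X Y : EndTensor p A) (a b : Fin n) : (X - Y) a b = X a b - Y a b := rfl

variable [Algebra ℂ A] [Superalgebra A]

theorem twist_apply (i : ZMod 2) (X : EndTensor p A) (a b : Fin n) :
    twist i X a b = csgn (i * (p a + p b)) • twist i (X a b) := by
  rcases zmod_two_cases i with rfl | rfl
  · rw [twist_zero, twist_zero, zero_mul, csgn_zero, one_smul]
  · rw [twist_one, twist_one, parity_apply, one_mul, sgn_smul_eq]

theorem apply_mem {X : EndTensor p A} (hX : Superalgebra.parity X = X) (a b : Fin n) :
    X a b ∈ homPart A (p a + p b) := by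
  have h : (Superalgebra.parity X : EndTensor p A) a b = X a b := by rw [hX]
  rw [parity_apply] at h
  rw [mem_homPart]
  conv_rhs => rw [← h]
  rw [smul_smul, sgn_mul_self, one_smul]

end EndTensor

/-! ### Replacing the graded algebra End V ⊗ End V ⊗ A by ordinary matrices -/

section ToMatrix

variable {M N : ℕ} {A : Type*} [Ring A] [Algebra ℂ A]

/-- The matrix of an element of `End V ⊗ End V ⊗ A`, with signs chosen such that even elements
are multiplied like matrices. -/
def toMatrix (X : EndEnd M N A) :
    Matrix (Fin (M + N) × Fin (M + N)) (Fin (M + N) × Fin (M + N)) A :=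
  fun i j => csgn (par M i.1 * par M j.1 + par M j.1 + (par M i.2 * par M j.2 + par M j.2) +
    (par M i.1 + par M j.1) * par M j.2) • X i.1 j.1 i.2 j.2

theorem toMatrix_injective : Function.Injective (toMatrix (M := M) (N := N) (A := A)) := by
  intro X Y h
  ext a b c d
  have h1 := congrFun (congrFun h (a, c)) (b, d)
  exact smul_right_injective A (csgn_ne_zero _) h1

/-- The sign-corrected entries `(-1)^{[a][b]} X a b` of `X = ∑ e^a_b ⊗ X a b`. -/
def hat (X : EndTensor (parV M N) A) (a b : Fin (M + N)) : A := csgn (par M a * par M b) • X a b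

theorem toMatrix_inFirst (X : EndTensor (parV M N) A) (a b c d : Fin (M + N)) :
    toMatrix (EndTensor.inFirst X) (a, c) (b, d) =
      if c = d then csgn (par M b + (par M a + par M b) * par M c) • hat X a b else 0 := by
  simp only [toMatrix, EndTensor.inFirst, EndTensor.oneTensor, EndTensor.mk_apply, hat]
  split_ifs with h
  · subst h
    rw [smul_smul, ← csgn_add]
    congr 2
    generalize par M a = a
    generalize par M b = b
    generalize par M c = c
    revert a b c
    decide
  · rw [smul_zero]

variable [Superalgebra A]

theorem toMatrix_add (X Y : EndEnd M N A) : toMatrix (X + Y) = toMatrix X + toMatrix Y := by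
  ext i j; exact smul_add _ _ _

theorem toMatrix_sub (X Y : EndEnd M N A) : toMatrix (X - Y) = toMatrix X - toMatrix Y := by
  ext i j; exact smul_sub _ _ _

theorem coef_mem {X : EndEnd M N A} (hX : Superalgebra.parity X = X) (a b c d : Fin (M + N)) :
    X a b c d ∈ homPart A (par M a + par M b + (par M c + par M d)) := by
  have h : (Superalgebra.parity X : EndEnd M N A) a b c d = X a b c d := by rw [hX]
  rw [EndTensor.parity_apply, EndTensor.smul_apply, EndTensor.parity_apply, smul_smul, ← sgn_add] at h
  rw [mem_homPart]
  conv_rhs => rw [← h]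
  rw [smul_smul]
  exact (by rw [show par M a = parV M N a from rfl, show par M b = parV M N b from rfl,
    show par M c = parV M N c from rfl, show par M d = parV M N d from rfl,
    sgn_mul_self, one_smul])

/-- Evenness of X makes the parity of each coefficient a function of its indices, so the twists in
the graded product become explicit signs. The sign in `toMatrix` is chosen so that they cancel, an
identity in six elements of ℤ/2 checked by exhaustion. -/
theorem toMatrix_mul {X : EndEnd M N A} (hX : Superalgebra.parity X = X) (Y : EndEnd M N A) :
    toMatrix (X * Y) = toMatrix X * toMatrix Y := by
  ext ⟨a, c⟩ ⟨b, d⟩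
  rw [Matrix.mul_apply, Fintype.sum_prod_type]
  simp only [toMatrix, EndTensor.mul_apply, EndTensor.sum_apply, Finset.smul_sum]
  refine Finset.sum_congr rfl fun m _ => Finset.sum_congr rfl fun l _ => ?_
  rw [EndTensor.twist_apply, map_smul, twist_twist, twist_of_mem (coef_mem hX a m c l)]
  simp only [smul_mul_assoc, mul_smul_comm, smul_smul, ← csgn_add]
  congr 2
  simp only [parV]
  generalize par M a = a
  generalize par M b = b
  generalize par M c = c
  generalize par M d = d
  generalize par M m = m
  generalize par M l = l
  revert a b c d m l
  decide

theorem toMatrix_inSecond (X : EndTensor (parV M N) A) (a b c d : Fin (M + N)) :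
    toMatrix (EndTensor.inSecond X) (a, c) (b, d) = if a = b then csgn (par M d) • hat X c d else 0 := by
  simp only [toMatrix, EndTensor.inSecond, EndTensor.oneTensor, EndTensor.mk_apply, hat, EndTensor.ite_apply]
  split_ifs with h
  · subst h
    rw [smul_smul, ← csgn_add]
    congr 2
    generalize par M a = a
    generalize par M d = b
    generalize par M c = c
    revert a b c
    decide
  · rw [EndTensor.zero_apply, smul_zero]

theorem units_apply (a b c d a' b' c' d' : Fin (M + N)) :
    units M N A a b c d a' b' c' d' = if a' = a ∧ b' = b ∧ c' = c ∧ d' = d then 1 else 0 := by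
  simp only [units, EndTensor.unitTensor, EndTensor.mk_apply, EndTensor.ite_apply, EndTensor.zero_apply]
  split_ifs <;> tauto

theorem powDiag_apply (z : ℂ) (a b c d : Fin (M + N)) :
    powDiag M N A z a b c d =
      if a = b ∧ c = d then (if a = c then qs M z a else 1) • 1 else 0 := by
  simp only [powDiag, EndTensor.sum_apply, EndTensor.smul_apply, units_apply]
  rw [Finset.sum_eq_single a, Finset.sum_eq_single c]
  · simp only [true_and, eq_comm (a := b), eq_comm (a := d)]
    split_ifs <;> simp_all [qs, parV]
  · intro x _ hx
    rw [if_neg (show ¬ (a = a ∧ b = a ∧ c = x ∧ d = x) by tauto), smul_zero]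
  · simp
  · intro x _ hx
    refine Finset.sum_eq_zero fun y _ => ?_
    rw [if_neg (show ¬ (a = x ∧ b = x ∧ c = y ∧ d = y) by tauto), smul_zero]
  · simp

variable (M N A) in
/-- The matrix `R⁺` in `R(x) = R⁺ - x⁻¹ R⁻`. -/
def rPlus (q : ℂ) : EndEnd M N A :=
  powDiag M N A q + (q - q⁻¹) • ∑ a, ∑ b,
    if b < a then sgn (parV M N b) • units M N A a b b a else 0

variable (M N A) in
/-- The matrix `R⁻` in `R(x) = R⁺ - x⁻¹ R⁻`. -/
def rMinus (q : ℂ) : EndEnd M N A :=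
  powDiag M N A q⁻¹ - (q - q⁻¹) • ∑ a, ∑ b,
    if a < b then sgn (parV M N b) • units M N A a b b a else 0

theorem sum_units_apply (P : Fin (M + N) → Fin (M + N) → Prop) [∀ a b, Decidable (P a b)]
    (a b c d : Fin (M + N)) :
    (∑ x, ∑ y, if P x y then sgn (parV M N y) • units M N A x y y x else 0 : EndEnd M N A) a b c d =
      if a = d ∧ b = c ∧ P a c then csgn (par M c) • 1 else 0 := by
  simp only [EndTensor.sum_apply, EndTensor.ite_apply, EndTensor.smul_apply, units_apply, EndTensor.zero_apply]
  rw [Finset.sum_eq_single a, Finset.sum_eq_single c]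
  · simp only [true_and, eq_comm (a := d), sgn_smul_eq]
    by_cases h : a = d ∧ b = c ∧ P a c
    · obtain ⟨rfl, rfl, h⟩ := h
      simp [h, parV]
    · rw [if_neg h]
      by_cases h1 : P a c
      · rw [if_pos h1, if_neg (by tauto), smul_zero]
      · rw [if_neg h1]
  · intro x _ hx; split_ifs <;> first | rfl | tauto | simp
  · simp
  · intro x _ hx
    refine Finset.sum_eq_zero fun y _ => ?_
    split_ifs <;> first | rfl | tauto | simp
  · simp

theorem toMatrix_powDiag (z : ℂ) (a b c d : Fin (M + N)) :
    toMatrix (powDiag M N A z) (a, c) (b, d) =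
      if a = b ∧ c = d then (if a = c then qs M z a else 1) • 1 else 0 := by
  rw [toMatrix, powDiag_apply]
  dsimp only
  by_cases h : a = b ∧ c = d
  · obtain ⟨rfl, rfl⟩ := h
    rw [if_pos (show a = a ∧ c = c from ⟨rfl, rfl⟩), show csgn _ = 1 from ?_, one_smul]
    rw [← csgn_zero]
    congr 1
    generalize par M a = a
    generalize par M c = c
    revert a c
    decide
  · rw [if_neg h, smul_zero]

theorem toMatrix_sum_units (P : Fin (M + N) → Fin (M + N) → Prop) [∀ a b, Decidable (P a b)]
    (t : ℂ) (a b c d : Fin (M + N)) :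
    toMatrix (t • ∑ x, ∑ y, if P x y then sgn (parV M N y) • units M N A x y y x else 0)
        (a, c) (b, d) =
      if a = d ∧ b = c ∧ P a c then (t * csgn (par M a * par M c)) • 1 else 0 := by
  rw [toMatrix, EndTensor.smul_apply, EndTensor.smul_apply, sum_units_apply]
  dsimp only
  split_ifs with h
  · obtain ⟨rfl, rfl, _⟩ := h
    rw [smul_smul, smul_smul, mul_right_comm, mul_comm, ← csgn_add]
    congr 3
    generalize par M a = a
    generalize par M b = c
    revert a c
    decide
  · rw [smul_zero, smul_zero]

theorem toMatrix_rPlus (q : ℂ) (a b c d : Fin (M + N)) :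
    toMatrix (rPlus M N A q) (a, c) (b, d) =
      (if a = b ∧ c = d then (if a = c then qs M q a else 1) • 1 else 0) +
      if a = d ∧ b = c ∧ c < a then ((q - q⁻¹) * csgn (par M a * par M c)) • 1 else 0 := by
  rw [rPlus, toMatrix_add, Matrix.add_apply, toMatrix_powDiag, toMatrix_sum_units (fun a b => b < a)]

theorem toMatrix_rMinus (q : ℂ) (a b c d : Fin (M + N)) :
    toMatrix (rMinus M N A q) (a, c) (b, d) =
      (if a = b ∧ c = d then (if a = c then (qs M q a)⁻¹ else 1) • 1 else 0) -
      if a = d ∧ b = c ∧ a < c then ((q - q⁻¹) * csgn (par M a * par M c)) • 1 else 0 := by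
  rw [rMinus, toMatrix_sub, Matrix.sub_apply, toMatrix_powDiag, toMatrix_sum_units (fun a b => a < b),
    qs_inv]

end ToMatrix

/-! ### Entries of the relations with R⁺ and R⁻, and the permutation R⁺ - R⁻ -/

section RLLEntries

variable {M N : ℕ} {A : Type*} [Ring A] [Algebra ℂ A] [Superalgebra A]

theorem toMatrix_first_second {X : EndTensor (parV M N) A} (hX : Superalgebra.parity X = X)
    (Y : EndTensor (parV M N) A) (a b c d : Fin (M + N)) :
    toMatrix (EndTensor.inFirst X * EndTensor.inSecond Y) (a, c) (b, d) =
      csgn (par M b + (par M a + par M b) * par M c + par M d) • (hat X a b * hat Y c d) := by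
  rw [toMatrix_mul (by rw [EndTensor.parity_inFirst, hX]), Matrix.mul_apply,
    Fintype.sum_prod_type]
  simp only [toMatrix_inFirst, toMatrix_inSecond, ite_mul, mul_ite, zero_mul, mul_zero]
  simp only [Finset.sum_ite_eq, Finset.sum_ite_eq', Finset.mem_univ, if_true,
    Finset.sum_const_zero, Finset.sum_ite_irrel]
  rw [smul_mul_smul_comm, ← csgn_add]

theorem toMatrix_second_first (X : EndTensor (parV M N) A) {Y : EndTensor (parV M N) A}
    (hY : Superalgebra.parity Y = Y) (a b c d : Fin (M + N)) :
    toMatrix (EndTensor.inSecond Y * EndTensor.inFirst X) (a, c) (b, d) =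
      csgn (par M b + (par M a + par M b) * par M d + par M d) • (hat Y c d * hat X a b) := by
  rw [toMatrix_mul (by rw [EndTensor.parity_inSecond, hY]), Matrix.mul_apply,
    Fintype.sum_prod_type]
  simp only [toMatrix_inFirst, toMatrix_inSecond, ite_mul, mul_ite, zero_mul, mul_zero]
  simp only [Finset.sum_ite_eq, Finset.sum_ite_eq', Finset.mem_univ, if_true]
  rw [smul_mul_smul_comm, ← csgn_add]
  congr 2
  abel

theorem parity_rPlus (q : ℂ) : Superalgebra.parity (rPlus M N A q) = rPlus M N A q := by
  simp only [rPlus, map_add, map_smul, map_sum, parity_powDiag, apply_ite,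
    map_zsmul, parity_units_swap, map_zero]

theorem parity_rMinus (q : ℂ) : Superalgebra.parity (rMinus M N A q) = rMinus M N A q := by
  simp only [rMinus, map_sub, map_smul, map_sum, parity_powDiag, apply_ite,
    map_zsmul, parity_units_swap, map_zero]

theorem toMatrix_rPlus_mul (q : ℂ) (Z : EndEnd M N A) (a b c d : Fin (M + N)) :
    toMatrix (rPlus M N A q * Z) (a, c) (b, d) =
      (if a = c then qs M q a else 1) • toMatrix Z (a, c) (b, d) +
      (if c < a then q - q⁻¹ else 0) • csgn (par M a * par M c) • toMatrix Z (c, a) (b, d) := by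
  rw [toMatrix_mul (parity_rPlus q), Matrix.mul_apply, Fintype.sum_prod_type]
  simp only [toMatrix_rPlus, add_mul, Finset.sum_add_distrib, ite_mul, zero_mul, ite_and,
    Finset.sum_ite_eq, Finset.sum_ite_eq', Finset.mem_univ, if_true, Finset.sum_const_zero,
    Finset.sum_ite_irrel, smul_mul_assoc, one_mul]
  simp only [ite_smul, zero_smul, mul_smul]

theorem toMatrix_mul_rPlus (q : ℂ) {Z : EndEnd M N A} (hZ : Superalgebra.parity Z = Z)
    (a b c d : Fin (M + N)) : toMatrix (Z * rPlus M N A q) (a, c) (b, d) =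
      (if b = d then qs M q b else 1) • toMatrix Z (a, c) (b, d) +
      (if b < d then q - q⁻¹ else 0) • csgn (par M b * par M d) • toMatrix Z (a, c) (d, b) := by
  rw [toMatrix_mul hZ, Matrix.mul_apply, Fintype.sum_prod_type]
  simp only [toMatrix_rPlus, mul_add, Finset.sum_add_distrib, mul_ite, mul_zero, ite_and,
    Finset.sum_ite_eq, Finset.sum_ite_eq', Finset.mem_univ, if_true, Finset.sum_const_zero,
    Finset.sum_ite_irrel, mul_smul_comm, mul_one]
  simp only [ite_smul, zero_smul, mul_smul, mul_comm (par M d)]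

theorem toMatrix_rMinus_mul (q : ℂ) (Z : EndEnd M N A) (a b c d : Fin (M + N)) :
    toMatrix (rMinus M N A q * Z) (a, c) (b, d) =
      (if a = c then (qs M q a)⁻¹ else 1) • toMatrix Z (a, c) (b, d) -
      (if a < c then q - q⁻¹ else 0) • csgn (par M a * par M c) • toMatrix Z (c, a) (b, d) := by
  rw [toMatrix_mul (parity_rMinus q), Matrix.mul_apply, Fintype.sum_prod_type]
  simp only [toMatrix_rMinus, sub_mul, Finset.sum_sub_distrib, ite_mul, zero_mul, ite_and,
    Finset.sum_ite_eq, Finset.sum_ite_eq', Finset.mem_univ, if_true, Finset.sum_const_zero,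
    Finset.sum_ite_irrel, smul_mul_assoc, one_mul]
  simp only [ite_smul, zero_smul, ← sub_mul, mul_smul]

theorem toMatrix_mul_rMinus (q : ℂ) {Z : EndEnd M N A} (hZ : Superalgebra.parity Z = Z)
    (a b c d : Fin (M + N)) : toMatrix (Z * rMinus M N A q) (a, c) (b, d) =
      (if b = d then (qs M q b)⁻¹ else 1) • toMatrix Z (a, c) (b, d) -
      (if d < b then q - q⁻¹ else 0) • csgn (par M b * par M d) • toMatrix Z (a, c) (d, b) := by
  rw [toMatrix_mul hZ, Matrix.mul_apply, Fintype.sum_prod_type]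
  simp only [toMatrix_rMinus, mul_sub, Finset.sum_sub_distrib, mul_ite, mul_zero, ite_and,
    Finset.sum_ite_eq, Finset.sum_ite_eq', Finset.mem_univ, if_true, Finset.sum_const_zero,
    Finset.sum_ite_irrel, mul_smul_comm, mul_one]
  simp only [ite_smul, zero_smul, mul_smul, mul_comm (par M d)]

variable {q : ℂ} {X Y : EndTensor (parV M N) A}

theorem second_first_even (hX : Superalgebra.parity X = X) (hY : Superalgebra.parity Y = Y) :
    Superalgebra.parity (EndTensor.inSecond Y * EndTensor.inFirst X) =
      EndTensor.inSecond Y * EndTensor.inFirst X := by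
  rw [map_mul, EndTensor.parity_inFirst, EndTensor.parity_inSecond, hX, hY]

/-- After the common sign (-1)^{[b] + [d] + [a][b]} is removed, the direct terms keep precisely the
signs `majSg` of `RelPlus` and `RelMinus`, and the exchange terms keep none. -/
theorem csgn_smul_signs (a b c d : Fin (M + N)) :
    csgn (par M b + (par M a + par M b) * par M c + par M d) =
      csgn (par M b + par M d + par M a * par M b) * majSg M a b c ∧
    csgn (par M b + (par M a + par M b) * par M d + par M d) =
      csgn (par M b + par M d + par M a * par M b) * majSg M a b d ∧
    csgn (par M a * par M c) * csgn (par M b + (par M c + par M b) * par M a + par M d) =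
      csgn (par M b + par M d + par M a * par M b) ∧
    csgn (par M b * par M d) * csgn (par M d + (par M a + par M d) * par M b + par M b) =
      csgn (par M b + par M d + par M a * par M b) := by
  simp only [majSg_eq, ← csgn_add]
  refine ⟨?_, ?_, ?_, ?_⟩ <;> congr 1 <;>
  · generalize par M a = a
    generalize par M b = b
    generalize par M c = c
    generalize par M d = d
    revert a b c d
    decide

theorem rPlus_mul_eq (hX : Superalgebra.parity X = X) (hY : Superalgebra.parity Y = Y)
    (h : ∀ a b c d, RelPlus Fin.val M q (hat X) (hat Y) a b c d) :
    rPlus M N A q * (EndTensor.inFirst X * EndTensor.inSecond Y) =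
      EndTensor.inSecond Y * EndTensor.inFirst X * rPlus M N A q := by
  apply toMatrix_injective
  ext ⟨a, c⟩ ⟨b, d⟩
  have h1 := congrArg (csgn (par M b + par M d + par M a * par M b) • ·) (h a b c d)
  obtain ⟨s1, s2, s3, s4⟩ := csgn_smul_signs a b c d
  rw [toMatrix_rPlus_mul, toMatrix_mul_rPlus _ (second_first_even hX hY),
    toMatrix_first_second hX, toMatrix_first_second hX, toMatrix_second_first _ hY,
    toMatrix_second_first _ hY, smul_smul (csgn _) (csgn _), smul_smul (csgn _) (csgn _),
    s1, s2, s3, s4]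
  linear_combination (norm := module) h1

theorem rMinus_mul_eq (hX : Superalgebra.parity X = X) (hY : Superalgebra.parity Y = Y)
    (h : ∀ a b c d, RelMinus Fin.val M q (hat X) (hat Y) a b c d) :
    rMinus M N A q * (EndTensor.inFirst X * EndTensor.inSecond Y) =
      EndTensor.inSecond Y * EndTensor.inFirst X * rMinus M N A q := by
  apply toMatrix_injective
  ext ⟨a, c⟩ ⟨b, d⟩
  have h1 := congrArg (csgn (par M b + par M d + par M a * par M b) • ·) (h a b c d)
  obtain ⟨s1, s2, s3, s4⟩ := csgn_smul_signs a b c d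
  rw [toMatrix_rMinus_mul, toMatrix_mul_rMinus _ (second_first_even hX hY),
    toMatrix_first_second hX, toMatrix_first_second hX, toMatrix_second_first _ hY,
    toMatrix_second_first _ hY, smul_smul (csgn _) (csgn _), smul_smul (csgn _) (csgn _),
    s1, s2, s3, s4]
  linear_combination (norm := module) h1

theorem qs_sub_qs_inv_eq (q : ℂ) (a : ℕ) :
    qs M q a - (qs M q a)⁻¹ = (q - q⁻¹) * csgn (par M a * par M a) := by
  rw [qs_sub_inv, mul_comm, sg]
  congr 1
  generalize par M a = a
  rcases zmod_two_cases a with rfl | rfl <;> simp [csgn]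

/-- The diagonal difference q_a - q_a⁻¹ = (-1)^{[a]} (q - q⁻¹) fits the off-diagonal terms, so R⁺ -
R⁻ is (q - q⁻¹) times the graded permutation; multiplying by it swaps the two row indices. -/
theorem toMatrix_sub_mul (Z : EndEnd M N A) (a b c d : Fin (M + N)) :
    toMatrix ((rPlus M N A q - rMinus M N A q) * Z) (a, c) (b, d) =
      ((q - q⁻¹) * csgn (par M a * par M c)) • toMatrix Z (c, a) (b, d) := by
  rw [sub_mul, toMatrix_sub, Matrix.sub_apply, toMatrix_rPlus_mul, toMatrix_rMinus_mul]
  rcases lt_trichotomy a c with h | rfl | h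
  · rw [if_neg h.ne, if_neg h.ne, if_pos h, if_neg h.not_gt]
    module
  · rw [if_pos rfl, if_pos rfl, if_neg (lt_irrefl _), ← qs_sub_qs_inv_eq]
    module
  · rw [if_neg h.ne', if_neg h.ne', if_pos h, if_neg h.not_gt]
    module

theorem toMatrix_mul_sub {Z : EndEnd M N A} (hZ : Superalgebra.parity Z = Z)
    (a b c d : Fin (M + N)) :
    toMatrix (Z * (rPlus M N A q - rMinus M N A q)) (a, c) (b, d) =
      ((q - q⁻¹) * csgn (par M b * par M d)) • toMatrix Z (a, c) (d, b) := by
  rw [mul_sub, toMatrix_sub, Matrix.sub_apply, toMatrix_mul_rPlus _ hZ, toMatrix_mul_rMinus _ hZ]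
  rcases lt_trichotomy b d with h | rfl | h
  · rw [if_neg h.ne, if_neg h.ne, if_pos h, if_neg h.not_gt]
    module
  · rw [if_pos rfl, if_pos rfl, if_neg (lt_irrefl _), ← qs_sub_qs_inv_eq]
    module
  · rw [if_neg h.ne', if_neg h.ne', if_pos h, if_neg h.not_gt]
    module

/-- The graded permutation carries an even element acting in the first tensor factor to the same
element acting in the second. -/
theorem sub_mul_inFirst (hX : Superalgebra.parity X = X) :
    (rPlus M N A q - rMinus M N A q) * EndTensor.inFirst X =
      EndTensor.inSecond X * (rPlus M N A q - rMinus M N A q) := by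
  apply toMatrix_injective
  ext ⟨a, c⟩ ⟨b, d⟩
  rw [toMatrix_sub_mul, toMatrix_mul_sub (by rw [EndTensor.parity_inSecond, hX]), toMatrix_inFirst,
    toMatrix_inSecond]
  split_ifs with h
  · subst h
    rw [smul_smul, smul_smul, mul_assoc, mul_assoc, ← csgn_add, ← csgn_add]
    congr 3
    generalize par M a = a
    generalize par M b = b
    generalize par M c = c
    revert a b c
    decide
  · rw [smul_zero, smul_zero]

theorem sub_mul_inSecond (hX : Superalgebra.parity X = X) :
    (rPlus M N A q - rMinus M N A q) * EndTensor.inSecond X =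
      EndTensor.inFirst X * (rPlus M N A q - rMinus M N A q) := by
  apply toMatrix_injective
  ext ⟨a, c⟩ ⟨b, d⟩
  rw [toMatrix_sub_mul, toMatrix_mul_sub (by rw [EndTensor.parity_inFirst, hX]), toMatrix_inFirst,
    toMatrix_inSecond]
  split_ifs with h
  · subst h
    rw [smul_smul, smul_smul, mul_assoc, mul_assoc, ← csgn_add, ← csgn_add]
    congr 3
    generalize par M a = a
    generalize par M d = b
    generalize par M c = c
    revert a b c
    decide
  · rw [smul_zero, smul_zero]

end RLLEntries

/-! ### Assembling the parameter-dependent relation from the constant ones -/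

section Central

/-- The relation `R L₁ L₂ = L₂ L₁ R` for `R = R⁺ - u R⁻`, `L₁ = a₁ - u v b₁`, `L₂ = a₂ - v b₂`, with
`u` and `v` central. -/
theorem rll_of_central {B : Type*} [Ring B] (u v : Subring.center B) {rp rm a₁ b₁ a₂ b₂ : B}
    (haa : rp * (a₁ * a₂) = a₂ * a₁ * rp) (hab : rp * (a₁ * b₂) = b₂ * a₁ * rp)
    (hba : rm * (b₁ * a₂) = a₂ * b₁ * rm) (hbb : rm * (b₁ * b₂) = b₂ * b₁ * rm)
    (ha₁ : (rp - rm) * a₁ = a₂ * (rp - rm)) (ha₂ : (rp - rm) * a₂ = a₁ * (rp - rm))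
    (hb₁ : (rp - rm) * b₁ = b₂ * (rp - rm)) (hb₂ : (rp - rm) * b₂ = b₁ * (rp - rm)) :
    (rp - u * rm) * (a₁ - u * v * b₁) * (a₂ - v * b₂) =
      (a₂ - v * b₂) * (a₁ - u * v * b₁) * (rp - u * rm) := by
  -- With P = rp - rm exchanging the indices 1 and 2, the given relations with rp or rm yield the
  -- ones with the other matrix.
  have h1 : (rp - rm) * (a₁ * a₂) = a₂ * a₁ * (rp - rm) := by
    rw [← mul_assoc, ha₁, mul_assoc, ha₂, mul_assoc]
  have h2 : (rp - rm) * (b₁ * b₂) = b₂ * b₁ * (rp - rm) := by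
    rw [← mul_assoc, hb₁, mul_assoc, hb₂, mul_assoc]
  have h3 : (rp - rm) * (a₁ * b₂) = a₂ * b₁ * (rp - rm) := by
    rw [← mul_assoc, ha₁, mul_assoc, hb₂, mul_assoc]
  have h4 : (rp - rm) * (b₁ * a₂) = b₂ * a₁ * (rp - rm) := by
    rw [← mul_assoc, hb₁, mul_assoc, ha₂, mul_assoc]
  -- B is a module over its centre, so the claim becomes a linear identity between noncommutative
  -- monomials with commutative coefficients u, v.
  have hu : ∀ x : B, (u : B) * x = u • x := fun _ => rfl
  have hv : ∀ x : B, (v : B) * x = v • x := fun _ => rfl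
  simp only [sub_mul, mul_sub, mul_assoc] at *
  simp only [hu, hv, mul_smul_comm]
  -- The delicate coefficient is that of uv: rm a₁b₂ - rp b₁a₂ equals rp a₁b₂ - rm b₁a₂ - P a₁b₂ - P
  -- b₁a₂. Moving P to the right interchanges its last two terms (`h3`, `h4`), so only their sum
  -- matches the other side.
  linear_combination (norm := module) haa - v • hab + (u * u * v) • hba - (u * u * v * v) • hbb +
    u • h1 - u • haa + (u * v * v) • (hbb + h2) + (u * v) • (hab - h3 - hba - h4)

end Central

/-! ### Power series in x⁻¹ and y⁻¹: clearing and cancelling denominators -/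

section Series

variable {E : Type*} [Ring E]

theorem isUnit_one_sub_X_mul_X :
    IsUnit (1 - MvPowerSeries.X 0 * MvPowerSeries.X 1 : MvPowerSeries (Fin 2) E) := by
  rw [MvPowerSeries.isUnit_iff_constantCoeff]
  simp

theorem isUnit_one_sub_X : IsUnit (1 - MvPowerSeries.X 1 : MvPowerSeries (Fin 2) E) := by
  rw [MvPowerSeries.isUnit_iff_constantCoeff]
  simp

variable {M N : ℕ} {A : Type*} [Ring A] [Algebra ℂ A] [Superalgebra A]

theorem X_mul_X_eq : (MvPowerSeries.X 0 * MvPowerSeries.X 1 : MvPowerSeries (Fin 2) E) =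
    MvPowerSeries.monomial (Finsupp.single 0 1 + Finsupp.single 1 1) 1 := by
  rw [MvPowerSeries.X, MvPowerSeries.X, MvPowerSeries.monomial_mul_monomial, one_mul]

theorem single_add_single_le (n : Fin 2 →₀ ℕ) :
    (Finsupp.single 0 1 + Finsupp.single 1 1 ≤ n) ↔ 1 ≤ n 0 ∧ 1 ≤ n 1 := by
  rw [Finsupp.le_def, Fin.forall_fin_two]
  simp

theorem single_one_le (n : Fin 2 →₀ ℕ) : (Finsupp.single 1 1 ≤ n) ↔ 1 ≤ n 1 := by
  rw [Finsupp.le_def, Fin.forall_fin_two]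
  simp

theorem eq_zero_iff_fin_two (n : Fin 2 →₀ ℕ) : n = 0 ↔ n 0 = 0 ∧ n 1 = 0 := by
  rw [Finsupp.ext_iff, Fin.forall_fin_two]
  rfl

theorem eq_single_add_single_iff (n : Fin 2 →₀ ℕ) :
    n = Finsupp.single 0 1 + Finsupp.single 1 1 ↔ n 0 = 1 ∧ n 1 = 1 := by
  rw [Finsupp.ext_iff, Fin.forall_fin_two]
  simp

theorem eq_single_one_iff (n : Fin 2 →₀ ℕ) :
    n = Finsupp.single 1 1 ↔ n 0 = 0 ∧ n 1 = 1 := by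
  rw [Finsupp.ext_iff, Fin.forall_fin_two]
  simp

theorem inFirst_sub (X Y : EndTensor (parV M N) A) :
    EndTensor.inFirst (X - Y) = EndTensor.inFirst X - EndTensor.inFirst Y := by
  ext a b c d
  simp only [EndTensor.inFirst, EndTensor.oneTensor, EndTensor.mk_apply, EndTensor.sub_apply]
  split_ifs <;> simp

theorem inSecond_sub (X Y : EndTensor (parV M N) A) :
    EndTensor.inSecond (X - Y) = EndTensor.inSecond X - EndTensor.inSecond Y := by
  ext a b c d
  simp only [EndTensor.inSecond, EndTensor.oneTensor, EndTensor.mk_apply, EndTensor.sub_apply]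
  split_ifs <;> simp [EndTensor.sub_apply]

variable {L : PowerSeries (EndTensor (parV M N) A)} {X Y : EndTensor (parV M N) A}

theorem coeff_firstXY (n : Fin 2 →₀ ℕ) : MvPowerSeries.coeff n (firstXY L) =
    if n 0 = n 1 then EndTensor.inFirst (PowerSeries.coeff (n 0) L) else 0 := rfl

theorem coeff_secondY (n : Fin 2 →₀ ℕ) : MvPowerSeries.coeff n (secondY L) =
    if n 0 = 0 then EndTensor.inSecond (PowerSeries.coeff (n 1) L) else 0 := rfl

/-- The hypotheses describe X + (X - Y)(t + t² + ⋯) = (X - tY)/(1 - t), evaluated here at t = x⁻¹y⁻¹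
and in `secondY_mul` at t = y⁻¹. -/
theorem firstXY_mul (h0 : PowerSeries.coeff 0 L = X)
    (h1 : ∀ k, PowerSeries.coeff (k + 1) L = X - Y) :
    firstXY L * (1 - MvPowerSeries.X 0 * MvPowerSeries.X 1) =
      MvPowerSeries.C (EndTensor.inFirst X) -
        MvPowerSeries.X 0 * MvPowerSeries.X 1 * MvPowerSeries.C (EndTensor.inFirst Y) := by
  ext n : 1
  rw [X_mul_X_eq, mul_sub, mul_one, map_sub, map_sub, MvPowerSeries.coeff_mul_monomial,
    MvPowerSeries.coeff_C, MvPowerSeries.coeff_mul_C, MvPowerSeries.coeff_monomial, coeff_firstXY,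
    coeff_firstXY]
  simp only [single_add_single_le, eq_zero_iff_fin_two, eq_single_add_single_iff]
  rw [show (n - (Finsupp.single 0 1 + Finsupp.single 1 1) : Fin 2 →₀ ℕ) 0 = n 0 - 1 by simp,
    show (n - (Finsupp.single 0 1 + Finsupp.single 1 1) : Fin 2 →₀ ℕ) 1 = n 1 - 1 by simp]
  generalize n 0 = s
  generalize n 1 = t
  rcases s with _ | _ | s <;> rcases t with _ | _ | t <;> simp [h0, h1, inFirst_sub]

theorem secondY_mul (h0 : PowerSeries.coeff 0 L = X)
    (h1 : ∀ k, PowerSeries.coeff (k + 1) L = X - Y) :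
    secondY L * (1 - MvPowerSeries.X 1) =
      MvPowerSeries.C (EndTensor.inSecond X) -
        MvPowerSeries.X 1 * MvPowerSeries.C (EndTensor.inSecond Y) := by
  ext n : 1
  rw [MvPowerSeries.X, mul_sub, mul_one, map_sub, map_sub, MvPowerSeries.coeff_mul_monomial,
    MvPowerSeries.coeff_C, MvPowerSeries.coeff_mul_C, MvPowerSeries.coeff_monomial, coeff_secondY,
    coeff_secondY]
  simp only [single_one_le, eq_zero_iff_fin_two, eq_single_one_iff]
  rw [show (n - Finsupp.single 1 1 : Fin 2 →₀ ℕ) 0 = n 0 by simp,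
    show (n - Finsupp.single 1 1 : Fin 2 →₀ ℕ) 1 = n 1 - 1 by simp]
  generalize n 0 = s
  generalize n 1 = t
  rcases s with _ | s <;> rcases t with _ | _ | t <;> simp [h0, h1, inSecond_sub]

theorem rMatrix_eq (q : ℂ) : rMatrix M N A q =
    MvPowerSeries.C (rPlus M N A q) - MvPowerSeries.X 0 * MvPowerSeries.C (rMinus M N A q) := by
  rw [rMatrix, rPlus, rMinus, map_add, map_sub, mul_sub]
  abel

variable {q : ℂ}

/-- With X = l⁺ and Y = l⁻ this reduces the relation for `l(x)` to four constant ones. Evenness is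
needed to pass to matrices. -/
theorem rllLeft_eq_rllRight (hX : Superalgebra.parity X = X) (hY : Superalgebra.parity Y = Y)
    (h0 : PowerSeries.coeff 0 L = X) (h1 : ∀ k, PowerSeries.coeff (k + 1) L = X - Y)
    (hXX : ∀ a b c d, RelPlus Fin.val M q (hat X) (hat X) a b c d)
    (hXY : ∀ a b c d, RelPlus Fin.val M q (hat X) (hat Y) a b c d)
    (hYX : ∀ a b c d, RelMinus Fin.val M q (hat Y) (hat X) a b c d)
    (hYY : ∀ a b c d, RelMinus Fin.val M q (hat Y) (hat Y) a b c d) :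
    rllLeft q L = rllRight q L := by
  let u : Subring.center (MvPowerSeries (Fin 2) (EndEnd M N A)) :=
    ⟨MvPowerSeries.X 0, Subring.mem_center_iff.2 fun φ => (φ.commute_X 0).eq⟩
  let v : Subring.center (MvPowerSeries (Fin 2) (EndEnd M N A)) :=
    ⟨MvPowerSeries.X 1, Subring.mem_center_iff.2 fun φ => (φ.commute_X 1).eq⟩
  have hg : ∀ φ : MvPowerSeries (Fin 2) (EndEnd M N A),
      φ * (1 - MvPowerSeries.X 0 * MvPowerSeries.X 1) =
        (1 - MvPowerSeries.X 0 * MvPowerSeries.X 1) * φ := fun φ =>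
    ((Commute.one_right φ).sub_right ((φ.commute_X 0).mul_right (φ.commute_X 1))).eq
  have hh : ∀ φ : MvPowerSeries (Fin 2) (EndEnd M N A),
      φ * (1 - MvPowerSeries.X 1) = (1 - MvPowerSeries.X 1) * φ := fun φ =>
    ((Commute.one_right φ).sub_right (φ.commute_X 1)).eq
  have key := rll_of_central u v (rp := MvPowerSeries.C (rPlus M N A q))
    (rm := MvPowerSeries.C (rMinus M N A q)) (a₁ := MvPowerSeries.C (EndTensor.inFirst X))
    (b₁ := MvPowerSeries.C (EndTensor.inFirst Y)) (a₂ := MvPowerSeries.C (EndTensor.inSecond X))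
    (b₂ := MvPowerSeries.C (EndTensor.inSecond Y))
    (by simp only [← map_mul, rPlus_mul_eq hX hX hXX])
    (by simp only [← map_mul, rPlus_mul_eq hX hY hXY])
    (by simp only [← map_mul, rMinus_mul_eq hY hX hYX])
    (by simp only [← map_mul, rMinus_mul_eq hY hY hYY])
    (by simp only [← map_mul, ← map_sub, sub_mul_inFirst hX])
    (by simp only [← map_mul, ← map_sub, sub_mul_inSecond hX])
    (by simp only [← map_mul, ← map_sub, sub_mul_inFirst hY])
    (by simp only [← map_mul, ← map_sub, sub_mul_inSecond hY])
  change (_ - MvPowerSeries.X 0 * _) * (_ - MvPowerSeries.X 0 * MvPowerSeries.X 1 * _) *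
    (_ - MvPowerSeries.X 1 * _) = (_ - MvPowerSeries.X 1 * _) *
    (_ - MvPowerSeries.X 0 * MvPowerSeries.X 1 * _) * (_ - MvPowerSeries.X 0 * _) at key
  rw [← rMatrix_eq, ← firstXY_mul h0 h1, ← secondY_mul h0 h1] at key
  -- Both denominators are units, having constant term 1, and are central since the variables are;
  -- hence they may be multiplied in on the right and moved to the series they belong to.
  apply (isUnit_one_sub_X_mul_X (E := EndEnd M N A)).mul_left_injective
  apply (isUnit_one_sub_X (E := EndEnd M N A)).mul_left_injective
  change rllLeft q L * _ * _ = rllRight q L * _ * _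
  rw [rllLeft, rllRight]
  generalize (1 - MvPowerSeries.X 0 * MvPowerSeries.X 1 : MvPowerSeries (Fin 2) (EndEnd M N A)) = g
    at *
  generalize (1 - MvPowerSeries.X 1 : MvPowerSeries (Fin 2) (EndEnd M N A)) = h at *
  calc rMatrix M N A q * firstXY L * secondY L * g * h =
        rMatrix M N A q * (firstXY L * g) * (secondY L * h) := by
        rw [mul_assoc _ (secondY L) g, hg (secondY L)]
        simp only [mul_assoc]
    _ = secondY L * h * (firstXY L * g) * rMatrix M N A q := key
    _ = secondY L * firstXY L * rMatrix M N A q * g * h := by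
        rw [hh (secondY L * firstXY L * rMatrix M N A q * g), hg (_ * rMatrix M N A q),
          hh (secondY L), hg (firstXY L)]
        simp only [mul_assoc]
        rw [← mul_assoc (secondY L) g, hg (secondY L), mul_assoc]

end Series

/-! ### The presentation of U_q(gl(M|N)) in terms of root vectors indexed by natural numbers -/

section Presentation

variable {M N : ℕ} {A : Type*} [Ring A] [Algebra ℂ A] {q : ℂ}

theorem map_simpleUp {B : Type*} [Ring B] [Algebra ℂ B] (φ : A →ₐ[ℂ] B) (g : UGen M N → A) (i : ℕ) :
    φ (simpleUp g i) = simpleUp (φ ∘ g) i := by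
  unfold simpleUp; split_ifs <;> simp

theorem map_simpleDown {B : Type*} [Ring B] [Algebra ℂ B] (φ : A →ₐ[ℂ] B) (g : UGen M N → A)
    (i : ℕ) : φ (simpleDown g i) = simpleDown (φ ∘ g) i := by
  unfold simpleDown; split_ifs <;> simp

/-- `raising` counts the steps beyond the simple root, `posRoot` takes the end point: hence the
shift by one. -/
theorem raising_eq_posRoot (g : UGen M N → A) (a d : ℕ) :
    raising q g a d = posRoot M q (simpleUp g) a (a + d + 1) := by
  induction d with
  | zero => exact (posRoot_self_succ a).symm
  | succ d ih => rw [raising, ih, zpow_neg]; exact (posRoot_succ (by omega)).symm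

theorem lowering_eq_negRoot (g : UGen M N → A) (a d : ℕ) :
    lowering q g a d = negRoot M q (simpleDown g) a (a + d + 1) := by
  induction d with
  | zero => exact (QData.negRoot_self_succ a).symm
  | succ d ih => rw [lowering, ih]; exact (QData.negRoot_succ (by omega)).symm

theorem cartanWeyl_of_lt (g : UGen M N → A) {a b : Fin (M + N)} (h : a < b) :
    cartanWeyl q g a b = posRoot M q (simpleUp g) a b := by
  have h' : (a : ℕ) < b := h
  rw [cartanWeyl, if_pos h, raising_eq_posRoot, show (a : ℕ) + (b - a - 1) + 1 = b by omega]

theorem cartanWeyl_of_gt (g : UGen M N → A) {a b : Fin (M + N)} (h : a < b) :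
    cartanWeyl q g b a = negRoot M q (simpleDown g) a b := by
  have h' : (a : ℕ) < b := h
  rw [cartanWeyl, if_neg h.not_gt, if_pos h, lowering_eq_negRoot,
    show (a : ℕ) + (b - a - 1) + 1 = b by omega]

theorem map_posRoot {B : Type*} [Ring B] [Algebra ℂ B] (φ : A →ₐ[ℂ] B) (e : ℕ → A) (a b : ℕ) :
    φ (posRoot M q e a b) = posRoot M q (φ ∘ e) a b := by
  induction b with
  | zero => exact map_zero φ
  | succ b ih => rw [posRoot, posRoot, ← ih]; split_ifs <;> simp

theorem map_negRoot {B : Type*} [Ring B] [Algebra ℂ B] (φ : A →ₐ[ℂ] B) (e : ℕ → A) (a b : ℕ) :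
    φ (negRoot M q e a b) = negRoot M q (φ ∘ e) a b := by
  induction b with
  | zero => exact map_zero φ
  | succ b ih => rw [negRoot, negRoot, ← ih]; split_ifs <;> simp

theorem map_cartanWeyl {B : Type*} [Ring B] [Algebra ℂ B] (φ : A →ₐ[ℂ] B) (g : UGen M N → A)
    (a b : Fin (M + N)) : φ (cartanWeyl q g a b) = cartanWeyl q (φ ∘ g) a b := by
  have h1 : φ ∘ simpleUp g = simpleUp (φ ∘ g) := funext fun i => map_simpleUp φ g i
  have h2 : φ ∘ simpleDown g = simpleDown (φ ∘ g) := funext fun i => map_simpleDown φ g i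
  rcases lt_trichotomy a b with h | rfl | h
  · rw [cartanWeyl_of_lt _ h, cartanWeyl_of_lt _ h, map_posRoot, h1]
  · simp [cartanWeyl]
  · rw [cartanWeyl_of_gt _ h, cartanWeyl_of_gt _ h, map_negRoot, h2]

theorem degE_of_ne {i : Fin (M + N - 1)} (h : (i : ℕ) + 1 ≠ M) : degE i = 0 := by
  rw [degE]
  change par M i + par M (i + 1) = 0
  rw [par_succ h, CharTwo.add_self_eq_zero]

theorem degE_of_eq {i : Fin (M + N - 1)} (h : (i : ℕ) + 1 = M) : degE i = 1 := by
  rw [degE]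
  change par M i + par M (i + 1) = 1
  rw [par_of_lt (by omega), par_of_le (by omega), zero_add]

theorem parity_mkAlgHom {F : Type*} [Ring F] [Algebra ℂ F] [Superalgebra F] (r : F → F → Prop)
    (hr : ∀ x y, r x y → ∃ i, x ∈ homPart F i ∧ y ∈ homPart F i) (x : F) :
    (quotSuperalgebra r hr).parity (RingQuot.mkAlgHom ℂ r x) =
      RingQuot.mkAlgHom ℂ r (Superalgebra.parity x) :=
  RingQuot.liftAlgHom_mkAlgHom_apply ..

end Presentation

/-! ### The generators of U_q(gl(M|N)) satisfy `QData` -/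

namespace QuantumGL

variable {M N : ℕ} {q : ℂ}

variable (M N q) in
/-- The projection of the free algebra to `U_q(gl(M|N))`. -/
def mk : FreeAlgebra ℂ (UGen M N) →ₐ[ℂ] QuantumGL M N q := RingQuot.mkAlgHom ℂ (URel M N q)

theorem mk_ι (x : UGen M N) : mk M N q (FreeAlgebra.ι ℂ x) = gen M N q x := rfl

theorem mk_rel {x y : FreeAlgebra ℂ (UGen M N)} (h : URel M N q x y) : mk M N q x = mk M N q y :=
  RingQuot.mkAlgHom_rel ℂ h

theorem mk_cartanWeyl (a b : Fin (M + N)) :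
    mk M N q (cartanWeyl q (FreeAlgebra.ι ℂ) a b) = E M N q a b :=
  map_cartanWeyl _ _ _ _

theorem mk_powK (a : Fin (M + N)) (i : ZMod 2) :
    mk M N q (powK (FreeAlgebra.ι ℂ) a i) = powK (gen M N q) a i := by
  unfold powK; split_ifs <;> rfl

theorem parity_mk (x : FreeAlgebra ℂ (UGen M N)) :
    Superalgebra.parity (mk M N q x : QuantumGL M N q) =
      mk M N q (Superalgebra.parity x) :=
  parity_mkAlgHom (URel M N q) (URel.homogeneous q) x

theorem mk_mem {x : FreeAlgebra ℂ (UGen M N)} {i : ZMod 2} (hx : x ∈ homPart _ i) :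
    mk M N q x ∈ homPart (QuantumGL M N q) i := by
  rw [mem_homPart, parity_mk, mem_homPart.1 hx, map_zsmul]

theorem E_mem (a b : Fin (M + N)) :
    E M N q a b ∈ homPart (QuantumGL M N q) (par M a + par M b) := by
  rw [← mk_cartanWeyl]
  exact mk_mem (cartanWeyl_mem q a b)

theorem powK_gen_mem (a : Fin (M + N)) (i : ZMod 2) :
    powK (gen M N q) a i ∈ homPart (QuantumGL M N q) 0 := by
  rw [← mk_powK]
  exact mk_mem (powK_mem a i)

theorem K_mul_Kinv (a : Fin (M + N)) : gen M N q (.K a) * gen M N q (.Kinv a) = 1 := by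
  have := mk_rel (URel.K_mul_Kinv (q := q) a)
  rwa [map_mul, map_one] at this

theorem Kinv_mul_K (a : Fin (M + N)) : gen M N q (.Kinv a) * gen M N q (.K a) = 1 := by
  have := mk_rel (URel.Kinv_mul_K (q := q) a)
  rwa [map_mul, map_one] at this

theorem K_comm (a b : Fin (M + N)) : Commute (gen M N q (.K a)) (gen M N q (.K b)) := by
  have := mk_rel (URel.K_comm (q := q) a b)
  rwa [map_mul, map_mul] at this

variable (M N q) in
/-- The invertible element `q^{E^a_a}`. -/
def unitK (a : Fin (M + N)) : (QuantumGL M N q)ˣ :=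
  ⟨gen M N q (.K a), gen M N q (.Kinv a), K_mul_Kinv a, Kinv_mul_K a⟩

theorem unitK_comm (a b : Fin (M + N)) : Commute (unitK M N q a) (unitK M N q b) :=
  Units.ext (K_comm a b)

theorem powK_eq (a : Fin (M + N)) (i : ZMod 2) :
    powK (gen M N q) a i = ((unitK M N q a ^ sgn i : (QuantumGL M N q)ˣ) : QuantumGL M N q) := by
  rcases zmod_two_cases i with rfl | rfl
  · rw [show sgn 0 = 1 from rfl, zpow_one]; rfl
  · rw [show sgn 1 = -1 from rfl, zpow_neg_one]; rfl

theorem powK_comm (a b : Fin (M + N)) (i j : ZMod 2) :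
    Commute (powK (gen M N q) a i) (powK (gen M N q) b j) := by
  rw [powK_eq, powK_eq]
  exact (((unitK_comm a b).zpow_left _).zpow_right _).map (Units.coeHom _)

theorem powK_mul_powK (a : Fin (M + N)) (i : ZMod 2) :
    powK (gen M N q) a i * powK (gen M N q) a (i + 1) = 1 := by
  rw [powK_eq, powK_eq, ← Units.val_mul, ← zpow_add, sgn_add, show sgn 1 = -1 from rfl, mul_neg_one,
    add_neg_cancel, zpow_zero, Units.val_one]

theorem powK_mul_of_K_mul {a : Fin (M + N)} {x : QuantumGL M N q} {t : ℂ} (ht : t ≠ 0)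
    (h : gen M N q (.K a) * x = t • (x * gen M N q (.K a))) (i : ZMod 2) :
    powK (gen M N q) a i * x = t ^ sgn i • (x * powK (gen M N q) a i) := by
  rcases zmod_two_cases i with rfl | rfl
  · rw [show sgn 0 = 1 from rfl, zpow_one]; exact h
  · rw [show sgn 1 = -1 from rfl, zpow_neg_one]
    change gen M N q (.Kinv a) * x = t⁻¹ • (x * gen M N q (.Kinv a))
    calc gen M N q (.Kinv a) * x =
          gen M N q (.Kinv a) * (t⁻¹ • t • (x * gen M N q (.K a))) * gen M N q (.Kinv a) := by
          rw [smul_smul, inv_mul_cancel₀ ht, one_smul, mul_assoc, mul_assoc, K_mul_Kinv, mul_one]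
      _ = t⁻¹ • (x * gen M N q (.Kinv a)) := by
          rw [← h, mul_smul_comm, smul_mul_assoc, ← mul_assoc _ _ x, Kinv_mul_K, one_mul]

variable (M N q) in
/-- The element `q^{(-1)^{[a]} E^a_a}` for a natural number `a`, and `1` if `a` is not an index. -/
def signedK (a : ℕ) : QuantumGL M N q :=
  if h : a < M + N then powK (gen M N q) ⟨a, h⟩ (par M a) else 1

variable (M N q) in
/-- The element `q^{-(-1)^{[a]} E^a_a}` for a natural number `a`, and `1` if `a` is not an index. -/
def signedKinv (a : ℕ) : QuantumGL M N q :=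
  if h : a < M + N then powK (gen M N q) ⟨a, h⟩ (par M a + 1) else 1

theorem zpow_weight (a : Fin (M + N)) (i : Fin (M + N - 1)) :
    (q ^ weight a i) ^ sgn (par M a) = rootWt M q a i (i + 1) := by
  have h1 : a = lo i ↔ (a : ℕ) = i := Fin.ext_iff
  have h2 : a = hi i ↔ (a : ℕ) = i + 1 := Fin.ext_iff
  rw [weight, rootWt, qs, ← zpow_mul]
  simp only [h1, h2]
  split_ifs <;> simp [mul_comm]
  omega

theorem zpow_neg_weight (a : Fin (M + N)) (i : Fin (M + N - 1)) :
    (q ^ (-weight a i)) ^ sgn (par M a) = rootWt M q a (i + 1) i := by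
  rw [← rootWt_inv, ← zpow_weight, zpow_neg, inv_zpow]

theorem powK_up (hq : q ≠ 0) (a : Fin (M + N)) (i : Fin (M + N - 1)) (j : ZMod 2) :
    powK (gen M N q) a j * gen M N q (.up i) =
      (q ^ weight a i) ^ sgn j • (gen M N q (.up i) * powK (gen M N q) a j) := by
  have := mk_rel (URel.K_up (q := q) a i)
  simp only [map_mul, map_smul, mk_ι] at this
  exact powK_mul_of_K_mul (zpow_ne_zero _ hq) this j

theorem powK_down (hq : q ≠ 0) (a : Fin (M + N)) (i : Fin (M + N - 1)) (j : ZMod 2) :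
    powK (gen M N q) a j * gen M N q (.down i) =
      (q ^ (-weight a i)) ^ sgn j • (gen M N q (.down i) * powK (gen M N q) a j) := by
  have := mk_rel (URel.K_down (q := q) a i)
  simp only [map_mul, map_smul, mk_ι] at this
  exact powK_mul_of_K_mul (zpow_ne_zero _ hq) this j

theorem simpleUp_of_lt {i : ℕ} (h : i + 1 < M + N) :
    simpleUp (gen M N q) i = gen M N q (.up ⟨i, by omega⟩) := dif_pos _

theorem simpleUp_of_le {i : ℕ} (h : M + N ≤ i + 1) : simpleUp (gen M N q) i = 0 :=
  dif_neg (by omega)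

theorem simpleDown_of_lt {i : ℕ} (h : i + 1 < M + N) :
    simpleDown (gen M N q) i = gen M N q (.down ⟨i, by omega⟩) := dif_pos _

theorem simpleDown_of_le {i : ℕ} (h : M + N ≤ i + 1) : simpleDown (gen M N q) i = 0 :=
  dif_neg (by omega)

theorem signedK_of_lt {a : ℕ} (h : a < M + N) :
    signedK M N q a = powK (gen M N q) ⟨a, h⟩ (par M a) := dif_pos h

theorem signedKinv_of_lt {a : ℕ} (h : a < M + N) :
    signedKinv M N q a = powK (gen M N q) ⟨a, h⟩ (par M a + 1) := dif_pos h

theorem signedK_mul_simpleUp (hq : q ≠ 0) (a i : ℕ) :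
    signedK M N q a * simpleUp (gen M N q) i =
      rootWt M q a i (i + 1) • (simpleUp (gen M N q) i * signedK M N q a) := by
  rcases Nat.lt_or_ge (i + 1) (M + N) with hi | hi
  · rcases Nat.lt_or_ge a (M + N) with ha | ha
    · rw [simpleUp_of_lt hi, signedK_of_lt ha, powK_up hq, ← zpow_weight ⟨a, ha⟩ ⟨i, by omega⟩]
    · rw [signedK, dif_neg ha.not_gt, rootWt, if_neg (by omega), if_neg (by omega)]
      simp
  · rw [simpleUp_of_le hi, mul_zero, zero_mul, smul_zero]

theorem signedK_mul_simpleDown (hq : q ≠ 0) (a i : ℕ) :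
    signedK M N q a * simpleDown (gen M N q) i =
      rootWt M q a (i + 1) i • (simpleDown (gen M N q) i * signedK M N q a) := by
  rcases Nat.lt_or_ge (i + 1) (M + N) with hi | hi
  · rcases Nat.lt_or_ge a (M + N) with ha | ha
    · rw [simpleDown_of_lt hi, signedK_of_lt ha, powK_down hq,
        ← zpow_neg_weight ⟨a, ha⟩ ⟨i, by omega⟩]
    · rw [signedK, dif_neg ha.not_gt, rootWt, if_neg (by omega), if_neg (by omega)]
      simp
  · rw [simpleDown_of_le hi, mul_zero, zero_mul, smul_zero]

theorem sgn_degE (i : Fin (M + N - 1)) : (sgn (degE i * degE i) : ℂ) = sg M i * sg M (i + 1) := by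
  rw [show degE i * degE i = degE i by generalize degE i = x; revert x; decide, degE, sgn_add,
    Int.cast_mul]
  rfl

theorem simpleUp_mul_simpleDown {i : ℕ} (h : i + 1 < M + N) :
    simpleUp (gen M N q) i * simpleDown (gen M N q) i =
      (sg M i * sg M (i + 1)) • (simpleDown (gen M N q) i * simpleUp (gen M N q) i) +
      (sg M i * (q - q⁻¹)⁻¹) • (signedK M N q i * signedKinv M N q (i + 1) -
        signedKinv M N q i * signedK M N q (i + 1)) := by
  have h1 := mk_rel (URel.up_down_self (q := q) (⟨i, by omega⟩ : Fin (M + N - 1)))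
  simp only [superComm, qh, qhInv, map_sub, map_smul, map_mul, mk_ι, mk_powK,
    ← Int.cast_smul_eq_zsmul ℂ, sgn_degE] at h1
  rw [simpleUp_of_lt h, simpleDown_of_lt h, signedK_of_lt h, signedK_of_lt (by omega),
    signedKinv_of_lt h, signedKinv_of_lt (by omega), mul_smul (sg M i) (q - q⁻¹)⁻¹]
  exact (sub_eq_iff_eq_add'.1 h1)

theorem simpleUp_comm_simpleDown {i j : ℕ} (h : i ≠ j) :
    Commute (simpleUp (gen M N q) i) (simpleDown (gen M N q) j) := by
  rcases Nat.lt_or_ge (i + 1) (M + N) with hi | hi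
  · rcases Nat.lt_or_ge (j + 1) (M + N) with hj | hj
    · have h1 := mk_rel (URel.up_down (q := q) (⟨i, by omega⟩ : Fin (M + N - 1)) ⟨j, by omega⟩
        (by rw [Ne, Fin.ext_iff]; exact h))
      -- There is at most one odd simple root, so for distinct indices the graded commutator is an
      -- ordinary one.
      have h2 : degE (⟨i, by omega⟩ : Fin (M + N - 1)) * degE (⟨j, by omega⟩ : Fin (M + N - 1)) =
          0 := by
        by_cases hM : i + 1 = M
        · rw [degE_of_ne (i := (⟨j, by omega⟩ : Fin (M + N - 1)))
            (show j + 1 ≠ M by omega), mul_zero]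
        · rw [degE_of_ne (i := (⟨i, by omega⟩ : Fin (M + N - 1))) hM, zero_mul]
      rw [superComm, h2, sgn_zero, one_smul, map_sub, map_mul, map_mul, map_zero, mk_ι, mk_ι,
        sub_eq_zero] at h1
      rwa [simpleUp_of_lt hi, simpleDown_of_lt hj]
    · rw [simpleDown_of_le hj]; exact Commute.zero_right _
  · rw [simpleUp_of_le hi]; exact Commute.zero_left _

/-- Each relation in range is a defining one; out of range the generators are 0 and it holds
trivially. -/
theorem halfRel_simpleUp : HalfRel M q (simpleUp (gen M N q)) where
  comm i j hij := by
    rcases Nat.lt_or_ge (j + 1) (M + N) with hj | hj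
    · have h1 := mk_rel (URel.up_comm (q := q) (⟨i, by omega⟩ : Fin (M + N - 1)) ⟨j, by omega⟩ hij)
      rw [map_mul, map_mul] at h1
      rwa [simpleUp_of_lt hj, simpleUp_of_lt (by omega)]
    · rw [simpleUp_of_le hj]; exact Commute.zero_right _
  sq i hi := by
    rcases Nat.lt_or_ge (i + 1) (M + N) with h | h
    · have h1 := mk_rel (URel.up_sq (q := q) (⟨i, by omega⟩ : Fin (M + N - 1)) hi)
      rw [map_pow, map_zero, mk_ι, pow_two] at h1
      rwa [simpleUp_of_lt h]
    · rw [simpleUp_of_le h, mul_zero]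
  serre i j hij hi := by
    unfold SerreRel
    rcases Nat.lt_or_ge (i + 1) (M + N) with h | h
    · rcases Nat.lt_or_ge (j + 1) (M + N) with hj | hj
      · have h1 := mk_rel (URel.up_serre (q := q) (⟨i, by omega⟩ : Fin (M + N - 1)) ⟨j, by omega⟩
          hij hi)
        simp only [map_add, map_sub, map_smul, map_mul, map_zero, mk_ι, pow_two,
          mul_assoc] at h1
        rw [simpleUp_of_lt h, simpleUp_of_lt hj]
        linear_combination (norm := module) h1
      · rw [simpleUp_of_le hj]; simp
    · rw [simpleUp_of_le h]; simp
  quartic i hi := by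
    rcases Nat.lt_or_ge (i + 3) (M + N) with h | h
    · have h1 := mk_rel (URel.up_quartic (q := q) (⟨i, by omega⟩ : Fin (M + N)) ⟨i + 3, h⟩
        ⟨i + 1, by omega⟩ hi (by change i + 3 = M + 1; omega) (by change i + 1 + 1 = M; omega))
      rw [superComm, degE_of_eq (by change i + 1 + 1 = M; omega), parV, parV,
        par_of_lt (show i < M by omega), par_of_le (show M ≤ i + 3 by omega), map_sub, map_zsmul,
        map_mul, map_mul, map_zero, mk_cartanWeyl, mk_ι, E,
        cartanWeyl_of_lt _ (by rw [Fin.lt_def]; change i < i + 3; omega)] at h1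
      simp only [zero_add, mul_one, show sgn 1 = -1 from rfl, neg_smul, one_smul,
        sub_neg_eq_add] at h1
      rw [simpleUp_of_lt (by omega)]
      exact eq_neg_of_add_eq_zero_right h1
    -- Here N ≤ 1: the root vector has the factor e_{i+2}, which is out of range and so 0.
    · rw [posRoot_succ (by omega), simpleUp_of_le (i := i + 2) (by omega)]
      simp

theorem halfRel_simpleDown (hq : q ≠ 0) : HalfRel M q (simpleDown (gen M N q)) where
  comm i j hij := by
    rcases Nat.lt_or_ge (j + 1) (M + N) with hj | hj
    · have h1 := mk_rel (URel.down_comm (q := q) (⟨i, by omega⟩ : Fin (M + N - 1)) ⟨j, by omega⟩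
        hij)
      rw [map_mul, map_mul] at h1
      rwa [simpleDown_of_lt hj, simpleDown_of_lt (by omega)]
    · rw [simpleDown_of_le hj]; exact Commute.zero_right _
  sq i hi := by
    rcases Nat.lt_or_ge (i + 1) (M + N) with h | h
    · have h1 := mk_rel (URel.down_sq (q := q) (⟨i, by omega⟩ : Fin (M + N - 1)) hi)
      rw [map_pow, map_zero, mk_ι, pow_two] at h1
      rwa [simpleDown_of_lt h]
    · rw [simpleDown_of_le h, mul_zero]
  serre i j hij hi := by
    unfold SerreRel
    rcases Nat.lt_or_ge (i + 1) (M + N) with h | h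
    · rcases Nat.lt_or_ge (j + 1) (M + N) with hj | hj
      · have h1 := mk_rel (URel.down_serre (q := q) (⟨i, by omega⟩ : Fin (M + N - 1))
          ⟨j, by omega⟩ hij hi)
        simp only [map_add, map_sub, map_smul, map_mul, map_zero, mk_ι, pow_two,
          mul_assoc] at h1
        rw [simpleDown_of_lt h, simpleDown_of_lt hj]
        linear_combination (norm := module) h1
      · rw [simpleDown_of_le hj]; simp
    · rw [simpleDown_of_le h]; simp
  quartic i hi := by
    rcases Nat.lt_or_ge (i + 3) (M + N) with h | h
    · have h1 := mk_rel (URel.down_quartic (q := q) (⟨i, by omega⟩ : Fin (M + N)) ⟨i + 3, h⟩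
        ⟨i + 1, by omega⟩ hi (by change i + 3 = M + 1; omega) (by change i + 1 + 1 = M; omega))
      rw [superComm, degE_of_eq (by change i + 1 + 1 = M; omega), parV, parV,
        par_of_lt (show i < M by omega), par_of_le (show M ≤ i + 3 by omega), map_sub, map_zsmul,
        map_mul, map_mul, map_zero, mk_cartanWeyl, mk_ι, E,
        cartanWeyl_of_gt _ (by rw [Fin.lt_def]; change i < i + 3; omega)] at h1
      simp only [zero_add, mul_one, show sgn 1 = -1 from rfl, neg_smul, one_smul,
        sub_neg_eq_add] at h1
      -- The defining quartic relation uses the lowering recursion, `HalfRel` the raising one; the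
      -- two root vectors are proportional with nonzero factor t.
      obtain ⟨t, ht, h2⟩ := exists_negRoot_eq (M := M) (e := simpleDown (gen M N q)) hq i (i + 3)
      rw [h2, smul_mul_assoc, mul_smul_comm, ← smul_add, smul_eq_zero_iff_right ht] at h1
      rw [simpleDown_of_lt (by omega)]
      exact eq_neg_of_add_eq_zero_right h1
    · rw [posRoot_succ (by omega), simpleDown_of_le (i := i + 2) (by omega)]
      simp

theorem qData (hq : q ≠ 0) : QData M (M + N) q (simpleUp (gen M N q)) (simpleDown (gen M N q))
    (signedK M N q) (signedKinv M N q) where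
  k_mul_k' a := by
    unfold signedK signedKinv
    split_ifs
    · exact powK_mul_powK _ _
    · exact mul_one _
  k'_mul_k a := by
    unfold signedK signedKinv
    split_ifs
    · rw [(powK_comm _ _ _ _).eq]; exact powK_mul_powK _ _
    · exact mul_one _
  k_comm a b := by
    unfold signedK
    split_ifs
    · exact powK_comm _ _ _ _
    · exact Commute.one_right _
    · exact Commute.one_left _
    · exact Commute.one_left _
  k_e := signedK_mul_simpleUp hq
  k_f := signedK_mul_simpleDown hq
  e_f_self _ h := simpleUp_mul_simpleDown h
  e_f _ _ h := simpleUp_comm_simpleDown h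
  pos := halfRel_simpleUp
  neg := halfRel_simpleDown hq

end QuantumGL

/-! ### Entries of l⁺ and l⁻, and the relation for l(x) -/

namespace QuantumGL

variable {M N : ℕ} {q : ℂ}

theorem E_of_lt {a b : Fin (M + N)} (h : a < b) :
    E M N q a b = posRoot M q (simpleUp (gen M N q)) a b := cartanWeyl_of_lt _ h

theorem E_of_gt {a b : Fin (M + N)} (h : a < b) :
    E M N q b a = negRoot M q (simpleDown (gen M N q)) a b := cartanWeyl_of_gt _ h

theorem E_up_split {a c b : Fin (M + N)} (hac : a < c) (hcb : c < b) :
    E M N q a b = E M N q a c * E M N q c b -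
      q ^ (-sgn (parV M N c)) • (E M N q c b * E M N q a c) := by
  rw [E_of_lt hac, E_of_lt hcb, E_of_lt (hac.trans hcb), zpow_neg]
  exact halfRel_simpleUp.posRoot_split hac hcb

theorem E_down_split (hq : q ≠ 0) {a c b : Fin (M + N)} (hac : a < c) (hcb : c < b) :
    E M N q b a = E M N q b c * E M N q c a -
      q ^ sgn (parV M N c) • (E M N q c a * E M N q b c) := by
  rw [E_of_gt hac, E_of_gt hcb, E_of_gt (hac.trans hcb)]
  exact (qData hq).negRoot_split hq hac hcb

theorem sum_unitTensor_apply {A : Type*} [Ring A] (P : Fin (M + N) → Fin (M + N) → Prop)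
    [∀ a b, Decidable (P a b)] (s : Fin (M + N) → Fin (M + N) → ℤ)
    (F : Fin (M + N) → Fin (M + N) → A) (a b : Fin (M + N)) :
    (∑ x, ∑ y, if P x y then s x y • EndTensor.unitTensor (parV M N) x y (F x y) else 0) a b =
      if P a b then s a b • F a b else 0 := by
  simp only [EndTensor.sum_apply, EndTensor.ite_apply, EndTensor.smul_apply, EndTensor.unitTensor,
    EndTensor.zero_apply]
  rw [Finset.sum_eq_single a, Finset.sum_eq_single b]
  · simp
  · intro y _ hy
    rw [if_neg (show ¬ (a = a ∧ b = y) by tauto), smul_zero, ite_self]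
  · simp
  · intro x _ hx
    refine Finset.sum_eq_zero fun y _ => ?_
    rw [if_neg (show ¬ (a = x ∧ b = y) by tauto), smul_zero, ite_self]
  · simp

theorem diagPart_apply (i : ZMod 2) (a b : Fin (M + N)) :
    diagPart M N q i a b = if a = b then powK (gen M N q) a (parV M N a + i) else 0 := by
  simp only [diagPart, EndTensor.sum_apply, EndTensor.unitTensor]
  rw [Finset.sum_eq_single a]
  · simp only [true_and, eq_comm (a := b)]
  · intro x _ hx
    rw [if_neg (by tauto)]
  · simp

theorem twist_of_even {x : QuantumGL M N q} (hx : x ∈ homPart (QuantumGL M N q) 0) (i : ZMod 2) :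
    twist i x = x := by
  rw [twist_of_mem hx, mul_zero, csgn_zero, one_smul]

/-- The left factor of l⁺ is diagonal with even entries, so a single summand without extra sign
remains. In l⁻ the right factor is diagonal, and the twist is trivial because its exponent is [b] +
[b]. -/
theorem lPlus_apply (a b : Fin (M + N)) : lPlus M N q a b =
    if a = b then powK (gen M N q) a (parV M N a) else if b < a then
      ((q - q⁻¹) * csgn (par M b)) • (powK (gen M N q) a (parV M N a) * E M N q b a) else 0 := by
  rw [lPlus, EndTensor.mul_apply, Finset.sum_eq_single a]
  · rw [diagPart_apply, if_pos rfl, twist_of_even (powK_gen_mem _ _), add_zero,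
      EndTensor.add_apply, EndTensor.one_apply, EndTensor.smul_apply, Finset.sum_comm]
    rw [sum_unitTensor_apply (fun x y => y < x) (fun x y => sgn (parV M N y))
      (fun x y => E M N q y x)]
    rcases eq_or_ne a b with rfl | h
    · simp
    · rw [if_neg h, if_neg h, zero_add]
      split_ifs
      · rw [sgn_smul_eq, smul_smul, mul_smul_comm]
        rfl
      · rw [smul_zero, mul_zero]
  · intro c _ hc
    rw [diagPart_apply, if_neg hc.symm, map_zero, zero_mul]
  · simp

theorem lMinus_apply (a b : Fin (M + N)) : lMinus M N q a b =
    if a = b then powK (gen M N q) b (parV M N b + 1) else if a < b then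
      (-((q - q⁻¹) * csgn (par M b))) • (E M N q b a * powK (gen M N q) b (parV M N b + 1))
      else 0 := by
  rw [lMinus, EndTensor.mul_apply, Finset.sum_eq_single b]
  · rw [diagPart_apply, if_pos rfl, CharTwo.add_self_eq_zero, twist_zero,
      EndTensor.sub_apply, EndTensor.one_apply, EndTensor.smul_apply]
    rw [sum_unitTensor_apply (fun x y => x < y) (fun x y => sgn (parV M N y))
      (fun x y => E M N q y x)]
    rcases eq_or_ne a b with rfl | h
    · simp
    · rw [if_neg h, if_neg h, zero_sub]
      split_ifs
      · rw [sgn_smul_eq, smul_smul, neg_smul, ← smul_mul_assoc, neg_mul]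
        rfl
      · rw [smul_zero, neg_zero, zero_mul]
  · intro c _ hc
    rw [diagPart_apply, if_neg hc, mul_zero]
  · simp

theorem parity_eq_self {A : Type*} [Ring A] [Algebra ℂ A] [Superalgebra A]
    {X : EndTensor (parV M N) A} (h : ∀ a b : Fin (M + N), X a b ∈ homPart A (par M a + par M b)) :
    Superalgebra.parity X = X := by
  ext a b
  rw [EndTensor.parity_apply, mem_homPart.1 (h a b), smul_smul]
  change (sgn (par M a + par M b) * _) • _ = _
  rw [sgn_mul_self, one_smul]

theorem parity_lPlus : Superalgebra.parity (lPlus M N q) = lPlus M N q := by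
  refine parity_eq_self fun a b => ?_
  rw [lPlus_apply]
  split_ifs with h
  · rw [h, CharTwo.add_self_eq_zero]
    exact powK_gen_mem _ _
  · refine Submodule.smul_mem _ _ ?_
    have := mul_mem_homPart (powK_gen_mem (q := q) a (parV M N a)) (E_mem b a)
    rwa [zero_add, add_comm (par M b)] at this
  · exact zero_mem _

theorem parity_lMinus : Superalgebra.parity (lMinus M N q) = lMinus M N q := by
  refine parity_eq_self fun a b => ?_
  rw [lMinus_apply]
  split_ifs with h
  · rw [h, CharTwo.add_self_eq_zero]
    exact powK_gen_mem _ _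
  · refine Submodule.smul_mem _ _ ?_
    have := mul_mem_homPart (E_mem b a) (powK_gen_mem (q := q) b (parV M N b + 1))
    rwa [add_zero, add_comm (par M b)] at this
  · exact zero_mem _

theorem sg_eq_csgn (M a : ℕ) : sg M a = csgn (par M a) := rfl

/-- If b < a and b is odd then a is odd, so [a][b] = [b] and the correcting sign cancels the
(-1)^{[b]} in l⁺. In `hat_lMinus` the smaller index is a, so [a][b] = [a] and (-1)^{[a] + [b]} is
left over. -/
theorem hat_lPlus (a b : Fin (M + N)) : hat (lPlus M N q) a b =
    lp M q (simpleUp (gen M N q)) (signedK M N q) a b := by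
  rw [hat, lPlus_apply]
  rcases lt_trichotomy a b with h | rfl | h
  · rw [if_neg h.ne, if_neg h.not_gt, smul_zero, lp_of_lt h]
  · rw [if_pos rfl, lp_self, signedK_of_lt a.2, sg_eq_csgn]
    congr 2
    generalize par M a = a
    revert a
    decide
  · rw [if_neg h.ne', if_pos h, lp_of_ne (by rw [Fin.lt_def] at h; omega), signedK_of_lt a.2,
      E_of_lt h, smul_smul, mul_left_comm, ← csgn_add]
    rw [show csgn _ = 1 from ?_, mul_one]
    · rfl
    · rw [← csgn_zero]
      congr 1
      have h' : (b : ℕ) < a := h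
      rcases Nat.lt_or_ge b M with hb | hb
      · rw [par_of_lt hb]; simp
      · rw [par_of_le hb, par_of_le (show M ≤ a by omega)]; rfl

theorem hat_lMinus (a b : Fin (M + N)) : hat (lMinus M N q) a b =
    lm M q (simpleDown (gen M N q)) (signedKinv M N q) a b := by
  rw [hat, lMinus_apply]
  rcases lt_trichotomy a b with h | rfl | h
  · have h' : (a : ℕ) < b := h
    rw [if_neg h.ne, if_pos h, lm_of_ne (by omega), signedKinv_of_lt b.2, E_of_gt h, smul_smul,
      mul_neg, mul_left_comm, ← csgn_add, sg_eq_csgn, sg_eq_csgn, ← csgn_add]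
    congr 4
    rcases Nat.lt_or_ge a M with ha | ha
    · rw [par_of_lt ha]; simp
    · rw [par_of_le ha, par_of_le (show M ≤ b by omega)]; rfl
  · rw [if_pos rfl, lm_self, signedKinv_of_lt a.2, sg_eq_csgn]
    congr 2
    generalize par M a = a
    revert a
    decide
  · rw [if_neg h.ne', if_neg h.not_gt, smul_zero, lm_of_lt h]

theorem coeff_zero_l : PowerSeries.coeff 0 (l M N q) = lPlus M N q := by
  rw [l, sub_mul, mul_assoc]
  simp

theorem coeff_succ_l (k : ℕ) :
    PowerSeries.coeff (k + 1) (l M N q) = lPlus M N q - lMinus M N q := by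
  rw [l, sub_mul, mul_assoc, map_sub, PowerSeries.coeff_succ_X_mul, PowerSeries.coeff_C_mul,
    PowerSeries.coeff_C_mul, PowerSeries.coeff_mk, PowerSeries.coeff_mk]
  simp

theorem rllLeft_l (hq : q ≠ 0) (hq' : q + q⁻¹ ≠ 0) (hq2 : q - q⁻¹ ≠ 0) :
    rllLeft q (l M N q) = rllRight q (l M N q) := by
  have h := qData (M := M) (N := N) hq
  refine rllLeft_eq_rllRight parity_lPlus parity_lMinus coeff_zero_l coeff_succ_l ?_ ?_ ?_ ?_
  · intro a b c d
    simp only [RelPlus, hat_lPlus]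
    exact relPlus_val_iff.2 (h.relPlus_lp_lp hq hq' hq2 a b c d)
  · intro a b c d
    simp only [RelPlus, hat_lPlus, hat_lMinus]
    exact relPlus_val_iff.2 (h.relPlus_lp_lm hq hq' hq2 a b c d)
  · intro a b c d
    simp only [RelMinus, hat_lPlus, hat_lMinus, Fin.ext_iff, Fin.lt_def]
    exact h.relMinus_lm_lp hq hq' hq2 a b c d
  · intro a b c d
    simp only [RelMinus, hat_lMinus, Fin.ext_iff, Fin.lt_def]
    exact h.relMinus_lm_lm hq hq' hq2 a b c d

end QuantumGL

/-! ### Transport of the relation along even homomorphisms -/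

section Functoriality

variable {A B : Type*} [Ring A] [Algebra ℂ A] [Superalgebra A] [Ring B] [Algebra ℂ B]
  [Superalgebra B]

theorem map_twist {φ : A →ₐ[ℂ] B} (hφ : ∀ x, φ (Superalgebra.parity x) = Superalgebra.parity (φ x))
    (i : ZMod 2) (x : A) : φ (twist i x) = twist i (φ x) := by
  rcases zmod_two_cases i with rfl | rfl
  · rw [twist_zero, twist_zero]
  · rw [twist_one, twist_one, hφ]

namespace EndTensor

variable {n : ℕ} (p : Fin n → ZMod 2)

/-- The homomorphism `End V ⊗ A → End V ⊗ B` induced by an even homomorphism `A → B`. -/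
def map (φ : A →ₐ[ℂ] B) (hφ : ∀ x, φ (Superalgebra.parity x) = Superalgebra.parity (φ x)) :
    EndTensor p A →ₐ[ℂ] EndTensor p B :=
  AlgHom.ofLinearMap
    { toFun := fun X => mk fun a b => φ (X a b)
      map_add' := fun X Y => by ext a b; exact map_add φ _ _
      map_smul' := fun c X => by ext a b; exact map_smul φ c _ }
    (by
      ext a b
      change φ ((1 : EndTensor p A) a b) = _
      rw [one_apply, one_apply, apply_ite φ, map_one, map_zero])
    (fun X Y => by
      ext a b
      change φ ((X * Y) a b) = ∑ c, twist (p c + p b) (φ (X a c)) * φ (Y c b)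
      rw [mul_apply, map_sum]
      exact Finset.sum_congr rfl fun c _ => by rw [map_mul, map_twist hφ])

variable {φ : A →ₐ[ℂ] B} (hφ : ∀ x, φ (Superalgebra.parity x) = Superalgebra.parity (φ x))

theorem map_apply (X : EndTensor p A) (a b : Fin n) : map p φ hφ X a b = φ (X a b) := rfl

theorem map_parity (X : EndTensor p A) :
    map p φ hφ (Superalgebra.parity X) = Superalgebra.parity (map p φ hφ X) := by
  ext a b
  rw [map_apply, parity_apply, parity_apply, map_zsmul, hφ, map_apply]

theorem map_unitTensor (a b : Fin n) (u : A) :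
    map p φ hφ (unitTensor p a b u) = unitTensor p a b (φ u) := by
  ext c d
  rw [map_apply, unitTensor, unitTensor, mk_apply, mk_apply, apply_ite φ, map_zero]

theorem map_oneTensor (u : A) : map p φ hφ (oneTensor p u) = oneTensor p (φ u) := by
  ext c d
  rw [map_apply, oneTensor, oneTensor, mk_apply, mk_apply, apply_ite φ, map_zero]

end EndTensor

variable {M N : ℕ} {φ : A →ₐ[ℂ] B}
  (hφ : ∀ x, φ (Superalgebra.parity x) = Superalgebra.parity (φ x))

variable (M N) in
/-- The homomorphism `End V ⊗ End V ⊗ A → End V ⊗ End V ⊗ B` induced by an even homomorphism. -/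
def mapEndEnd : EndEnd M N A →ₐ[ℂ] EndEnd M N B :=
  EndTensor.map _ (EndTensor.map (parV M N) φ hφ) (EndTensor.map_parity _ hφ)

theorem mapEndEnd_units (a b c d : Fin (M + N)) :
    mapEndEnd M N hφ (units M N A a b c d) = units M N B a b c d := by
  rw [units, mapEndEnd, EndTensor.map_unitTensor, EndTensor.map_unitTensor, map_one, units]

theorem mapEndEnd_powDiag (z : ℂ) :
    mapEndEnd M N hφ (powDiag M N A z) = powDiag M N B z := by
  simp only [powDiag, map_sum, map_smul, mapEndEnd_units]

theorem map_mapEndEnd_rMatrix (q : ℂ) :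
    MvPowerSeries.map (mapEndEnd M N hφ).toRingHom (rMatrix M N A q) = rMatrix M N B q := by
  simp only [rMatrix, map_add, map_sub, map_mul, MvPowerSeries.map_C, MvPowerSeries.map_X,
    AlgHom.toRingHom_eq_coe, RingHom.coe_coe, map_smul, map_sum, mapEndEnd_powDiag, apply_ite,
    map_zsmul, mapEndEnd_units, map_zero]

variable {L : PowerSeries (EndTensor (parV M N) A)} {L' : PowerSeries (EndTensor (parV M N) B)}

theorem map_mapEndEnd_firstXY
    (hL : ∀ k a b, φ (PowerSeries.coeff k L a b) = PowerSeries.coeff k L' a b) :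
    MvPowerSeries.map (mapEndEnd M N hφ).toRingHom (firstXY L) = firstXY L' := by
  ext n : 1
  rw [MvPowerSeries.coeff_map, coeff_firstXY, coeff_firstXY]
  change mapEndEnd M N hφ _ = _
  rw [apply_ite (mapEndEnd M N hφ), map_zero (mapEndEnd M N hφ)]
  congr 1
  ext a b : 1
  change EndTensor.map (parV M N) φ hφ (EndTensor.oneTensor _ _) = EndTensor.oneTensor _ _
  rw [EndTensor.map_oneTensor, hL]

theorem map_mapEndEnd_secondY
    (hL : ∀ k a b, φ (PowerSeries.coeff k L a b) = PowerSeries.coeff k L' a b) :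
    MvPowerSeries.map (mapEndEnd M N hφ).toRingHom (secondY L) = secondY L' := by
  ext n : 1
  rw [MvPowerSeries.coeff_map, coeff_secondY, coeff_secondY]
  change mapEndEnd M N hφ _ = _
  rw [apply_ite (mapEndEnd M N hφ), map_zero (mapEndEnd M N hφ)]
  congr 1
  rw [EndTensor.inSecond, mapEndEnd, EndTensor.map_oneTensor, EndTensor.inSecond]
  congr 1
  ext a b
  rw [EndTensor.map_apply, hL]

/-- The Yangian relations are imposed on coefficients in a free algebra. Since R has scalar entries
and φ respects parity, applying φ to them gives the same expressions in the image of the generating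
series. -/
theorem map_coeff_rllLeft
    (hφ : ∀ x, φ (Superalgebra.parity x) = Superalgebra.parity (φ x))
    (hL : ∀ k a b, φ (PowerSeries.coeff k L a b) = PowerSeries.coeff k L' a b)
    (q : ℂ) (n : Fin 2 →₀ ℕ) (a b c d : Fin (M + N)) :
    φ (MvPowerSeries.coeff n (rllLeft q L) a b c d) =
      MvPowerSeries.coeff n (rllLeft q L') a b c d := by
  have h : MvPowerSeries.map (mapEndEnd M N hφ).toRingHom (rllLeft q L) = rllLeft q L' := by
    rw [rllLeft, map_mul, map_mul, map_mapEndEnd_rMatrix, map_mapEndEnd_firstXY hφ hL,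
      map_mapEndEnd_secondY hφ hL, rllLeft]
  rw [← h, MvPowerSeries.coeff_map]
  rfl

theorem map_coeff_rllRight
    (hφ : ∀ x, φ (Superalgebra.parity x) = Superalgebra.parity (φ x))
    (hL : ∀ k a b, φ (PowerSeries.coeff k L a b) = PowerSeries.coeff k L' a b)
    (q : ℂ) (n : Fin 2 →₀ ℕ) (a b c d : Fin (M + N)) :
    φ (MvPowerSeries.coeff n (rllRight q L) a b c d) =
      MvPowerSeries.coeff n (rllRight q L') a b c d := by
  have h : MvPowerSeries.map (mapEndEnd M N hφ).toRingHom (rllRight q L) = rllRight q L' := by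
    rw [rllRight, map_mul, map_mul, map_mapEndEnd_rMatrix, map_mapEndEnd_firstXY hφ hL,
      map_mapEndEnd_secondY hφ hL, rllRight]
  rw [← h, MvPowerSeries.coeff_map]
  rfl

end Functoriality

/-! ### The homomorphism Λ: existence, parity, surjectivity and uniqueness -/

section Evaluation

variable {M N : ℕ} {q : ℂ}

namespace QuantumGL

theorem coeff_l_mem (k : ℕ) (a b : Fin (M + N)) :
    PowerSeries.coeff k (l M N q) a b ∈ homPart (QuantumGL M N q) (parV M N a + parV M N b) := by
  cases k with
  | zero => rw [coeff_zero_l]; exact EndTensor.apply_mem parity_lPlus a b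
  | succ k =>
    rw [coeff_succ_l]
    exact sub_mem (EndTensor.apply_mem parity_lPlus a b) (EndTensor.apply_mem parity_lMinus a b)

variable (M N q) in
/-- The images of the generators of the quantum super Yangian in `U_q(gl(M|N))`. -/
def yangianGen : YGen M N → QuantumGL M N q
  | .T b a k => sgn (parV M N b) • PowerSeries.coeff k (l M N q) a b

variable (M N q) in
/-- The homomorphism from the free algebra on the generators of the quantum super Yangian. -/
def freeEval : FreeAlgebra ℂ (YGen M N) →ₐ[ℂ] QuantumGL M N q :=
  FreeAlgebra.lift ℂ (yangianGen M N q)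

theorem freeEval_coeff (k : ℕ) (a b : Fin (M + N)) :
    freeEval M N q (PowerSeries.coeff k (lSeries (FreeAlgebra.ι ℂ)) a b) =
      PowerSeries.coeff k (l M N q) a b := by
  rw [lSeries, PowerSeries.coeff_mk, EndTensor.mk_apply, map_zsmul, freeEval,
    FreeAlgebra.lift_ι_apply, yangianGen, smul_smul, sgn_mul_self, one_smul]

theorem freeEval_parity (x : FreeAlgebra ℂ (YGen M N)) :
    freeEval M N q (Superalgebra.parity x) = Superalgebra.parity (freeEval M N q x) := by
  rw [← AlgHom.comp_apply, ← AlgHom.comp_apply]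
  congr 1
  ext ⟨b, a, k⟩
  simp only [Function.comp_apply, AlgHom.comp_apply]
  rw [parity_ι, map_zsmul, freeEval, FreeAlgebra.lift_ι_apply, yangianGen, map_zsmul,
    mem_homPart.1 (coeff_l_mem k a b), smul_comm, add_comm (parV M N a)]
  rfl

theorem freeEval_rel (h : rllLeft q (l M N q) = rllRight q (l M N q))
    {x y : FreeAlgebra ℂ (YGen M N)} (hxy : YRel M N q x y) :
    freeEval M N q x = freeEval M N q y := by
  obtain ⟨n, a, b, c, d⟩ := hxy
  rw [map_coeff_rllLeft freeEval_parity freeEval_coeff,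
    map_coeff_rllRight freeEval_parity freeEval_coeff, h]

/-- The homomorphism from the quantum super Yangian to `U_q(gl(M|N))` with `L(x) ↦ l(x)`. -/
def eval (h : rllLeft q (l M N q) = rllRight q (l M N q)) : Yangian M N q →ₐ[ℂ] QuantumGL M N q :=
  RingQuot.liftAlgHom ℂ ⟨freeEval M N q, fun _ _ hxy => freeEval_rel h hxy⟩

theorem adjoin_gen_eq_top (S : Subalgebra ℂ (QuantumGL M N q)) (hS : ∀ x, gen M N q x ∈ S)
    (x : QuantumGL M N q) : x ∈ S := by
  obtain ⟨x, rfl⟩ := RingQuot.mkAlgHom_surjective ℂ (URel M N q) x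
  change mk M N q x ∈ S
  induction x using FreeAlgebra.induction with
  | grade0 r => rw [AlgHom.commutes]; exact S.algebraMap_mem r
  | grade1 x => exact hS x
  | mul x y hx hy => rw [map_mul]; exact mul_mem hx hy
  | add x y hx hy => rw [map_add]; exact add_mem hx hy

/-- The entries of `l⁺` and `l⁻` generate `U_q(gl(M|N))`. -/
theorem mem_of_lPlus_mem_of_lMinus_mem (hq2 : q - q⁻¹ ≠ 0) (S : Subalgebra ℂ (QuantumGL M N q))
    (hp : ∀ a b, lPlus M N q a b ∈ S) (hm : ∀ a b, lMinus M N q a b ∈ S)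
    (x : QuantumGL M N q) : x ∈ S := by
  have h1 : ∀ a, powK (gen M N q) a (parV M N a) ∈ S := fun a => by
    have := hp a a
    rwa [lPlus_apply, if_pos rfl] at this
  have h2 : ∀ a, powK (gen M N q) a (parV M N a + 1) ∈ S := fun a => by
    have := hm a a
    rwa [lMinus_apply, if_pos rfl] at this
  have h3 : ∀ a i, powK (gen M N q) a i ∈ S := fun a i => by
    rcases (by decide : ∀ i j : ZMod 2, i = j ∨ i = j + 1) i (parV M N a) with h | h
    · rw [h]; exact h1 a
    · rw [h]; exact h2 a
  refine adjoin_gen_eq_top S (fun x => ?_) x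
  cases x with
  | K a => exact h3 a 0
  | Kinv a => exact h3 a 1
  | up i =>
    have hlt : lo i < hi i := by rw [Fin.lt_def]; exact Nat.lt_succ_self _
    have h := S.smul_mem (hp (hi i) (lo i)) ((q - q⁻¹) * csgn (par M (lo i)))⁻¹
    rw [lPlus_apply, if_neg hlt.ne', if_pos hlt,
      inv_smul_smul₀ (mul_ne_zero hq2 (csgn_ne_zero _))] at h
    -- The entry of l⁺ next to the diagonal is, up to a nonzero scalar, a Cartan element times the
    -- simple root vector; the inverse Cartan element comes from the diagonal of l⁻.
    have h' := mul_mem (h2 (hi i)) h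
    rw [← mul_assoc, (powK_comm _ _ _ _).eq, powK_mul_powK, one_mul, E_of_lt hlt] at h'
    change posRoot M q (simpleUp (gen M N q)) i (i + 1) ∈ S at h'
    rwa [posRoot_self_succ, simpleUp_of_lt (by omega)] at h'
  | down i =>
    have hlt : lo i < hi i := by rw [Fin.lt_def]; exact Nat.lt_succ_self _
    have h := S.smul_mem (hm (lo i) (hi i)) (-((q - q⁻¹) * csgn (par M (hi i))))⁻¹
    rw [lMinus_apply, if_neg hlt.ne, if_pos hlt,
      inv_smul_smul₀ (neg_ne_zero.2 (mul_ne_zero hq2 (csgn_ne_zero _)))] at h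
    have h' := mul_mem h (h1 (hi i))
    rw [mul_assoc, (powK_comm _ _ _ _).eq, powK_mul_powK, mul_one, E_of_gt hlt] at h'
    change negRoot M q (simpleDown (gen M N q)) i (i + 1) ∈ S at h'
    rwa [QData.negRoot_self_succ, simpleDown_of_lt (by omega)] at h'

section Eval

variable (h : rllLeft q (l M N q) = rllRight q (l M N q))

theorem eval_mk (x : FreeAlgebra ℂ (YGen M N)) :
    eval h (RingQuot.mkAlgHom ℂ (YRel M N q) x) = freeEval M N q x :=
  RingQuot.liftAlgHom_mkAlgHom_apply ..

theorem mk_coeff_lSeries (k : ℕ) (a b : Fin (M + N)) :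
    RingQuot.mkAlgHom ℂ (YRel M N q) (PowerSeries.coeff k (lSeries (FreeAlgebra.ι ℂ)) a b) =
      PowerSeries.coeff k (Yangian.L M N q) a b := by
  rw [Yangian.L, lSeries, lSeries, PowerSeries.coeff_mk, PowerSeries.coeff_mk]
  exact map_zsmul _ _ _

theorem eval_coeff_L (k : ℕ) (a b : Fin (M + N)) :
    eval h (PowerSeries.coeff k (Yangian.L M N q) a b) = PowerSeries.coeff k (l M N q) a b := by
  rw [← mk_coeff_lSeries]
  exact (eval_mk h _).trans (freeEval_coeff k a b)

theorem eval_parity (y : Yangian M N q) :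
    eval h (Superalgebra.parity y) = Superalgebra.parity (eval h y) := by
  obtain ⟨x, rfl⟩ := RingQuot.mkAlgHom_surjective ℂ (YRel M N q) y
  have h1 := parity_mkAlgHom (YRel M N q) (YRel.homogeneous M N q) x
  calc _ = eval h (RingQuot.mkAlgHom ℂ (YRel M N q) (Superalgebra.parity x)) :=
        congrArg (eval h) h1
    _ = freeEval M N q (Superalgebra.parity x) := eval_mk h _
    _ = Superalgebra.parity (freeEval M N q x) := freeEval_parity x
    _ = _ := congrArg _ (eval_mk h x).symm

theorem eval_mem {i : ZMod 2} {y : Yangian M N q} (hy : y ∈ homPart (Yangian M N q) i) :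
    eval h y ∈ homPart (QuantumGL M N q) i := by
  rw [mem_homPart, ← eval_parity, mem_homPart.1 hy, map_zsmul]

/-- The coefficients of x⁰ and x⁻¹ in `l(x)` are l⁺ and l⁺ - l⁻, so the range contains all entries
of l⁺ and l⁻. -/
theorem eval_surjective (hq2 : q - q⁻¹ ≠ 0) : Function.Surjective (eval h) := by
  have hp : ∀ a b, lPlus M N q a b ∈ (eval h).range := fun a b => by
    rw [← coeff_zero_l, ← eval_coeff_L h]
    exact (eval h).mem_range_self _
  intro x
  refine mem_of_lPlus_mem_of_lMinus_mem hq2 (eval h).range hp (fun a b => ?_) x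
  have h1 : lPlus M N q a b - lMinus M N q a b ∈ (eval h).range := by
    have := (eval h).mem_range_self (PowerSeries.coeff 1 (Yangian.L M N q) a b)
    rwa [eval_coeff_L, coeff_succ_l, EndTensor.sub_apply] at this
  rw [← sub_sub_cancel (lPlus M N q a b) (lMinus M N q a b)]
  exact sub_mem (hp a b) h1

/-- Every generator T^b_a[k] is, up to sign, an entry of a coefficient of L(x), so its image is
prescribed. -/
theorem eval_unique {Λ : Yangian M N q →ₐ[ℂ] QuantumGL M N q}
    (hΛ : ∀ (k : ℕ) (a b : Fin (M + N)), Λ (PowerSeries.coeff k (Yangian.L M N q) a b) =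
      PowerSeries.coeff k (l M N q) a b) : Λ = eval h := by
  have h1 : ∀ x, Λ (Yangian.gen M N q x) = eval h (Yangian.gen M N q x) := by
    rintro ⟨b, a, k⟩
    have h2 := (hΛ k a b).trans (eval_coeff_L h k a b).symm
    rw [Yangian.L, lSeries, PowerSeries.coeff_mk, EndTensor.mk_apply, sgn_smul_eq, map_smul,
      map_smul] at h2
    exact smul_right_injective _ (csgn_ne_zero _) h2
  let π : FreeAlgebra ℂ (YGen M N) →ₐ[ℂ] Yangian M N q := RingQuot.mkAlgHom ℂ (YRel M N q)
  have h2 : Λ.comp π = (eval h).comp π := FreeAlgebra.hom_ext (funext h1)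
  ext y
  obtain ⟨x, rfl⟩ := RingQuot.mkAlgHom_surjective ℂ (YRel M N q) y
  exact DFunLike.congr_fun h2 x

end Eval

end QuantumGL

end Evaluation

end
end SuperYangian

theorem mainTheorem2 (M N : ℕ) (q : ℂ) (hq₀ : q ≠ 0) (hq : ∀ k : ℕ, 0 < k → q ^ k ≠ 1) :
    -- the Cartan–Weyl generators satisfy their defining recursion for every intermediate index
    (∀ a c b : Fin (M + N), a < c → c < b →
      SuperYangian.QuantumGL.E M N q a b =
          SuperYangian.QuantumGL.E M N q a c * SuperYangian.QuantumGL.E M N q c b -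
            q ^ (-SuperYangian.sgn (SuperYangian.parV M N c)) •
              (SuperYangian.QuantumGL.E M N q c b * SuperYangian.QuantumGL.E M N q a c) ∧
      SuperYangian.QuantumGL.E M N q b a =
          SuperYangian.QuantumGL.E M N q b c * SuperYangian.QuantumGL.E M N q c a -
            q ^ SuperYangian.sgn (SuperYangian.parV M N c) •
              (SuperYangian.QuantumGL.E M N q c a * SuperYangian.QuantumGL.E M N q b c)) ∧
    -- the relation `R₁₂(x) l₁(xy) l₂(y) = l₂(y) l₁(xy) R₁₂(x)`
    SuperYangian.rllLeft q (SuperYangian.QuantumGL.l M N q) =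
      SuperYangian.rllRight q (SuperYangian.QuantumGL.l M N q) ∧
    -- the homomorphism `Λ` with `Λ(L(x)) = l(x)`
    ∃ Λ : SuperYangian.Yangian M N q →ₐ[ℂ] SuperYangian.QuantumGL M N q,
      (∀ (k : ℕ) (a b : Fin (M + N)),
        Λ (PowerSeries.coeff k (SuperYangian.Yangian.L M N q) a b) =
          PowerSeries.coeff k (SuperYangian.QuantumGL.l M N q) a b) ∧
      (∀ (i : ZMod 2) (y : SuperYangian.Yangian M N q),
        y ∈ SuperYangian.homPart (SuperYangian.Yangian M N q) i →
          Λ y ∈ SuperYangian.homPart (SuperYangian.QuantumGL M N q) i) ∧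
      Function.Surjective Λ ∧
      ∀ Λ' : SuperYangian.Yangian M N q →ₐ[ℂ] SuperYangian.QuantumGL M N q,
        (∀ (k : ℕ) (a b : Fin (M + N)),
          Λ' (PowerSeries.coeff k (SuperYangian.Yangian.L M N q) a b) =
            PowerSeries.coeff k (SuperYangian.QuantumGL.l M N q) a b) → Λ' = Λ := by
  -- q = q⁻¹ would give q² = 1, and q = -q⁻¹ would give q² = -1, hence q⁴ = 1.
  have h1 : q - q⁻¹ ≠ 0 := fun h => hq 2 (by norm_num) (by
    field_simp at h
    linear_combination h)
  have h2 : q + q⁻¹ ≠ 0 := fun h => hq 4 (by norm_num) (by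
    field_simp at h
    linear_combination (q ^ 2 - 1) * h)
  have h3 := SuperYangian.QuantumGL.rllLeft_l (M := M) (N := N) hq₀ h2 h1
  exact ⟨fun a c b hac hcb => ⟨SuperYangian.QuantumGL.E_up_split hac hcb,
      SuperYangian.QuantumGL.E_down_split hq₀ hac hcb⟩, h3, SuperYangian.QuantumGL.eval h3,
    SuperYangian.QuantumGL.eval_coeff_L h3, fun _ _ hy => SuperYangian.QuantumGL.eval_mem h3 hy,
    SuperYangian.QuantumGL.eval_surjective h3 h1,
    fun _ hΛ => SuperYangian.QuantumGL.eval_unique h3 hΛ⟩
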